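/- Let $\Lambda$ be the ring of symmetric functions in infinitely many variables, with coefficients in $\mathbb{Q}(z,w)$, with power sums $p_k$, complete symmetric functions $h_\mu$, Schur functions $s_\lambda$ and Hall pairing $\langle\cdot,\cdot\rangle$. For a partition $\mu$ of $n$ let $\tilde H_\mu(\mathbf{x};q,t)$ be the modified Macdonald symmetric function, i.e. the unique symmetric function over $\mathbb{Q}(q,t)$ such that $\tilde H_\mu[X(1-q)]$ is a linear combination of the $s_\lambda$ with $\lambda\trianglerighteq\mu$, $\tilde H_\mu[X(1-t)]$ is a linear combination of the $s_\lambda$ with $\lambda\trianglerighteq\mu'$ (dominance order, $\mu'$ the conjugate partition), and $\langle\tilde H_\mu,s_{(n)}\rangle=1$; here $f[X(1-a)]$ is obtained from $f$ by $p_k\mapsto(1-a^k)p_k$. With $a(s)$, $l(s)$ the arm and leg length of a cell $s$, and with sums over all partitions $\lambda$, put $$\mathcal{H}_\lambda(z,w)=\prod_{s\in\lambda}\frac{(z^{2a(s)+1}-w^{2l(s)+1})^{2}}{(z^{2a(s)+2}-w^{2l(s)})(z^{2a(s)}-w^{2l(s)+2})},\qquad \Omega(z,w)=\sum_{\lambda}\mathcal{H}_\lambda(z,w)\,\tilde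 H_\lambda(\mathbf{x};z^2,w^2)\,T^{|\lambda|}\in\Lambda[[T]].$$ Let $\mathrm{Log}(f)=\sum_{d\ge1}\frac{\mu(d)}{d}\psi_d(\log f)$, where $\mu(d)$ is the Möbius function and $\psi_d$ is the Adams operation $p_k\mapsto p_{dk}$, $z\mapsto z^d$, $w\mapsto w^d$, $T\mapsto T^d$. For $n\ge1$ define $$\mathbb{H}_{(n-1,1)}(z,w)=(z^2-1)(1-w^2)\,\big\langle [T^n]\,\mathrm{Log}\,\Omega(z,w),\;h_{n-1}h_1\big\rangle\in\mathbb{Q}(z,w),$$ and define $\mathbb{H}^{[n]}(z,w)$ for $n\ge0$ by $$\sum_{n\ge0}\mathbb{H}^{[n]}(z,w)\,T^n=\prod_{m\ge1}\frac{(1-zwT^m)^2}{(1-z^2T^m)(1-w^2T^m)}.$$ Finally put $A_0(z,w;T)=\sum_\lambda\mathcal{H}_\lambda(z,w)T^{|\lambda|}$ and $A_1(z,w;T)=\sum_\lambda\mathcal{H}_\lambda(z,w)\phi_\lambda(z^2,w^2)T^{|\lambda|}$, where $\phi_\lambda(z,w)=\sum_{(i,j)\in\lambda}z^{j-1}w^{i-1}$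 ($i$ the row and $j$ the column of a cell, counted from $1$). Then: 1. For every $n\ge1$ the rational function $\mathbb{H}_{(n-1,1)}(z,w)$ can be specialized at $w=z^{-1}$ ($z$ an indeterminate), and $\mathbb{H}_{(n-1,1)}(z,z^{-1})=\mathbb{H}^{[n]}(z,z^{-1})$. 2. In terms of generating functions, for $w=z^{-1}$, $$1+(z^2-1)(1-w^2)\frac{A_1(z,w;T)}{A_0(z,w;T)}=\prod_{m\ge1}\frac{(1-zwT^m)^2}{(1-z^2T^m)(1-w^2T^m)}.$$ 3. For every $n\ge1$ the rational function $\mathbb{H}_{(n-1,1)}(z,w)$ can be specialized at $z=0$ ($w$ an indeterminate), and $\mathbb{H}_{(n-1,1)}(0,w)=\mathbb{H}^{[n]}(0,w)$. -/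

import Mathlib

noncomputable section

namespace HilbChar

/-! ### Partitions, arm and leg lengths

Partitions are drawn as Young diagrams: the cell `(i, j)` lies in row `i` and column `j` (both
counted from `0`), and row `i` has length `λ_{i+1}`. -/

/-- The Young diagram whose row lengths are the parts of `lam`, in weakly decreasing order. -/
def diagram {n : ℕ} (lam : n.Partition) : YoungDiagram :=
  YoungDiagram.ofRowLens (lam.parts.sort (· ≥ ·)) (Multiset.pairwise_sort _ _).sortedGE

/-- The arm length of a cell: the number of cells to its right in the same row. -/
def arm (D : YoungDiagram) (s : ℕ × ℕ) : ℕ := D.rowLen s.1 - (s.2 + 1)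

/-- The leg length of a cell: the number of cells below it in the same column. -/
def leg (D : YoungDiagram) (s : ℕ × ℕ) : ℕ := D.colLen s.2 - (s.1 + 1)

/-- The dominance order: `D ⊵ E`. -/
def Dominates (D E : YoungDiagram) : Prop :=
  ∀ k : ℕ, ∑ i ∈ Finset.range k, E.rowLen i ≤ ∑ i ∈ Finset.range k, D.rowLen i

/-- The partition `(n-1,1)` of `n ≥ 1`; for `n = 1` the zero part is dropped and it is `(1)`. -/
def almostRow (n : ℕ) (hn : 1 ≤ n) : n.Partition :=
  Nat.Partition.ofSums n {n - 1, 1} (by simp; omega)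

/-! ### Symmetric functions -/

/-- The ring of symmetric functions in infinitely many variables, with coefficients in a field `K`
of characteristic zero, as the polynomial ring over `K` in the power sums `p_1, p_2, …`: the
variable `X k` is `p_k`. -/
abbrev Sym (K : Type*) [Field K] : Type _ := MvPolynomial ℕ+ K

section SymmetricFunctions

variable {K : Type*} [Field K]

/-- `z_ρ = ∏ i ^ (m_i) * (m_i)!` for the partition `ρ` in which `i` has multiplicity `m i`. -/
def zee (m : ℕ+ →₀ ℕ) : ℕ := m.prod fun i a => (i : ℕ) ^ a * a.factorial

/-- The Hall pairing: the bilinear form with `⟨p_ρ, p_σ⟩ = δ_{ρσ} z_ρ`. -/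
def hall (f g : Sym K) : K := ∑ m ∈ f.support, f.coeff m * g.coeff m * (zee m : K)

/-- The complete symmetric function `h_n = ∑_{ρ ⊢ n} p_ρ / z_ρ`. -/
def complete (n : ℕ) : Sym K :=
  ∑ rho : n.Partition,
    MvPolynomial.monomial (Multiset.toFinsupp (rho.parts.map Nat.toPNat'))
      ((zee (Multiset.toFinsupp (rho.parts.map Nat.toPNat')) : K)⁻¹)

/-- `h_m` for an integer `m`, zero if `m < 0`. -/
def completeInt (m : ℤ) : Sym K := if 0 ≤ m then complete m.toNat else 0

/-- `h_μ = ∏ h_{μ_i}`. -/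
def completeProd {n : ℕ} (mu : n.Partition) : Sym K := (mu.parts.map complete).prod

/-- The Schur function `s_λ = det (h_{λ_i - i + j})`. -/
def schur (D : YoungDiagram) : Sym K :=
  Matrix.det (Matrix.of fun i j : Fin D.card =>
    completeInt (K := K) ((D.rowLen i : ℤ) - (i : ℤ) + (j : ℤ)))

/-- The plethystic substitution `f ↦ f[X (1 - a)]`, that is `p_k ↦ (1 - a ^ k) p_k`. -/
def plethOneSub (a : K) : Sym K →ₐ[K] Sym K :=
  MvPolynomial.aeval fun k : ℕ+ => MvPolynomial.C (1 - a ^ (k : ℕ)) * MvPolynomial.X k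

/-- The span of the Schur functions `s_λ` with `|λ| = |μ|` and `λ ⊵ μ`. -/
def schurAbove (D : YoungDiagram) : Submodule K (Sym K) :=
  Submodule.span K (schur '' {E | E.card = D.card ∧ Dominates E D})

/-- The defining properties of the (modified) Macdonald symmetric function `H̃_μ(x; q, t)`:
`H̃_μ[X(1-q)]` is a combination of the `s_λ` with `λ ⊵ μ`, `H̃_μ[X(1-t)]` is a combination of the
`s_λ` with `λ ⊵ μ'`, and the coefficient of `s_(n)` in `H̃_μ`, i.e. `⟨H̃_μ, h_n⟩`, is `1`. -/
def IsMacdonald (q t : K) (D : YoungDiagram) (H : Sym K) : Prop :=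
  plethOneSub q H ∈ schurAbove (K := K) D ∧
  plethOneSub t H ∈ schurAbove (K := K) D.transpose ∧
  hall H (complete D.card) = 1

open Classical in
/-- The (modified) Macdonald symmetric function `H̃_μ(x; q, t)`, the unique one with the defining
properties; used for `q`, `t` algebraically independent over `ℚ`. -/
def macdonald (q t : K) (D : YoungDiagram) : Sym K :=
  if h : ∃! H : Sym K, IsMacdonald q t D H then h.choose else 0

/-! ### Functions of two elements `z`, `w` of a field -/

/-- The genus `g` hook function `𝓗_λ(z, w)`. -/
def hook (g : ℕ) (z w : K) (D : YoungDiagram) : K :=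
  ∏ s ∈ D.cells,
    (z ^ (2 * arm D s + 1) - w ^ (2 * leg D s + 1)) ^ (2 * g) /
      ((z ^ (2 * arm D s + 2) - w ^ (2 * leg D s)) *
        (z ^ (2 * arm D s) - w ^ (2 * leg D s + 2)))

/-- `φ_λ(z, w)`, the sum of `z ^ j * w ^ i` over the cells `(i, j)` (rows and columns from `0`). -/
def phi (z w : K) (D : YoungDiagram) : K := ∑ s ∈ D.cells, z ^ s.2 * w ^ s.1

/-- `A_0(z, w; T) = ∑_λ 𝓗_λ(z, w) T ^ |λ|`, in genus one. -/
def seriesA0 (z w : K) : PowerSeries K :=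
  PowerSeries.mk fun n => ∑ lam : n.Partition, hook 1 z w (diagram lam)

/-- `A_1(z, w; T) = ∑_λ 𝓗_λ(z, w) φ_λ(z², w²) T ^ |λ|`, in genus one. -/
def seriesA1 (z w : K) : PowerSeries K :=
  PowerSeries.mk fun n =>
    ∑ lam : n.Partition, hook 1 z w (diagram lam) * phi (z ^ 2) (w ^ 2) (diagram lam)

/-- `ℍ^{[n]}(z, w)`: the coefficient of `T ^ n` in
`∏_{m ≥ 1} (1 - z w T^m)² / ((1 - z² T^m) (1 - w² T^m))`. The factors with `m > n` are congruent to
`1` modulo `T ^ (n + 1)` and do not contribute. -/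
def hilbH (n : ℕ) (z w : K) : K :=
  PowerSeries.coeff n (∏ m ∈ Finset.Icc 1 n,
    (1 - PowerSeries.C (z * w) * PowerSeries.X ^ m) ^ 2 *
      ((1 - PowerSeries.C (z ^ 2) * PowerSeries.X ^ m) *
        (1 - PowerSeries.C (w ^ 2) * PowerSeries.X ^ m))⁻¹)

end SymmetricFunctions

/-! ### The rational functions `ℍ_μ(z, w)`, for one puncture -/

/-- The field `ℚ(z, w)`. -/
abbrev Qzw : Type := FractionRing (MvPolynomial (Fin 2) ℚ)

/-- The variable `z` of `ℚ(z, w)`. -/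
def zVar : Qzw := algebraMap (MvPolynomial (Fin 2) ℚ) Qzw (MvPolynomial.X 0)

/-- The variable `w` of `ℚ(z, w)`. -/
def wVar : Qzw := algebraMap (MvPolynomial (Fin 2) ℚ) Qzw (MvPolynomial.X 1)

/-- The Adams operation on `ℚ(z, w)`: `f(z, w) ↦ f(z ^ d, w ^ d)`. -/
def adamsQ (d : ℕ+) : Qzw →+* Qzw :=
  IsFractionRing.map (A := MvPolynomial (Fin 2) ℚ) (B := MvPolynomial (Fin 2) ℚ)
    (j := (MvPolynomial.expand (d : ℕ) : MvPolynomial (Fin 2) ℚ →ₐ[ℚ] _).toRingHom)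
    (MvPolynomial.expand_injective d.pos)

/-- The Adams operation on symmetric functions over `ℚ(z, w)`:
`p_k ↦ p_{dk}`, `z ↦ z ^ d`, `w ↦ w ^ d`. -/
def adams (d : ℕ+) : Sym Qzw →+* Sym Qzw :=
  MvPolynomial.eval₂Hom (MvPolynomial.C.comp (adamsQ d)) fun k => MvPolynomial.X (d * k)

/-- `Log f = ∑_{d ≥ 1} μ(d) / d • ψ_d (log f)`, where the Adams operation `ψ_d` of the power series
ring acts on coefficients by `adams d` and maps `T` to `T ^ d`; so the coefficient of `T ^ n` is a
sum over the divisors `d` of `n`. -/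
def plethLog (f : PowerSeries (Sym Qzw)) : PowerSeries (Sym Qzw) :=
  PowerSeries.mk fun n => ∑ d ∈ n.divisors,
    ((ArithmeticFunction.moebius d : ℚ) / (d : ℚ)) •
      adams d.toPNat' (PowerSeries.coeff (n / d) (PowerSeries.logOf f))

/-- `Ω(z, w) = ∑_λ 𝓗_λ(z, w) H̃_λ(x; z², w²) T ^ |λ|` in genus `g` with one puncture. -/
def Omega (g : ℕ) : PowerSeries (Sym Qzw) :=
  PowerSeries.mk fun n => ∑ lam : n.Partition,
    hook g zVar wVar (diagram lam) • macdonald (zVar ^ 2) (wVar ^ 2) (diagram lam)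

/-- `ℍ_μ(z, w) = (z² - 1) (1 - w²) ⟨Log Ω(z, w), h_μ⟩` in genus `g` with one puncture. Only the
part of degree `n = |μ|`, which is the coefficient of `T ^ n`, pairs non-trivially with `h_μ`. -/
def charH (g : ℕ) {n : ℕ} (mu : n.Partition) : Qzw :=
  (zVar ^ 2 - 1) * (1 - wVar ^ 2) *
    hall (PowerSeries.coeff n (plethLog (Omega g))) (completeProd mu)

/-- The rational function `f(z, w)` is defined at the point `(a, b)` of a field `L ⊇ ℚ` and its value
there is `v`: it is a quotient of polynomials `P / Q` with `Q(a, b) ≠ 0` and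
`v = P(a, b) / Q(a, b)`. There is at most one such `v`. -/
def HasValueAt {L : Type*} [Field L] [Algebra ℚ L] (f : Qzw) (a b v : L) : Prop :=
  ∃ P Q : MvPolynomial (Fin 2) ℚ,
    MvPolynomial.aeval ![a, b] Q ≠ 0 ∧
    f = algebraMap _ Qzw P / algebraMap _ Qzw Q ∧
    v = MvPolynomial.aeval ![a, b] P / MvPolynomial.aeval ![a, b] Q

end HilbChar

end

/-!
The modified Macdonald functions are the eigenvectors of the operator
`f ↦ [u⁰] f[X + (1-q)(1-t)/u] Ω[-uX]`. Conjugated by the plethysm `X ↦ X(1-q)`, it is triangular on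
the Schur functions for the dominance order, because it multiplies each term of a Jacobi–Trudi
determinant by a scalar; its eigenvalue on `s_λ` is `1 - (1-q)(1-t) φ_λ(q,t)`. As the operator is
symmetric in `q` and `t`, a single eigenvector satisfies both triangularity conditions. The
eigenvalues are distinct and the eigenvectors can be normalized for generic `q`, `t`, since both
already hold at `t = 1/q`. Pairing the eigenvector equation with `h_n` gives
`⟨H̃_λ, h_{n-1} h_1⟩ = φ_λ(q,t)`.

The pairing with `h_{n-1} h_1` is the derivation `f ↦ (∂f/∂p_1)[1]`, which annihilates the image of
`ψ_d` for `d > 1`. Hence `Log Ω` contributes only through `log Ω`, whose image is `A_1 / A_0`, and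
`1 + (z²-1)(1-w²) A_1 / A_0` is the quotient by `A_0` of the series
`∑ 𝓗_λ (1 - (1-z²)(1-w²) φ_λ(z²,w²)) T^|λ|`. On `w = 1/z` every `𝓗_λ` is `1`, and an Abel
summation over the columns of `λ` turns this series into a `T`-binomial series. On `z = 0` the hook
factors depend only on the multiplicities of the parts, and both series are products over the part
sizes.
-/

noncomputable section

namespace HilbChar

open scoped Polynomial PowerSeries
open Finset (range)
open Finset.HasAntidiagonal (antidiagonal mem_antidiagonal)

/-! ### Complete symmetric functions -/

/-- The weight of a monomial in the power sums, where `p_k` has weight `k`. -/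
abbrev weight : (ℕ+ →₀ ℕ) →+ ℕ := Finsupp.weight fun k : ℕ+ => (k : ℕ)

/-- The exponent vector of the monomial `p_ρ` in the power sums. -/
def partExponents {n : ℕ} (rho : n.Partition) : ℕ+ →₀ ℕ :=
  Multiset.toFinsupp (rho.parts.map Nat.toPNat')

lemma weight_toFinsupp (s : Multiset ℕ+) :
    weight (Multiset.toFinsupp s) = (s.map fun k : ℕ+ => (k : ℕ)).sum := by
  induction s using Multiset.induction with
  | empty => simp
  | cons a s ih =>
    rw [← Multiset.singleton_add, map_add, map_add, ih, Multiset.toFinsupp_singleton]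
    simp [Finsupp.weight_single]

lemma map_toPNat'_map_coe {n : ℕ} (rho : n.Partition) :
    (rho.parts.map Nat.toPNat').map (fun k : ℕ+ => (k : ℕ)) = rho.parts := by
  rw [Multiset.map_map]
  refine (Multiset.map_congr rfl fun x hx => ?_).trans (Multiset.map_id _)
  simp [Nat.toPNat'_coe, rho.parts_pos hx]

lemma weight_partExponents {n : ℕ} (rho : n.Partition) : weight (partExponents rho) = n := by
  rw [partExponents, weight_toFinsupp, map_toPNat'_map_coe, rho.parts_sum]

lemma partExponents_injective (n : ℕ) : Function.Injective (partExponents (n := n)) := by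
  intro a b h
  ext1
  rw [← map_toPNat'_map_coe a, Multiset.toFinsupp.injective h, map_toPNat'_map_coe]

lemma exists_partExponents_eq {n : ℕ} {m : ℕ+ →₀ ℕ} (hm : weight m = n) :
    ∃ rho : n.Partition, partExponents rho = m := by
  refine ⟨⟨(Finsupp.toMultiset m).map fun k : ℕ+ => (k : ℕ), ?_, ?_⟩, ?_⟩
  · intro i hi
    obtain ⟨k, -, rfl⟩ := Multiset.mem_map.1 hi
    exact k.pos
  · rw [← weight_toFinsupp, Finsupp.toMultiset_toFinsupp, hm]
  · have hid : (Nat.toPNat' ∘ fun k : ℕ+ => (k : ℕ)) = id := by ext k; simp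
    rw [partExponents, Multiset.map_map, hid, Multiset.map_id, Finsupp.toMultiset_toFinsupp]

lemma weight_eq_zero_iff {m : ℕ+ →₀ ℕ} : weight m = 0 ↔ m = 0 := by
  refine ⟨fun h => Finsupp.ext fun k => ?_, fun h => by simp [h]⟩
  have hk := Finsupp.le_weight (fun k : ℕ+ => (k : ℕ)) k.ne_zero m
  exact Nat.le_zero.1 (hk.trans h.le)

lemma weight_eq_sum_range (m : ℕ+ →₀ ℕ) :
    weight m = ∑ i ∈ range (weight m), (i + 1) * m i.succPNat := by
  have hs : weight m = ∑ k ∈ m.support, m k * (k : ℕ) := by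
    simp [weight, Finsupp.weight_apply, Finsupp.sum]
  conv_lhs => rw [hs]
  refine Finset.sum_of_injOn PNat.natPred ?_ ?_ ?_ ?_
  · intro a _ b _ h
    simpa using h
  · intro k hk
    have hle : (k : ℕ) ≤ weight m :=
      Finsupp.le_weight_of_ne_zero' _ (Finsupp.mem_support_iff.1 hk)
    have := k.natPred_add_one
    simp only [Finset.coe_range, Set.mem_Iio]
    omega
  · intro i _ hi
    have : i.succPNat ∉ m.support := fun h => hi ⟨_, h, by simp⟩
    simp [Finsupp.notMem_support_iff.1 this]
  · intro k _
    simp [mul_comm]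

lemma zee_pos (m : ℕ+ →₀ ℕ) : 0 < zee m :=
  Finset.prod_pos fun i _ => Nat.mul_pos (Nat.pow_pos i.pos) (Nat.factorial_pos _)

lemma zee_eq_mul_zee_sub_single {m : ℕ+ →₀ ℕ} {k : ℕ+} (hk : m k ≠ 0) :
    zee m = k * m k * zee (m - Finsupp.single k 1) := by
  obtain ⟨a, ha⟩ := Nat.exists_eq_succ_of_ne_zero hk
  have herase : (m - Finsupp.single k 1).erase k = m.erase k := by
    ext i
    rcases eq_or_ne i k with rfl | h <;> simp [*]
  rw [zee, zee, ← Finsupp.mul_prod_erase' m k _ fun _ => by simp,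
    ← Finsupp.mul_prod_erase' (m - Finsupp.single k 1) k _ fun _ => by simp, herase]
  simp only [ha, Finsupp.coe_tsub, Pi.sub_apply, Finsupp.single_eq_same, Nat.succ_sub_one,
    Nat.succ_eq_add_one, Nat.factorial_succ, pow_succ]
  ring

section Complete

variable {K : Type*} [Field K]

lemma coeff_complete (n : ℕ) (m : ℕ+ →₀ ℕ) :
    (complete (K := K) n).coeff m = if weight m = n then (zee m : K)⁻¹ else 0 := by
  classical
  have hsum : complete (K := K) n = ∑ rho : n.Partition,
      MvPolynomial.monomial (partExponents rho) ((zee (partExponents rho) : K)⁻¹) := rfl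
  rw [hsum, MvPolynomial.coeff_sum]
  simp only [MvPolynomial.coeff_monomial]
  split_ifs with h
  · obtain ⟨rho, rfl⟩ := exists_partExponents_eq h
    rw [Finset.sum_eq_single_of_mem rho (Finset.mem_univ _) fun b _ hb =>
      if_neg fun h => hb (partExponents_injective _ h), if_pos rfl]
  · refine Finset.sum_eq_zero fun rho _ => if_neg ?_
    rintro rfl
    exact h (weight_partExponents rho)

lemma complete_zero : complete (K := K) 0 = 1 := by
  ext m
  rw [coeff_complete, MvPolynomial.coeff_one]
  simp only [weight_eq_zero_iff, eq_comm (a := (0 : ℕ+ →₀ ℕ))]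
  split_ifs with h
  · simp [h, zee]
  · rfl

lemma isWeightedHomogeneous_complete (n : ℕ) :
    (complete (K := K) n).IsWeightedHomogeneous (fun k : ℕ+ => (k : ℕ)) n := by
  intro m hm
  by_contra h
  exact hm ((coeff_complete n m).trans (if_neg h))

variable [CharZero K]

lemma coeff_X_mul_complete {n i : ℕ} (hi : i ≤ n) (m : ℕ+ →₀ ℕ) :
    MvPolynomial.coeff m ((MvPolynomial.X i.succPNat : Sym K) * complete (n - i)) =
      if weight m = n + 1 then (((i + 1) * m i.succPNat : ℕ) : K) * (zee m : K)⁻¹ else 0 := by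
  classical
  rw [MvPolynomial.coeff_X_mul']
  by_cases h : m i.succPNat = 0
  · simp [h]
  have hle : Finsupp.single i.succPNat 1 ≤ m := by simpa using Nat.one_le_iff_ne_zero.2 h
  have hw : weight (m - Finsupp.single i.succPNat 1) + (i + 1) = weight m := by
    conv_rhs => rw [← tsub_add_cancel_of_le hle, map_add]
    simp [Finsupp.weight_single]
  rw [if_pos (by simpa using h), coeff_complete]
  by_cases hm : weight m = n + 1
  · have hz : (zee (m - Finsupp.single i.succPNat 1) : K) ≠ 0 := mod_cast (zee_pos _).ne'
    have hm0 : (m i.succPNat : K) ≠ 0 := mod_cast h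
    have hi0 : (i : K) + 1 ≠ 0 := mod_cast Nat.succ_ne_zero i
    rw [if_pos hm, if_pos (by omega), zee_eq_mul_zee_sub_single h]
    push_cast
    simp only [Nat.succPNat_coe, Nat.succ_eq_add_one, Nat.cast_add, Nat.cast_one]
    field_simp
  · rw [if_neg hm, if_neg (by omega)]

lemma succ_mul_complete_succ (n : ℕ) :
    ((n : Sym K) + 1) * complete (n + 1) =
      ∑ x ∈ antidiagonal n, MvPolynomial.X x.1.succPNat * complete x.2 := by
  ext m
  have hC : (n : Sym K) + 1 = MvPolynomial.C ((n : K) + 1) := by simp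
  rw [hC, MvPolynomial.coeff_C_mul, MvPolynomial.coeff_sum, coeff_complete,
    Finset.Nat.sum_antidiagonal_eq_sum_range_succ
      fun i j => MvPolynomial.coeff m ((MvPolynomial.X i.succPNat : Sym K) * complete j),
    Finset.sum_congr rfl fun i hi =>
      coeff_X_mul_complete (Nat.lt_succ_iff.1 (Finset.mem_range.1 hi)) m]
  split_ifs with h
  · have hsum := weight_eq_sum_range m
    rw [h] at hsum
    rw [← Finset.sum_mul, ← Nat.cast_sum, ← hsum]
    push_cast
    ring
  · simp

end Complete

/-! ### The generating series of the complete symmetric functions -/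

lemma eq_of_derivative_eq_mul {R : Type*} [CommRing R] [IsAddTorsionFree R] {P F G : R⟦X⟧}
    (hF : PowerSeries.derivative R F = P * F) (hG : PowerSeries.derivative R G = P * G)
    (h0 : PowerSeries.constantCoeff F = PowerSeries.constantCoeff G) : F = G := by
  ext n
  induction n using Nat.strong_induction_on with
  | _ n ih =>
    obtain _ | n := n
    · simpa using h0
    have hFn := congrArg (PowerSeries.coeff n) hF
    have hGn := congrArg (PowerSeries.coeff n) hG
    rw [PowerSeries.coeff_derivative, PowerSeries.coeff_mul] at hFn hGn
    refine nsmul_right_injective n.succ_ne_zero ?_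
    simp only [Nat.succ_eq_add_one, nsmul_eq_mul, Nat.cast_add, Nat.cast_one]
    rw [mul_comm, hFn, mul_comm, hGn]
    refine Finset.sum_congr rfl fun x hx => ?_
    have := mem_antidiagonal.1 hx
    rw [ih x.2 (by omega)]

lemma derivative_map {R S : Type*} [CommRing R] [CommRing S] (f : R →+* S) (F : R⟦X⟧) :
    PowerSeries.derivative S (F.map f) = (PowerSeries.derivative R F).map f := by
  ext n
  simp [PowerSeries.coeff_derivative]

section Series

variable (K : Type*) [Field K]

/-- The generating series `H(u) = ∑ h_n u^n` of the complete symmetric functions. -/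
def hSeries : (Sym K)⟦X⟧ := PowerSeries.mk complete

/-- The generating series `∑ p_{n+1} u^n` of the power sums, the logarithmic derivative of `H`. -/
def pSeries : (Sym K)⟦X⟧ := PowerSeries.mk fun n => MvPolynomial.X n.succPNat

/-- The series `1 / H(u) = ∑ (-1)^n e_n u^n` of the elementary symmetric functions. -/
def eSeries : (Sym K)⟦X⟧ := PowerSeries.invOfUnit (hSeries K) 1

lemma constantCoeff_hSeries : PowerSeries.constantCoeff (hSeries K) = 1 := by
  rw [← PowerSeries.coeff_zero_eq_constantCoeff_apply, hSeries, PowerSeries.coeff_mk, complete_zero]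

lemma hSeries_mul_eSeries : hSeries K * eSeries K = 1 :=
  PowerSeries.mul_invOfUnit _ _ (by simpa using constantCoeff_hSeries K)

variable [CharZero K]

lemma derivative_hSeries :
    PowerSeries.derivative (Sym K) (hSeries K) = pSeries K * hSeries K := by
  ext1 n
  rw [PowerSeries.coeff_derivative, PowerSeries.coeff_mul, hSeries, pSeries]
  simp only [PowerSeries.coeff_mk]
  rw [mul_comm, succ_mul_complete_succ]

variable {K} {A : Type*} [CommRing A]

lemma map_complete_eq_pow_mul [IsAddTorsionFree A] {φ ψ : Sym K →+* A} {y : A}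
    (h : ∀ k : ℕ+, φ (.X k) = y ^ (k : ℕ) * ψ (.X k)) (n : ℕ) :
    φ (complete n) = y ^ n * ψ (complete n) := by
  induction n using Nat.strong_induction_on with
  | _ n ih =>
    obtain _ | n := n
    · simp [complete_zero]
    have hφ := congrArg φ (succ_mul_complete_succ (K := K) n)
    have hψ := congrArg ψ (succ_mul_complete_succ (K := K) n)
    simp only [map_mul, map_add, map_natCast, map_one, map_sum] at hφ hψ
    refine nsmul_right_injective n.succ_ne_zero ?_
    simp only [Nat.succ_eq_add_one, nsmul_eq_mul, Nat.cast_add, Nat.cast_one]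
    rw [hφ, mul_left_comm, hψ, Finset.mul_sum]
    refine Finset.sum_congr rfl fun x hx => ?_
    have hx := mem_antidiagonal.1 hx
    rw [h, ih x.2 (by omega), ← hx, Nat.succPNat_coe, Nat.succ_eq_add_one]
    ring

/-- In plethystic notation, `H[X + Y] = H[X] H[Y]`. -/
lemma map_hSeries_eq_mul [IsAddTorsionFree A] {φ ψ χ : Sym K →+* A}
    (h : ∀ k, φ (.X k) = ψ (.X k) + χ (.X k)) :
    (hSeries K).map φ = (hSeries K).map ψ * (hSeries K).map χ := by
  have hp : (pSeries K).map φ = (pSeries K).map ψ + (pSeries K).map χ := by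
    ext n
    simp [pSeries, h]
  have hconst (θ : Sym K →+* A) : PowerSeries.constantCoeff ((hSeries K).map θ) = 1 := by
    rw [← PowerSeries.coeff_zero_eq_constantCoeff_apply, PowerSeries.coeff_map,
      PowerSeries.coeff_zero_eq_constantCoeff_apply, constantCoeff_hSeries, map_one]
  refine eq_of_derivative_eq_mul (P := (pSeries K).map φ) ?_ ?_ ?_
  · rw [derivative_map, derivative_hSeries, map_mul]
  · rw [Derivation.leibniz, derivative_map, derivative_map, derivative_hSeries, map_mul, map_mul,
      hp, smul_eq_mul, smul_eq_mul]
    ring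
  · rw [map_mul, hconst, hconst, hconst, mul_one]

lemma aeval_pow_complete [Algebra K A] [IsAddTorsionFree A] (y : A) (n : ℕ) :
    MvPolynomial.aeval (fun k : ℕ+ => y ^ (k : ℕ)) (complete (K := K) n) = y ^ n := by
  have hone : ∀ n, MvPolynomial.aeval (fun _ : ℕ+ => (1 : A)) (complete (K := K) n) = 1 := by
    intro n
    induction n using Nat.strong_induction_on with
    | _ n ih =>
      obtain _ | n := n
      · simp [complete_zero]
      have h := congrArg (MvPolynomial.aeval fun _ : ℕ+ => (1 : A))
        (succ_mul_complete_succ (K := K) n)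
      simp only [map_mul, map_add, map_natCast, map_one, map_sum, MvPolynomial.aeval_X,
        one_mul] at h
      rw [Finset.sum_congr rfl fun x hx => ih x.2 (by have := mem_antidiagonal.1 hx; omega),
        Finset.sum_const, Finset.Nat.card_antidiagonal, nsmul_one] at h
      refine nsmul_right_injective n.succ_ne_zero ?_
      simpa using h
  have h := map_complete_eq_pow_mul (K := K) (y := y)
    (φ := (MvPolynomial.aeval fun k : ℕ+ => y ^ (k : ℕ)).toRingHom)
    (ψ := (MvPolynomial.aeval fun _ : ℕ+ => (1 : A)).toRingHom) (fun k => by simp) n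
  simpa [hone] using h

end Series

/-! ### The vertex operator of the modified Macdonald functions -/

/-- The `R`-linear functional on polynomials in `y` with `y^k ↦ a_k`, that is, the constant term of
the product with `a(1/y)`. -/
def contract {R : Type*} [CommRing R] (a : R⟦X⟧) : R[X] →ₗ[R] R :=
  Polynomial.lsum fun k => LinearMap.id.smulRight (PowerSeries.coeff k a)

section Contract

variable {R : Type*} [CommRing R] (a : R⟦X⟧)

lemma contract_C_mul_X_pow (f : R) (k : ℕ) :
    contract a (.C f * .X ^ k) = f * PowerSeries.coeff k a := by
  rw [contract, Polynomial.C_mul_X_pow_eq_monomial]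
  simp [Polynomial.lsum_apply]

lemma contract_C_mul (f : R) (g : R[X]) : contract a (.C f * g) = f * contract a g := by
  rw [← Polynomial.smul_eq_C_mul, map_smul, smul_eq_mul]

lemma map_contract {S : Type*} [CommRing S] (φ : R →+* S) (g : R[X]) :
    φ (contract a g) = contract (a.map φ) (g.map φ) := by
  induction g using Polynomial.induction_on' with
  | add f g hf hg => simp [hf, hg]
  | monomial n b =>
    rw [Polynomial.map_monomial, ← Polynomial.C_mul_X_pow_eq_monomial,
      ← Polynomial.C_mul_X_pow_eq_monomial, contract_C_mul_X_pow, contract_C_mul_X_pow, map_mul,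
      PowerSeries.coeff_map]

lemma contract_det_updateCol {ι : Type*} [Fintype ι] [DecidableEq ι] (M : Matrix ι ι R) (r : ι)
    (v : ι → R[X]) :
    contract a ((M.map Polynomial.C).updateCol r v).det =
      (M.updateCol r fun i => contract a (v i)).det := by
  have hadj : (M.map Polynomial.C).adjugate = M.adjugate.map Polynomial.C :=
    (RingHom.map_adjugate Polynomial.C M).symm
  simp only [← Matrix.cramer_apply, Matrix.cramer_eq_adjugate_mulVec, Matrix.mulVec, dotProduct,
    hadj, Matrix.map_apply, map_sum, contract_C_mul]

end Contract

section VertexOperator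

variable {K : Type*} [Field K]

/-- The translation `p_k ↦ p_k + c_k y^k`. -/
def translate (c : ℕ+ → K) : Sym K →ₐ[K] (Sym K)[X] :=
  MvPolynomial.aeval fun k : ℕ+ => .C (.X k) + .C (.C (c k)) * .X ^ (k : ℕ)

/-- The vertex operator that translates by `c` and then contracts the powers of `y` with `a`. -/
def vertexOp (c : ℕ+ → K) (a : (Sym K)⟦X⟧) : Sym K →ₗ[K] Sym K :=
  ((contract a).restrictScalars K).comp (translate c).toLinearMap

/-- The series `∑ h_n[X(q-1)] u^n = H(q u) / H(u)`. -/
def qSeries (q : K) : (Sym K)⟦X⟧ := (eSeries K).map (plethOneSub q : Sym K →+* Sym K)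

/-- The operator `f ↦ [u⁰] f[X + (1-q)(1-t)/u] Ω[-uX]`, where `Ω[-uX] = 1 / H(u)`; its eigenvectors
are the modified Macdonald functions. -/
def macOp (q t : K) : Sym K →ₗ[K] Sym K :=
  vertexOp (fun k => (1 - q ^ (k : ℕ)) * (1 - t ^ (k : ℕ))) (eSeries K)

/-- The conjugate of `macOp q t` by the plethysm `X ↦ X(1-q)`. -/
def macOpConj (q t : K) : Sym K →ₗ[K] Sym K :=
  vertexOp (fun k => 1 - t ^ (k : ℕ)) (qSeries q)

lemma macOp_comm (q t : K) : macOp q t = macOp t q := by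
  simp only [macOp, mul_comm]

lemma translate_X (c : ℕ+ → K) (k : ℕ+) :
    translate c (.X k) = .C (.X k) + .C (.C (c k)) * .X ^ (k : ℕ) := by
  simp [translate]

lemma plethOneSub_X (q : K) (k : ℕ+) :
    plethOneSub q (.X k) = .C (1 - q ^ (k : ℕ)) * .X k := by
  simp [plethOneSub]

lemma map_plethOneSub_translate (q t : K) (f : Sym K) :
    (translate (fun k => (1 - q ^ (k : ℕ)) * (1 - t ^ (k : ℕ))) f).map
        (plethOneSub q : Sym K →+* Sym K) =
      translate (fun k => 1 - t ^ (k : ℕ)) (plethOneSub q f) := by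
  have h : (Polynomial.mapAlgHom (plethOneSub q)).comp
        (translate fun k => (1 - q ^ (k : ℕ)) * (1 - t ^ (k : ℕ))) =
      (translate fun k => 1 - t ^ (k : ℕ)).comp (plethOneSub q) := by
    ext1 k
    have hC (a : K) : translate (fun k => 1 - t ^ (k : ℕ)) (.C a) = .C (.C a) :=
      (translate _).commutes a
    simp only [AlgHom.comp_apply, translate_X, plethOneSub_X, map_mul, hC]
    simp [plethOneSub_X]
    ring
  exact DFunLike.congr_fun h f

lemma plethOneSub_macOp (q t : K) (f : Sym K) :
    plethOneSub q (macOp q t f) = macOpConj q t (plethOneSub q f) :=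
  (map_contract _ (plethOneSub q : Sym K →+* Sym K) _).trans
    (congrArg (contract _) (map_plethOneSub_translate q t f))

variable [CharZero K]

lemma qSeries_mul_hSeries (q : K) :
    qSeries q * hSeries K = PowerSeries.mk fun n => .C (q ^ n) * complete n := by
  set dil : Sym K →ₐ[K] Sym K := MvPolynomial.aeval fun k => .C (q ^ (k : ℕ)) * .X k with hdil
  have hsplit : hSeries K = (hSeries K).map (plethOneSub q : Sym K →+* Sym K) *
      (hSeries K).map (dil : Sym K →+* Sym K) := by
    rw [← map_hSeries_eq_mul (φ := RingHom.id _), PowerSeries.map_id]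
    · rfl
    intro k
    simp [hdil, plethOneSub_X]
    ring
  have hdilH : (hSeries K).map (dil : Sym K →+* Sym K) =
      PowerSeries.mk fun n => .C (q ^ n) * complete n := by
    ext1 n
    rw [PowerSeries.coeff_map, hSeries, PowerSeries.coeff_mk, PowerSeries.coeff_mk, map_pow]
    exact map_complete_eq_pow_mul (φ := (dil : Sym K →+* Sym K)) (ψ := RingHom.id _)
      (fun k => by simp [hdil]) n
  calc qSeries q * hSeries K
      = ((hSeries K * eSeries K).map (plethOneSub q : Sym K →+* Sym K)) *
          (hSeries K).map (dil : Sym K →+* Sym K) := by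
        conv_lhs => rw [hsplit]
        rw [qSeries, map_mul]
        ring
    _ = _ := by rw [hSeries_mul_eSeries, map_one, one_mul, hdilH]

lemma coeff_zero_qSeries (q : K) : PowerSeries.coeff 0 (qSeries q) = 1 := by
  have h := congrArg (PowerSeries.coeff 0) (qSeries_mul_hSeries q)
  simpa [complete_zero, constantCoeff_hSeries] using h

end VertexOperator

section TranslateComplete

variable {K : Type*} [Field K]

lemma completeInt_natCast (n : ℕ) : completeInt (K := K) (n : ℤ) = complete n := by
  simp [completeInt]

lemma completeInt_of_neg {m : ℤ} (h : m < 0) : completeInt (K := K) m = 0 := if_neg h.not_ge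

variable (K) in
/-- The polynomial `∑_{k ≥ 0} h_{m-k} y^k`, in which the translates of `h_m` are expressed. -/
def hPoly (m : ℤ) : (Sym K)[X] :=
  ∑ k ∈ range (m + 1).toNat, .C (completeInt (m - k)) * .X ^ k

lemma hPoly_of_neg {m : ℤ} (h : m < 0) : hPoly K m = 0 := by
  simp [hPoly, Int.toNat_of_nonpos (show m + 1 ≤ 0 by omega)]

lemma hPoly_natCast (n : ℕ) :
    hPoly K n = ∑ k ∈ range (n + 1), .C (complete (n - k)) * .X ^ k := by
  refine Finset.sum_congr (by norm_cast) fun k hk => ?_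
  rw [← Nat.cast_sub (Finset.mem_range_succ_iff.1 hk), completeInt_natCast]

lemma hPoly_eq_add (m : ℤ) :
    hPoly K m = .C (completeInt m) + .X * hPoly K (m - 1) := by
  rcases lt_or_ge m 0 with h | h
  · rw [hPoly_of_neg h, hPoly_of_neg (by omega), completeInt_of_neg h]
    simp
  lift m to ℕ using h
  rw [hPoly, hPoly, sub_add_cancel, show ((m : ℤ) + 1).toNat = m + 1 by norm_cast,
    Int.toNat_natCast, Finset.sum_range_succ', Finset.mul_sum, add_comm]
  refine congrArg₂ (· + ·) ?_ ?_
  · simp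
  · refine Finset.sum_congr rfl fun k _ => ?_
    rw [Nat.cast_succ, sub_sub, add_comm (1 : ℤ)]
    ring

lemma one_sub_C_mul_X_mul_mk_pow {R : Type*} [CommRing R] (y : R) :
    (1 - PowerSeries.C y * PowerSeries.X) * PowerSeries.mk (y ^ ·) = 1 := by
  ext n
  obtain _ | n := n
  · simp [mul_assoc, sub_mul]
  · simp [sub_mul, mul_assoc, PowerSeries.coeff_succ_X_mul, PowerSeries.coeff_one, pow_succ']

variable [CharZero K]

lemma one_sub_mul_map_translate_hSeries (t : K) :
    (1 - PowerSeries.C .X * PowerSeries.X) *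
        (hSeries K).map (translate (fun k => 1 - t ^ (k : ℕ)) : Sym K →+* (Sym K)[X]) =
      (1 - PowerSeries.C (.C (.C t) * .X) * PowerSeries.X) * (hSeries K).map Polynomial.C := by
  set powerSum : (Sym K)[X] → Sym K →ₐ[K] (Sym K)[X] := fun y =>
    MvPolynomial.aeval fun k : ℕ+ => y ^ (k : ℕ) with hpow
  have hmap (y : (Sym K)[X]) :
      (hSeries K).map (powerSum y : Sym K →+* (Sym K)[X]) = PowerSeries.mk (y ^ ·) := by
    ext1 n
    rw [PowerSeries.coeff_map, hSeries, PowerSeries.coeff_mk, PowerSeries.coeff_mk]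
    exact aeval_pow_complete y n
  have hX : (hSeries K).map (translate (fun _ => (1 : K)) : Sym K →+* (Sym K)[X]) =
      (hSeries K).map Polynomial.C * PowerSeries.mk (Polynomial.X ^ ·) := by
    rw [← hmap]
    refine map_hSeries_eq_mul fun k => ?_
    simp [hpow, translate_X]
  have htX : (hSeries K).map (translate (fun _ => (1 : K)) : Sym K →+* (Sym K)[X]) =
      (hSeries K).map (translate (fun k => 1 - t ^ (k : ℕ)) : Sym K →+* (Sym K)[X]) *
        PowerSeries.mk ((Polynomial.C (MvPolynomial.C t) * Polynomial.X) ^ ·) := by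
    rw [← hmap]
    refine map_hSeries_eq_mul fun k => ?_
    simp [hpow, translate_X]
    ring
  have h₁ := one_sub_C_mul_X_mul_mk_pow (Polynomial.X : (Sym K)[X])
  have h₂ := one_sub_C_mul_X_mul_mk_pow (Polynomial.C (MvPolynomial.C t : Sym K) * Polynomial.X)
  rw [htX] at hX
  linear_combination (1 - PowerSeries.C (.C (.C t) * .X) * PowerSeries.X) *
    ((1 - PowerSeries.C .X * PowerSeries.X) * hX + (hSeries K).map Polynomial.C * h₁) -
    (1 - PowerSeries.C .X * PowerSeries.X) *
    (hSeries K).map (translate (fun k => 1 - t ^ (k : ℕ)) : Sym K →+* (Sym K)[X]) * h₂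

lemma translate_complete (t : K) (n : ℕ) :
    translate (fun k => 1 - t ^ (k : ℕ)) (complete (K := K) n) =
      .C (.C t) * .C (complete n) + (1 - .C (.C t)) * hPoly K n := by
  induction n with
  | zero => simp [complete_zero, hPoly, completeInt]
  | succ n ih =>
    have h := congrArg (PowerSeries.coeff (n + 1)) (one_sub_mul_map_translate_hSeries t)
    simp only [sub_mul, one_mul, mul_assoc, map_sub, PowerSeries.coeff_C_mul,
      PowerSeries.coeff_succ_X_mul, PowerSeries.coeff_map, hSeries, PowerSeries.coeff_mk,
      RingHom.coe_coe, ih] at h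
    rw [hPoly_eq_add, completeInt_natCast, Nat.cast_succ, add_sub_cancel_right]
    linear_combination h

lemma translate_completeInt (t : K) (m : ℤ) :
    translate (fun k => 1 - t ^ (k : ℕ)) (completeInt (K := K) m) =
      .C (.C t) * .C (completeInt m) + (1 - .C (.C t)) * hPoly K m := by
  rcases lt_or_ge m 0 with h | h
  · simp [completeInt_of_neg h, hPoly_of_neg h]
  · lift m to ℕ using h
    rw [completeInt_natCast, translate_complete]

lemma contract_hPoly (q : K) (m : ℤ) :
    contract (qSeries q) (hPoly K m) = .C (q ^ m) * completeInt m := by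
  rcases lt_or_ge m 0 with h | h
  · rw [hPoly_of_neg h, completeInt_of_neg h, map_zero, mul_zero]
  lift m to ℕ using h
  have h := congrArg (PowerSeries.coeff m) (qSeries_mul_hSeries q)
  rw [mul_comm, PowerSeries.coeff_mul, ← Finset.Nat.sum_antidiagonal_swap,
    Finset.Nat.sum_antidiagonal_eq_sum_range_succ_mk] at h
  rw [hPoly_natCast, map_sum, completeInt_natCast, zpow_natCast]
  simpa only [contract_C_mul_X_pow, hSeries, PowerSeries.coeff_mk, Prod.swap_prod_mk] using h

end TranslateComplete

/-! ### The action on Jacobi–Trudi determinants -/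

section Det

variable {R : Type*} [CommRing R]

lemma det_add_sum_rankOne {ι : Type*} [Fintype ι] [DecidableEq ι] (M : Matrix ι ι R) (v w : ι → R)
    (s : Finset ι) :
    (Matrix.of fun i j => M i j + v i * if j ∈ s then w j else 0).det =
      M.det + ∑ j ∈ s, w j * (M.updateCol j v).det := by
  induction s using Finset.induction_on with
  | empty => simp; rfl
  | insert a s ha ih =>
    set N : Matrix ι ι R := Matrix.of fun i j => M i j + v i * if j ∈ s then w j else 0 with hN
    have hinsert : (Matrix.of fun i j => M i j + v i * if j ∈ insert a s then w j else 0) =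
        N.updateCol a (N.col a + w a • v) := by
      ext i j
      by_cases hj : j = a
      · subst hj
        simp [hN, ha, mul_comm]
      · simp [hN, hj]
    have hcol : (N.updateCol a v).det = (M.updateCol a v).det := by
      rw [← Matrix.det_transpose, ← Matrix.det_transpose (M.updateCol a v)]
      refine Matrix.det_eq_of_forall_row_eq_smul_add_const (fun j => if j ∈ s then w j else 0) a
        (by simp [ha]) fun j i => ?_
      by_cases hj : j = a
      · subst hj
        simp [ha]
      · simp [Matrix.updateCol_ne hj, hN, mul_comm]
    rw [hinsert, Matrix.det_updateCol_add, Matrix.det_updateCol_smul, hcol, Finset.sum_insert ha,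
      add_left_comm, ← ih, add_comm]
    congr 2
    exact Matrix.updateCol_eq_self N a

variable {N : ℕ} {M : Matrix (Fin N) (Fin N) R} {P : ℕ → Fin N → R} {y : R}

lemma det_updateCol_of_horner (hP : ∀ i (j : Fin N), P (j + 1 : ℕ) i = M i j + y * P j i)
    (r : Fin N) :
    (M.updateCol r (P (r + 1))).det = M.det + y ^ (r + 1 : ℕ) * (M.updateCol r (P 0)).det := by
  have hcol (j : Fin N) : P (j + 1) = (fun i => M i j) + y • P j := by
    ext i
    exact hP i j
  have hlt : ∀ k : ℕ, k ≤ r → (M.updateCol r (P k)).det = y ^ k * (M.updateCol r (P 0)).det := by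
    intro k hk
    induction k with
    | zero => simp
    | succ k ih =>
      have hkr : (⟨k, by omega⟩ : Fin N) ≠ r := fun h => by rw [← h] at hk; simp at hk
      rw [hcol ⟨k, by omega⟩, Matrix.det_updateCol_add, Matrix.det_updateCol_smul,
        Matrix.det_updateCol_eq_zero hkr, ih (by omega)]
      ring
  rw [hcol, Matrix.det_updateCol_add, Matrix.det_updateCol_smul, hlt r le_rfl]
  have hself : M.updateCol r (fun i => M i r) = M := Matrix.updateCol_eq_self M r
  rw [hself]
  ring

lemma det_horner (hP : ∀ i (j : Fin N), P (j + 1 : ℕ) i = M i j + y * P j i) (t : R) :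
    (Matrix.of fun i j : Fin N => t * M i j + (1 - t) * P (j + 1) i).det =
      t ^ N * M.det + ∑ r : Fin N, (1 - t) * t ^ (r : ℕ) * (M.updateCol r (P (r + 1))).det := by
  have hrank : (Matrix.of fun i j : Fin N => t * M i j + (1 - t) * P (j + 1) i).det =
      (Matrix.of fun i j : Fin N =>
        M i j + P 0 i * ((1 - t) * t ^ (j : ℕ) * y ^ (j + 1 : ℕ))).det := by
    obtain _ | N := N
    · simp
    -- Both determinants equal that of the matrix with columns `M_{j+1} - t y M_j`.
    set D : Matrix (Fin (N + 1)) (Fin (N + 1)) R := Matrix.of fun i =>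
      Fin.cons (M i 0 + (1 - t) * y * P 0 i) fun j => M i j.succ - t * y * M i j.castSucc with hD
    trans D.det
    · refine Matrix.det_eq_of_forall_col_eq_smul_add_pred (fun _ => y) (fun i => ?_) fun i j => ?_
      · have := hP i 0
        simp only [Fin.val_zero, zero_add] at this
        simp [hD, this]
        ring
      · have := hP i j.succ
        simp only [Fin.val_succ] at this
        simp [hD, this]
        ring
    · symm
      refine Matrix.det_eq_of_forall_col_eq_smul_add_pred (fun _ => t * y) (fun i => ?_)
        fun i j => ?_
      · simp [hD]
        ring
      · simp [hD]
        ring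
  have h := det_add_sum_rankOne M (P 0) (fun j => (1 - t) * t ^ (j : ℕ) * y ^ (j + 1 : ℕ))
    Finset.univ
  simp only [Finset.mem_univ, if_true] at h
  have hgeom : ∑ r : Fin N, (1 - t) * t ^ (r : ℕ) * M.det = (1 - t ^ N) * M.det := by
    rw [← Finset.sum_mul, ← Finset.mul_sum, Fin.sum_univ_eq_sum_range (fun r => t ^ r) N,
      mul_comm (1 - t), geom_sum_mul_neg]
  rw [hrank, h]
  simp only [det_updateCol_of_horner hP, mul_add, Finset.sum_add_distrib, hgeom, ← mul_assoc]
  ring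

end Det

section JacobiTrudi

variable (K : Type*) [Field K]

/-- The Jacobi–Trudi matrix `(h_{l_i + j})`, for arbitrary indices `l`. -/
def jtMatrix {N : ℕ} (l : Fin N → ℤ) : Matrix (Fin N) (Fin N) (Sym K) :=
  Matrix.of fun i j => completeInt (l i + (j : ℤ))

variable {K} [CharZero K]

lemma translate_det_jtMatrix (t : K) {N : ℕ} (l : Fin N → ℤ) :
    translate (fun k => 1 - t ^ (k : ℕ)) (jtMatrix K l).det =
      .C (.C t) ^ N * .C (jtMatrix K l).det + ∑ r : Fin N, (1 - .C (.C t)) * .C (.C t) ^ (r : ℕ) *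
        (((jtMatrix K l).map Polynomial.C).updateCol r fun i => hPoly K (l i + r)).det := by
  have hmap : (translate (fun k => 1 - t ^ (k : ℕ))).mapMatrix (jtMatrix K l) =
      Matrix.of fun i j : Fin N => .C (.C t) * (jtMatrix K l).map Polynomial.C i j +
        (1 - .C (.C t)) * hPoly K (l i + ((j + 1 : ℕ) : ℤ) - 1) := by
    ext1 i j
    simp only [AlgHom.mapMatrix_apply, Matrix.map_apply, jtMatrix, Matrix.of_apply,
      translate_completeInt, Nat.cast_succ, ← add_assoc, add_sub_cancel_right]
  rw [AlgHom.map_det, hmap, det_horner (P := fun j i => hPoly K (l i + j - 1)) (y := .X),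
    ← RingHom.mapMatrix_apply, ← RingHom.map_det]
  · simp only [Nat.cast_succ, ← add_assoc, add_sub_cancel_right, RingHom.mapMatrix_apply]
  · intro i j
    rw [Nat.cast_succ, ← add_assoc, add_sub_cancel_right, hPoly_eq_add]
    rfl

lemma macOpConj_det_jtMatrix (q t : K) {N : ℕ} (l : Fin N → ℤ) :
    macOpConj q t (jtMatrix K l).det =
      .C (t ^ N) * (jtMatrix K l).det + ∑ r : Fin N, .C ((1 - t) * t ^ (r : ℕ)) *
        ((jtMatrix K l).updateCol r fun i =>
          .C (q ^ (l i + (r : ℤ))) * completeInt (l i + (r : ℤ))).det := by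
  have hdet : contract (qSeries q) (.C (.C t) ^ N * .C (jtMatrix K l).det) =
      .C (t ^ N) * (jtMatrix K l).det := by
    have hC := contract_C_mul_X_pow (qSeries q) (jtMatrix K l).det 0
    rw [pow_zero, mul_one, coeff_zero_qSeries, mul_one] at hC
    rw [← Polynomial.C_pow, ← MvPolynomial.C_pow, contract_C_mul, hC]
  have hcoeff (r : ℕ) : (1 - Polynomial.C (MvPolynomial.C t : Sym K)) * .C (.C t) ^ r =
      .C (.C ((1 - t) * t ^ r)) := by
    simp
  change contract _ (translate _ _) = _
  simp only [translate_det_jtMatrix, map_add, map_sum, hcoeff, contract_C_mul,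
    contract_det_updateCol, contract_hPoly, hdet]

end JacobiTrudi

/-! ### Young diagrams and the dominance order -/

section Diagrams

lemma rowLen_eq_zero {D : YoungDiagram} {i : ℕ} (hi : D.card ≤ i) : D.rowLen i = 0 := by
  by_contra h
  have hmem : (i, 0) ∈ D := YoungDiagram.mem_iff_lt_rowLen.2 (Nat.pos_of_ne_zero h)
  have hcol : D.colLen 0 ≤ D.card := by
    rw [YoungDiagram.colLen_eq_card]
    exact Finset.card_le_card (Finset.filter_subset _ _)
  exact absurd (YoungDiagram.mem_iff_lt_colLen.1 hmem) (by omega)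

@[to_additive]
lemma prod_cells_eq {M : Type*} [CommMonoid M] {D : YoungDiagram} {N : ℕ}
    (hN : D.rowLen N = 0) (f : ℕ × ℕ → M) :
    ∏ s ∈ D.cells, f s = ∏ i ∈ range N, ∏ j ∈ range (D.rowLen i), f (i, j) := by
  refine Finset.prod_finset_product _ _ _ fun s => ?_
  rw [YoungDiagram.mem_cells, YoungDiagram.mem_iff_lt_rowLen, Finset.mem_range, Finset.mem_range,
    iff_and_self]
  intro hs
  by_contra hsN
  have := D.rowLen_anti N s.1 (by omega)
  omega

lemma sum_rowLen {D : YoungDiagram} {N : ℕ} (hN : D.rowLen N = 0) :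
    ∑ i ∈ range N, D.rowLen i = D.card := by
  have h := sum_cells_eq hN fun _ => 1
  simp only [Finset.sum_const, Finset.card_range, smul_eq_mul, mul_one] at h
  exact h.symm

lemma sum_rowLen_card (D : YoungDiagram) : ∑ i ∈ range D.card, D.rowLen i = D.card :=
  sum_rowLen (rowLen_eq_zero le_rfl)

lemma diagram_ext {D E : YoungDiagram} (h : ∀ i, D.rowLen i = E.rowLen i) : D = E := by
  ext ⟨i, j⟩
  rw [YoungDiagram.mem_cells, YoungDiagram.mem_cells, YoungDiagram.mem_iff_lt_rowLen,
    YoungDiagram.mem_iff_lt_rowLen, h]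

lemma rowLen_ofRowLens_eq_getD {w : List ℕ} (hw : w.SortedGE) (i : ℕ) :
    (YoungDiagram.ofRowLens w hw).rowLen i = w.getD i 0 := by
  refine eq_of_forall_lt_iff fun j => ?_
  rw [← YoungDiagram.mem_iff_lt_rowLen, YoungDiagram.mem_ofRowLens]
  by_cases hi : i < w.length <;> simp [hi]

lemma card_ofRowLens {w : List ℕ} (hw : w.SortedGE) :
    (YoungDiagram.ofRowLens w hw).card = w.sum := by
  have hlen : (YoungDiagram.ofRowLens w hw).rowLen w.length = 0 := by
    rw [rowLen_ofRowLens_eq_getD, List.getD_eq_default _ _ le_rfl]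
  rw [← sum_rowLen hlen, ← Fin.sum_univ_getElem w, ← Fin.sum_univ_eq_sum_range]
  exact Finset.sum_congr rfl fun i _ => YoungDiagram.rowLen_ofRowLens i

lemma card_diagram {n : ℕ} (lam : n.Partition) : (diagram lam).card = n := by
  rw [diagram, card_ofRowLens, ← Multiset.sum_coe, Multiset.sort_eq, lam.parts_sum]

lemma diagram_injective (n : ℕ) : Function.Injective (diagram (n := n)) := by
  have hrow (c : n.Partition) : (diagram c).rowLens = c.parts.sort (· ≥ ·) :=
    YoungDiagram.rowLens_ofRowLens_eq_self fun _ hx => c.parts_pos ((Multiset.mem_sort _).1 hx)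
  intro a b h
  ext1
  rw [← Multiset.sort_eq a.parts (· ≥ ·), ← hrow, h, hrow, Multiset.sort_eq]

lemma exists_diagram_eq (D : YoungDiagram) : ∃ lam : D.card.Partition, diagram lam = D := by
  have hsum : D.rowLens.sum = D.card := by
    conv_rhs => rw [← YoungDiagram.ofRowLens_to_rowLens_eq_self (μ := D), card_ofRowLens]
  refine ⟨⟨D.rowLens, fun hi => D.pos_of_mem_rowLens _ hi, hsum⟩, ?_⟩
  have hsort : (D.rowLens : Multiset ℕ).sort (· ≥ ·) = D.rowLens := by
    rw [Multiset.coe_sort]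
    exact List.mergeSort_of_pairwise (by simpa using D.rowLens_sorted.pairwise)
  simp only [diagram, hsort]
  exact YoungDiagram.ofRowLens_to_rowLens_eq_self

lemma Dominates.refl (D : YoungDiagram) : Dominates D D := fun _ => le_rfl

lemma Dominates.trans {D E F : YoungDiagram} (h : Dominates D E) (h' : Dominates E F) :
    Dominates D F := fun k => (h' k).trans (h k)

lemma Dominates.antisymm {D E : YoungDiagram} (h : Dominates D E) (h' : Dominates E D) :
    D = E := by
  have hsum (k : ℕ) : ∑ i ∈ range k, D.rowLen i = ∑ i ∈ range k, E.rowLen i :=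
    le_antisymm (h' k) (h k)
  refine diagram_ext fun i => ?_
  have hi := hsum (i + 1)
  rwa [Finset.sum_range_succ, Finset.sum_range_succ, hsum i, add_right_inj] at hi

/-- Strict dominance of diagrams of the same size. -/
def StrictDom (F E : YoungDiagram) : Prop := F.card = E.card ∧ Dominates F E ∧ F ≠ E

lemma StrictDom.of_dominates {G F E : YoungDiagram} (hc : G.card = F.card) (h : Dominates G F)
    (h' : StrictDom F E) : StrictDom G E := by
  refine ⟨hc.trans h'.1, h.trans h'.2.1, ?_⟩
  rintro rfl
  exact h'.2.2 (h'.2.1.antisymm h)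

open Classical in
/-- The finite set of the diagrams of the size of `E` that dominate `E`. -/
def above (E : YoungDiagram) : Finset YoungDiagram :=
  {F ∈ Finset.univ.image (diagram (n := E.card)) | Dominates F E}

lemma mem_above {E F : YoungDiagram} : F ∈ above E ↔ F.card = E.card ∧ Dominates F E := by
  simp only [above, Finset.mem_filter, Finset.mem_image, Finset.mem_univ, true_and]
  refine and_congr_left fun _ => ⟨?_, fun h => ?_⟩
  · rintro ⟨lam, rfl⟩
    exact card_diagram lam
  · rw [← h]
    exact exists_diagram_eq F

lemma dominance_induction {P : YoungDiagram → Prop}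
    (h : ∀ E, (∀ F, StrictDom F E → P F) → P E) (E : YoungDiagram) : P E := by
  induction hn : (above E).card using Nat.strong_induction_on generalizing E with
  | _ n ih =>
    refine h E fun F hF => ih _ (hn ▸ Finset.card_lt_card ?_) F rfl
    refine (Finset.ssubset_iff_of_subset fun G hG => ?_).2
      ⟨E, mem_above.2 ⟨rfl, Dominates.refl E⟩, fun hE => ?_⟩
    · rw [mem_above] at hG ⊢
      exact ⟨hG.1.trans hF.1, hG.2.trans hF.2.1⟩
    · exact hF.2.2 (hF.2.1.antisymm (mem_above.1 hE).2)

/-- The indicator of the first `k` of `N` indices; pairing with it takes a partial sum. -/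
def initial (N k : ℕ) (i : Fin N) : ℕ := if (i : ℕ) < k then 1 else 0

lemma antitone_initial (N k : ℕ) : Antitone (initial N k) := by
  intro i j (hij : (i : ℕ) ≤ j)
  simp only [initial]
  split_ifs <;> omega

lemma initial_succ {N : ℕ} (m : Fin N) : initial N (m + 1) = initial N m + Pi.single m 1 := by
  ext i
  simp only [initial, Pi.add_apply, Pi.single_apply, Fin.ext_iff]
  split_ifs <;> omega

lemma sum_range_eq_initial_dotProduct {N : ℕ} {f : ℕ → ℕ} (hf : ∀ i, N ≤ i → f i = 0) (k : ℕ) :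
    ∑ i ∈ range k, f i = initial N k ⬝ᵥ fun i => f i := by
  simp only [dotProduct, initial]
  rw [Fin.sum_univ_eq_sum_range (fun i => (if i < k then 1 else 0) * f i) N]
  simp only [ite_mul, one_mul, zero_mul]
  rw [← Finset.sum_filter]
  refine (Finset.sum_subset (fun i hi => ?_) fun i hi hi' => ?_).symm
  · exact Finset.mem_range.2 (Finset.mem_filter.1 hi).2
  · simp only [Finset.mem_filter, Finset.mem_range] at hi hi'
    exact hf i (by omega)

lemma initial_dotProduct_val_le {N : ℕ} (σ : Equiv.Perm (Fin N)) (k : ℕ) :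
    (initial N k ⬝ᵥ fun i => (i : ℕ)) ≤ initial N k ⬝ᵥ fun i => (σ i : ℕ) :=
  ((antitone_initial N k).antivary Fin.val_strictMono.monotone).sum_mul_le_sum_mul_comp_perm

lemma perm_eq_one_of_initial_le {N : ℕ} {σ : Equiv.Perm (Fin N)}
    (h : ∀ k, (initial N k ⬝ᵥ fun i => (σ i : ℕ)) ≤ initial N k ⬝ᵥ fun i => (i : ℕ)) :
    σ = 1 := by
  have heq (k : ℕ) := (h k).antisymm (initial_dotProduct_val_le σ k)
  ext m
  have hm := heq (m + 1)
  rwa [initial_succ, add_dotProduct, add_dotProduct, single_dotProduct, single_dotProduct, heq m,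
    one_mul, one_mul, add_right_inj] at hm

lemma exists_sorted_diagram {N : ℕ} (α : Fin N → ℕ) :
    ∃ (F : YoungDiagram) (τ : Equiv.Perm (Fin N)), (∀ i : Fin N, F.rowLen i = α (τ i)) ∧
      F.card = ∑ i, α i ∧ ∀ k, initial N k ⬝ᵥ α ≤ ∑ i ∈ range k, F.rowLen i := by
  set τ := Tuple.sort (OrderDual.toDual ∘ α)
  have hτ : Antitone (α ∘ τ) := Tuple.monotone_sort (OrderDual.toDual ∘ α)
  set F := YoungDiagram.ofRowLens (List.ofFn (α ∘ τ)) hτ.sortedGE_ofFn with hF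
  have hlt (i : Fin N) : F.rowLen i = α (τ i) := by
    simp [hF, rowLen_ofRowLens_eq_getD]
  have hge (i : ℕ) (hi : N ≤ i) : F.rowLen i = 0 := by
    rw [hF, rowLen_ofRowLens_eq_getD, List.getD_eq_default _ _ (by simpa using hi)]
  refine ⟨F, τ, hlt, ?_, fun k => ?_⟩
  · rw [card_ofRowLens, List.sum_ofFn]
    exact Equiv.sum_comp τ α
  · rw [sum_range_eq_initial_dotProduct hge]
    simpa [hlt, dotProduct] using
      ((antitone_initial N k).monovary hτ).sum_mul_comp_perm_le_sum_mul (σ := τ⁻¹)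

/-- `E.rowLen i - i + σ i` are the indices in the term of the Jacobi–Trudi determinant of `E`
given by `σ`; sorted, they form a diagram dominating `E`. -/
lemma exists_dominating {E : YoungDiagram} {σ : Equiv.Perm (Fin E.card)}
    (hpos : ∀ i : Fin E.card, (i : ℕ) ≤ E.rowLen i + σ i) :
    ∃ (F : YoungDiagram) (τ : Equiv.Perm (Fin E.card)), F.card = E.card ∧ Dominates F E ∧
      (∀ i : Fin E.card, F.rowLen i + τ i = E.rowLen (τ i) + σ (τ i)) ∧ (F = E → σ = 1) := by
  set α : Fin E.card → ℕ := fun i => E.rowLen i + σ i - i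
  have hα (i : Fin E.card) : α i + i = E.rowLen i + σ i := Nat.sub_add_cancel (hpos i)
  obtain ⟨F, τ, hrow, hcard, hpartial⟩ := exists_sorted_diagram α
  have hsum (k : ℕ) : initial E.card k ⬝ᵥ α + initial E.card k ⬝ᵥ (fun i => (i : ℕ)) =
      ∑ i ∈ range k, E.rowLen i + initial E.card k ⬝ᵥ fun i => (σ i : ℕ) := by
    rw [sum_range_eq_initial_dotProduct fun i => rowLen_eq_zero, ← dotProduct_add,
      ← dotProduct_add]
    exact congrArg _ (funext hα)
  refine ⟨F, τ, ?_, fun k => ?_, fun i => by rw [hrow, hα], fun hFE => ?_⟩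
  · have htotal : ∑ i, α i + ∑ i : Fin E.card, (i : ℕ) =
        ∑ i : Fin E.card, E.rowLen i + ∑ i, (σ i : ℕ) := by
      simp only [← Finset.sum_add_distrib, hα]
    rw [Equiv.sum_comp σ fun i => (i : ℕ), Fin.sum_univ_eq_sum_range (fun i => E.rowLen i),
      sum_rowLen_card] at htotal
    omega
  · have := hsum k
    have := hpartial k
    have := initial_dotProduct_val_le σ k
    omega
  · refine perm_eq_one_of_initial_le fun k => ?_
    have := hsum k
    have := hpartial k
    rw [hFE] at this
    omega

end Diagrams

/-! ### Triangularity on the Schur functions -/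

section Triangularity

variable {K : Type*} [Field K]

/-- The eigenvalue `1 - (1-q)(1-t) φ_D(q,t)` of `macOp q t` belonging to `D`. -/
def eig (q t : K) (D : YoungDiagram) : K := 1 - (1 - q) * (1 - t) * phi q t D

lemma eig_eq (q t : K) {D : YoungDiagram} {N : ℕ} (hN : D.rowLen N = 0) :
    eig q t D = t ^ N + (1 - t) * ∑ i ∈ range N, t ^ i * q ^ D.rowLen i := by
  have hrow (i : ℕ) : (1 - q) * (1 - t) * ∑ j ∈ range (D.rowLen i), q ^ j * t ^ i =
      (1 - t) * t ^ i - (1 - t) * (t ^ i * q ^ D.rowLen i) := by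
    rw [← Finset.sum_mul]
    linear_combination (1 - t) * t ^ i * geom_sum_mul_neg q (D.rowLen i)
  rw [eig, phi, sum_cells_eq hN, Finset.mul_sum, Finset.sum_congr rfl fun i _ => hrow i,
    Finset.sum_sub_distrib, ← Finset.mul_sum, ← Finset.mul_sum]
  linear_combination -geom_sum_mul_neg t N

/-- The complete symmetric function `h_λ` of the partition with diagram `D`. -/
def hDiag (K : Type*) [Field K] (D : YoungDiagram) : Sym K :=
  ∏ i ∈ range D.card, complete (D.rowLen i)

/-- The span of the Schur functions of the diagrams strictly dominating `D`; the triangularity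
statements are congruences modulo it. -/
def schurStrict (K : Type*) [Field K] (D : YoungDiagram) : Submodule K (Sym K) :=
  Submodule.span K (schur '' {E | StrictDom E D})

lemma schurAbove_mono {E F : YoungDiagram} (hc : F.card = E.card) (hd : Dominates F E) :
    schurAbove (K := K) F ≤ schurAbove E :=
  Submodule.span_mono <| Set.image_mono fun _ hG => ⟨hG.1.trans hc, hG.2.trans hd⟩

lemma schurAbove_le_schurStrict {F E : YoungDiagram} (h : StrictDom F E) :
    schurAbove F ≤ schurStrict K E :=
  Submodule.span_mono <| Set.image_mono fun _ hG => StrictDom.of_dominates hG.1 hG.2 h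

lemma schurStrict_le_schurAbove (E : YoungDiagram) : schurStrict K E ≤ schurAbove E :=
  Submodule.span_mono <| Set.image_mono fun _ hG => ⟨hG.1, hG.2.1⟩

lemma schur_mem_schurAbove (E : YoungDiagram) : schur E ∈ schurAbove (K := K) E :=
  Submodule.subset_span ⟨E, ⟨rfl, Dominates.refl E⟩, rfl⟩

/-- The term of `σ` in the expansion of the Jacobi–Trudi determinant `det (h_{l_i + j})`. -/
def jtTerm (K : Type*) [Field K] {N : ℕ} (l : Fin N → ℤ) (σ : Equiv.Perm (Fin N)) : Sym K :=
  (Equiv.Perm.sign σ : ℤ) • ∏ i, completeInt (l i + (σ i : ℕ))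

lemma det_jtMatrix_eq_sum {N : ℕ} (l : Fin N → ℤ) :
    (jtMatrix K l).det = ∑ σ, jtTerm K l σ := by
  rw [← Matrix.det_transpose, Matrix.det_apply]
  rfl

lemma det_updateCol_jtMatrix_eq_sum {N : ℕ} (l : Fin N → ℤ) (c : ℤ → K) (r : Fin N) :
    ((jtMatrix K l).updateCol r fun i =>
        .C (c (l i + (r : ℤ))) * completeInt (l i + (r : ℤ))).det =
      ∑ σ : Equiv.Perm (Fin N), c (l (σ⁻¹ r) + (r : ℤ)) • jtTerm K l σ := by
  rw [← Matrix.det_transpose, Matrix.det_apply]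
  refine Finset.sum_congr rfl fun σ _ => ?_
  rw [jtTerm, smul_comm, ← MvPolynomial.C_mul']
  congr 1
  rw [← Finset.mul_prod_erase _ _ (Finset.mem_univ (σ⁻¹ r)),
    ← Finset.mul_prod_erase _ (fun i => completeInt (l i + (σ i : ℕ)))
      (Finset.mem_univ (σ⁻¹ r)), ← mul_assoc]
  congr 1
  · simp
  · refine Finset.prod_congr rfl fun i hi => ?_
    have hir : σ i ≠ r := fun h => Finset.ne_of_mem_erase hi (by simp [← h])
    simp [Matrix.updateCol_ne hir, jtMatrix]

/-- The scalar by which the operator `macOpConj q t` multiplies the term of `σ` in a Jacobi–Trudi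
determinant. -/
def permScalar (q t : K) {N : ℕ} (l : Fin N → ℤ) (σ : Equiv.Perm (Fin N)) : K :=
  t ^ N + (1 - t) * ∑ i, t ^ (σ i : ℕ) * q ^ (l i + (σ i : ℕ))

lemma macOpConj_det_jtMatrix_eq_sum [CharZero K] (q t : K) {N : ℕ} (l : Fin N → ℤ) :
    macOpConj q t (jtMatrix K l).det = ∑ σ, permScalar q t l σ • jtTerm K l σ := by
  have hσ (σ : Equiv.Perm (Fin N)) : permScalar q t l σ = t ^ N +
      ∑ r : Fin N, (1 - t) * t ^ (r : ℕ) * q ^ (l (σ⁻¹ r) + (r : ℤ)) := by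
    rw [permScalar, Finset.mul_sum, ← Equiv.sum_comp σ fun r : Fin N => (1 - t) * _ * _]
    simp [mul_assoc]
  rw [macOpConj_det_jtMatrix]
  simp only [det_updateCol_jtMatrix_eq_sum l (q ^ ·), det_jtMatrix_eq_sum]
  simp only [MvPolynomial.C_mul', Finset.smul_sum, smul_smul, hσ, add_smul, Finset.sum_smul,
    Finset.sum_add_distrib]
  rw [Finset.sum_comm]

/-- The shifted row lengths `λ_i - i`, for which `jtMatrix` is the matrix of `schur D`. -/
def shiftedRowLen (D : YoungDiagram) (i : Fin D.card) : ℤ := D.rowLen i - (i : ℤ)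

lemma schur_eq_det_jtMatrix (D : YoungDiagram) :
    schur (K := K) D = (jtMatrix K (shiftedRowLen D)).det := rfl

lemma permScalar_one (q t : K) (D : YoungDiagram) :
    permScalar q t (shiftedRowLen D) 1 = eig q t D := by
  rw [permScalar, eig_eq q t (rowLen_eq_zero le_rfl),
    ← Fin.sum_univ_eq_sum_range fun i => t ^ i * q ^ D.rowLen i]
  simp [shiftedRowLen]

lemma jtTerm_one (D : YoungDiagram) : jtTerm K (shiftedRowLen D) 1 = hDiag K D := by
  rw [hDiag, ← Fin.prod_univ_eq_prod_range fun i => complete (D.rowLen i)]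
  simp [jtTerm, shiftedRowLen, completeInt_natCast]

lemma prod_completeInt_eq (E : YoungDiagram) (σ : Equiv.Perm (Fin E.card)) :
    ∏ i, completeInt (K := K) (shiftedRowLen E i + (σ i : ℕ)) = 0 ∨
    ∃ F : YoungDiagram, F.card = E.card ∧ Dominates F E ∧ (F = E → σ = 1) ∧
      ∏ i, completeInt (K := K) (shiftedRowLen E i + (σ i : ℕ)) = hDiag K F := by
  by_cases hpos : ∀ i : Fin E.card, (i : ℕ) ≤ E.rowLen i + σ i
  · obtain ⟨F, τ, hcard, hdom, hrow, heq⟩ := exists_dominating hpos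
    refine .inr ⟨F, hcard, hdom, heq, ?_⟩
    rw [hDiag, hcard, ← Fin.prod_univ_eq_prod_range fun i => complete (F.rowLen i),
      ← Equiv.prod_comp τ]
    refine Finset.prod_congr rfl fun i _ => ?_
    rw [← completeInt_natCast, shiftedRowLen]
    congr 1
    have := hrow i
    omega
  · push Not at hpos
    obtain ⟨i, hi⟩ := hpos
    refine .inl (Finset.prod_eq_zero (Finset.mem_univ i) (completeInt_of_neg ?_))
    rw [shiftedRowLen]
    omega

lemma jtTerm_mem {E : YoungDiagram} {σ : Equiv.Perm (Fin E.card)} (hσ : σ ≠ 1)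
    {W : Submodule K (Sym K)} (hW : ∀ F, StrictDom F E → hDiag K F ∈ W) :
    jtTerm K (shiftedRowLen E) σ ∈ W := by
  refine zsmul_mem ?_ _
  obtain h0 | ⟨F, hcard, hdom, heq, hF⟩ := prod_completeInt_eq (K := K) E σ
  · rw [h0]
    exact W.zero_mem
  · rw [hF]
    exact hW F ⟨hcard, hdom, fun hFE => hσ (heq hFE)⟩

lemma hDiag_mem_schurAbove (E : YoungDiagram) : hDiag K E ∈ schurAbove E := by
  induction E using dominance_induction with
  | _ E ih =>
    have h := schur_eq_det_jtMatrix (K := K) E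
    rw [det_jtMatrix_eq_sum, ← Finset.add_sum_erase _ _ (Finset.mem_univ 1), jtTerm_one,
      ← sub_eq_iff_eq_add] at h
    rw [← h]
    refine sub_mem (schur_mem_schurAbove E) (sum_mem fun σ hσ => ?_)
    exact jtTerm_mem (Finset.ne_of_mem_erase hσ) fun F hF =>
      schurAbove_mono hF.1 hF.2.1 (ih F hF)

lemma macOpConj_schur_sub_mem [CharZero K] (q t : K) (E : YoungDiagram) :
    macOpConj q t (schur E) - eig q t E • schur E ∈ schurStrict K E := by
  rw [schur_eq_det_jtMatrix, macOpConj_det_jtMatrix_eq_sum, det_jtMatrix_eq_sum, Finset.smul_sum,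
    ← Finset.sum_sub_distrib]
  refine sum_mem fun σ _ => ?_
  rw [← sub_smul]
  obtain rfl | hσ := eq_or_ne σ 1
  · rw [permScalar_one, sub_self, zero_smul]
    exact zero_mem _
  · exact Submodule.smul_mem _ _ <| jtTerm_mem hσ fun F hF =>
      schurAbove_le_schurStrict hF (hDiag_mem_schurAbove F)

end Triangularity

/-! ### Evaluations and the Hall pairing -/

section Evaluation

variable {K : Type*} [Field K]

variable (K) in
/-- The evaluation `p_k ↦ 1`, that is `f ↦ f[1]`. In degree `n` it is the pairing with `h_n`. -/
def evOne : Sym K →ₐ[K] K := MvPolynomial.aeval fun _ => 1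

variable (K) in
/-- The functional `f ↦ (∂f/∂p_1)[1]`. In degree `n` it is the pairing with `h_{n-1} h_1`. -/
def pairAlmostRow : Sym K →ₗ[K] K :=
  (evOne K).toLinearMap.comp (MvPolynomial.pderiv (1 : ℕ+)).toLinearMap

variable (K) in
/-- The homogeneous symmetric functions of degree `n`. -/
abbrev homog (n : ℕ) : Submodule K (Sym K) :=
  MvPolynomial.weightedHomogeneousSubmodule K (fun k : ℕ+ => (k : ℕ)) n

lemma pairAlmostRow_apply (f : Sym K) : pairAlmostRow K f = evOne K (MvPolynomial.pderiv 1 f) := rfl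

lemma evOne_monomial (m : ℕ+ →₀ ℕ) (a : K) : evOne K (.monomial m a) = a := by
  simp [evOne, MvPolynomial.aeval_monomial]

lemma evOne_eq_sum (f : Sym K) : evOne K f = ∑ m ∈ f.support, f.coeff m := by
  conv_lhs => rw [MvPolynomial.as_sum f, map_sum]
  exact Finset.sum_congr rfl fun m _ => evOne_monomial _ _

lemma pairAlmostRow_eq_sum (f : Sym K) :
    pairAlmostRow K f = ∑ m ∈ f.support, f.coeff m * (m 1 : K) := by
  conv_lhs => rw [MvPolynomial.as_sum f, map_sum]
  refine Finset.sum_congr rfl fun m _ => ?_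
  rw [pairAlmostRow_apply, MvPolynomial.pderiv_monomial, evOne_monomial]

lemma homog_le_span_monomial (n : ℕ) :
    homog K n ≤ Submodule.span K
      (Set.range fun rho : n.Partition => MvPolynomial.monomial (partExponents rho) (1 : K)) := by
  intro f hf
  rw [MvPolynomial.as_sum f]
  refine Submodule.sum_mem _ fun m hm => ?_
  obtain ⟨rho, rfl⟩ := exists_partExponents_eq (hf (MvPolynomial.mem_support_iff.1 hm))
  rw [← mul_one (MvPolynomial.coeff _ f), ← smul_eq_mul, ← MvPolynomial.smul_monomial]
  exact Submodule.smul_mem _ _ (Submodule.subset_span ⟨rho, rfl⟩)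

lemma homog_le_span_of_linearIndependent {n : ℕ} {v : n.Partition → Sym K}
    (hv : LinearIndependent K v) (hn : ∀ lam, v lam ∈ homog K n) :
    homog K n ≤ Submodule.span K (Set.range v) := by
  set S := Submodule.span K
    (Set.range fun rho : n.Partition => MvPolynomial.monomial (partExponents rho) (1 : K))
  have : FiniteDimensional K S := FiniteDimensional.span_of_finite K (Set.finite_range _)
  have hle : Submodule.span K (Set.range v) ≤ S :=
    (Submodule.span_le.2 <| Set.range_subset_iff.2 hn).trans (homog_le_span_monomial n)
  have hrank : Module.finrank K S ≤ Module.finrank K (Submodule.span K (Set.range v)) := by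
    rw [finrank_span_eq_card hv]
    exact finrank_range_le_card _
  exact (homog_le_span_monomial n).trans (Submodule.eq_of_le_of_finrank_le hle hrank).ge

lemma contract_one_sub_X {R : Type*} [CommRing R] (g : R[X]) :
    contract (1 - PowerSeries.X) g = g.coeff 0 - g.coeff 1 := by
  induction g using Polynomial.induction_on' with
  | add f g hf hg => simp only [map_add, hf, hg, Polynomial.coeff_add]; ring
  | monomial n a =>
    rw [← Polynomial.C_mul_X_pow_eq_monomial, contract_C_mul_X_pow]
    rcases n with _ | _ | n <;>
      simp [PowerSeries.coeff_one, PowerSeries.coeff_X, Polynomial.coeff_C, Polynomial.coeff_X_pow]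

lemma coeff_zero_translate (c : ℕ+ → K) (f : Sym K) : (translate c f).coeff 0 = f := by
  induction f using MvPolynomial.induction_on with
  | C a => simp
  | add f g hf hg => rw [map_add, Polynomial.coeff_add, hf, hg]
  | mul_X f k hf => simp [Polynomial.mul_coeff_zero, hf, translate_X, k.ne_zero.symm]

lemma coeff_one_translate (c : ℕ+ → K) (f : Sym K) :
    (translate c f).coeff 1 = .C (c 1) * MvPolynomial.pderiv 1 f := by
  induction f using MvPolynomial.induction_on with
  | C a => simp
  | add f g hf hg => rw [map_add, Polynomial.coeff_add, hf, hg, map_add, mul_add]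
  | mul_X f k hf =>
    have hX : (translate c (.X k)).coeff 1 = .C (c 1) * MvPolynomial.pderiv 1 (.X k) := by
      rw [translate_X, Polynomial.coeff_add, Polynomial.coeff_C_of_ne_zero one_ne_zero,
        Polynomial.coeff_C_mul, Polynomial.coeff_X_pow, MvPolynomial.pderiv_X, zero_add]
      obtain rfl | hk := eq_or_ne k 1
      · simp
      · simp [hk, eq_comm (a := 1)]
    rw [map_mul, Polynomial.mul_coeff_one, coeff_zero_translate, coeff_zero_translate, hf, hX,
      Derivation.leibniz, smul_eq_mul, smul_eq_mul]
    ring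

variable [CharZero K]

lemma hall_complete {n : ℕ} {f : Sym K} (hf : f ∈ homog K n) : hall f (complete n) = evOne K f := by
  rw [hall, evOne_eq_sum]
  refine Finset.sum_congr rfl fun m hm => ?_
  have hz : (zee m : K) ≠ 0 := mod_cast (zee_pos m).ne'
  rw [coeff_complete, if_pos (hf (MvPolynomial.mem_support_iff.1 hm)), inv_mul_cancel_right₀ hz]

lemma complete_one : complete (K := K) 1 = .X 1 := by
  change complete 1 = MvPolynomial.X (Nat.succPNat 0)
  simpa [complete_zero] using succ_mul_complete_succ (K := K) 0

lemma zee_mul_coeff_complete_mul_X {n : ℕ} {m : ℕ+ →₀ ℕ} (hm : weight m = n + 1) :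
    (zee m : K) * MvPolynomial.coeff m (complete n * .X 1) = m 1 := by
  classical
  rw [MvPolynomial.coeff_mul_X']
  by_cases h : m 1 = 0
  · simp [h]
  have hle : Finsupp.single (1 : ℕ+) 1 ≤ m := by simpa using Nat.one_le_iff_ne_zero.2 h
  have hw : weight (m - .single 1 1) + 1 = weight m := by
    conv_rhs => rw [← tsub_add_cancel_of_le hle, map_add]
    simp [Finsupp.weight_single]
  have hz : (zee (m - .single 1 1) : K) ≠ 0 := mod_cast (zee_pos _).ne'
  rw [if_pos (by simpa using h), coeff_complete, if_pos (by omega), zee_eq_mul_zee_sub_single h]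
  push_cast
  simp [mul_inv_cancel_right₀ hz]

lemma hall_complete_mul_X {n : ℕ} {f : Sym K} (hf : f ∈ homog K (n + 1)) :
    hall f (complete n * .X 1) = pairAlmostRow K f := by
  rw [hall, pairAlmostRow_eq_sum]
  refine Finset.sum_congr rfl fun m hm => ?_
  rw [← zee_mul_coeff_complete_mul_X (hf (MvPolynomial.mem_support_iff.1 hm)), mul_assoc,
    mul_comm (MvPolynomial.coeff m (_ * _))]

lemma completeProd_almostRow (n : ℕ) (hn : 1 ≤ n) :
    completeProd (K := K) (almostRow n hn) = complete (n - 1) * .X 1 := by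
  have hparts : (almostRow n hn).parts = Multiset.filter (· ≠ 0) {n - 1, 1} := rfl
  have hone : Multiset.filter (fun x => ¬x = 0) {1} = ({1} : Multiset ℕ) := by decide
  rw [completeProd, hparts]
  by_cases h : n - 1 = 0 <;> simp [h, hone, complete_one, complete_zero]

lemma evOne_complete (n : ℕ) : evOne K (complete n) = 1 := by
  simpa [evOne] using aeval_pow_complete (K := K) (1 : K) n

lemma map_evOne_eSeries : (eSeries K).map (evOne K : Sym K →+* K) = 1 - PowerSeries.X := by
  have hh : (hSeries K).map (evOne K : Sym K →+* K) = PowerSeries.mk 1 := by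
    ext n; simp [hSeries, evOne_complete]
  have h := congrArg (PowerSeries.map (evOne K : Sym K →+* K)) (hSeries_mul_eSeries K)
  rw [map_mul, hh, map_one] at h
  refine (left_inv_eq_right_inv ?_ h).symm
  rw [mul_comm, PowerSeries.mk_one_mul_one_sub_eq_one]

lemma evOne_macOp (q t : K) (f : Sym K) :
    evOne K (macOp q t f) = evOne K f - (1 - q) * (1 - t) * pairAlmostRow K f := by
  change (evOne K : Sym K →+* K) (contract (eSeries K) (translate _ f)) = _
  rw [map_contract, map_evOne_eSeries, contract_one_sub_X, Polynomial.coeff_map,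
    Polynomial.coeff_map, coeff_zero_translate, coeff_one_translate]
  simp [pairAlmostRow_apply, evOne]

end Evaluation

section Rescaling

variable {K : Type*} [Field K]

/-- The rescaling `p_k ↦ c_k p_k`. -/
def scale (c : ℕ+ → K) : Sym K →ₐ[K] Sym K :=
  MvPolynomial.aeval fun k : ℕ+ => .C (c k) * .X k

/-- The plethysm `f ↦ f[X/(1-q)]`, inverse to `plethOneSub q` unless `q` is a root of unity. -/
def plethInv (q : K) : Sym K →ₐ[K] Sym K := scale fun k : ℕ+ => (1 - q ^ (k : ℕ))⁻¹

lemma scale_comp (c d : ℕ+ → K) (f : Sym K) :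
    scale c (scale d f) = scale (fun k => c k * d k) f := by
  suffices (scale c).comp (scale d) = scale (fun k => c k * d k) from DFunLike.congr_fun this f
  refine MvPolynomial.algHom_ext fun k => ?_
  simp [scale, MvPolynomial.algHom_C]
  ring

lemma scale_one (f : Sym K) : scale (fun _ => (1 : K)) f = f := by simp [scale]

lemma scale_monomial (c : ℕ+ → K) (m : ℕ+ →₀ ℕ) (a : K) :
    scale c (.monomial m a) = .monomial m (a * m.prod fun k e => c k ^ e) := by
  rw [scale, MvPolynomial.aeval_monomial, MvPolynomial.monomial_eq, map_mul, mul_assoc,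
    MvPolynomial.algebraMap_eq]
  simp only [mul_pow, Finsupp.prod, map_prod, map_pow, Finset.prod_mul_distrib]

lemma scale_mem_homog (c : ℕ+ → K) {n : ℕ} {f : Sym K} (hf : f ∈ homog K n) :
    scale c f ∈ homog K n := by
  rw [MvPolynomial.as_sum f, map_sum]
  refine Submodule.sum_mem _ fun m hm => ?_
  rw [scale_monomial]
  exact MvPolynomial.isWeightedHomogeneous_monomial _ _ _ (hf (MvPolynomial.mem_support_iff.1 hm))

lemma plethOneSub_plethInv {q : K} (hq : ∀ k : ℕ+, 1 - q ^ (k : ℕ) ≠ 0) (f : Sym K) :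
    plethOneSub q (plethInv q f) = f := by
  refine (scale_comp (fun k : ℕ+ => 1 - q ^ (k : ℕ)) _ f).trans ?_
  simp only [mul_inv_cancel₀ (hq _), scale_one]

lemma plethInv_plethOneSub {q : K} (hq : ∀ k : ℕ+, 1 - q ^ (k : ℕ) ≠ 0) (f : Sym K) :
    plethInv q (plethOneSub q f) = f := by
  refine (scale_comp _ (fun k : ℕ+ => 1 - q ^ (k : ℕ)) f).trans ?_
  simp only [inv_mul_cancel₀ (hq _), scale_one]

lemma hDiag_mem_homog (D : YoungDiagram) : hDiag K D ∈ homog K D.card := by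
  have h := MvPolynomial.IsWeightedHomogeneous.prod (range D.card)
    (fun i => complete (K := K) (D.rowLen i)) (fun i => D.rowLen i)
    fun i _ => isWeightedHomogeneous_complete _
  rwa [sum_rowLen_card] at h

lemma schur_mem_homog (D : YoungDiagram) : schur D ∈ homog K D.card := by
  rw [schur_eq_det_jtMatrix, det_jtMatrix_eq_sum]
  refine Submodule.sum_mem _ fun σ _ => zsmul_mem ?_ _
  obtain h0 | ⟨F, hF, -, -, hprod⟩ := prod_completeInt_eq (K := K) D σ
  · rw [h0]; exact Submodule.zero_mem _
  · rw [hprod, ← hF]; exact hDiag_mem_homog F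

lemma schurAbove_le_homog (D : YoungDiagram) : schurAbove (K := K) D ≤ homog K D.card := by
  refine Submodule.span_le.2 ?_
  rintro _ ⟨E, ⟨hc, -⟩, rfl⟩
  exact hc ▸ schur_mem_homog E

lemma mem_homog_of_plethOneSub_mem_schurAbove {q : K} (hq : ∀ k : ℕ+, 1 - q ^ (k : ℕ) ≠ 0)
    {E : YoungDiagram} {f : Sym K} (h : plethOneSub q f ∈ schurAbove (K := K) E) :
    f ∈ homog K E.card := by
  rw [← plethInv_plethOneSub hq f]
  exact scale_mem_homog _ (schurAbove_le_homog E h)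

end Rescaling

/-! ### Eigenvectors of the Macdonald operator -/

section PolynomialsInAnEndomorphism

variable {K V : Type*} [Field K] [AddCommGroup V] [Module K V]

lemma aeval_mul_apply_eq_zero (T : Module.End K V) (P : K[X]) {Q : K[X]} {v : V}
    (hv : Polynomial.aeval T Q v = 0) : Polynomial.aeval T (P * Q) v = 0 := by
  rw [map_mul, Module.End.mul_apply, hv, map_zero]

lemma aeval_X_sub_C_apply (T : Module.End K V) (e : K) (v : V) :
    Polynomial.aeval T (.X - .C e : K[X]) v = T v - e • v := by
  simp [Module.algebraMap_end_apply]

lemma aeval_apply_mem {T : Module.End K V} {W : Submodule K V} (hW : W ≤ W.comap T) (P : K[X])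
    {v : V} (hv : v ∈ W) : Polynomial.aeval T P v ∈ W := by
  induction P using Polynomial.induction_on with
  | C a => simpa [Module.algebraMap_end_apply] using W.smul_mem a hv
  | add P Q hP hQ => simpa using W.add_mem hP hQ
  | monomial n a ih =>
    rw [pow_succ', mul_left_comm, map_mul, Module.End.mul_apply, Polynomial.aeval_X]
    exact hW ih

lemma map_aeval_apply {W : Type*} [AddCommGroup W] [Module K W] {S : Module.End K V}
    {T : Module.End K W} {φ : V →ₗ[K] W} (h : ∀ v, φ (S v) = T (φ v)) (P : K[X]) (v : V) :
    φ (Polynomial.aeval S P v) = Polynomial.aeval T P (φ v) := by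
  induction P using Polynomial.induction_on with
  | C a => simp [Module.algebraMap_end_apply]
  | add P Q hP hQ => simp [hP, hQ]
  | monomial n a ih =>
    simp only [pow_succ', mul_left_comm _ Polynomial.X, map_mul _ Polynomial.X,
      Module.End.mul_apply, Polynomial.aeval_X, h, ih]

lemma eq_zero_of_isCoprime_of_aeval_apply_eq_zero {T : Module.End K V} {P Q : K[X]}
    (h : IsCoprime P Q) {v : V} (hP : Polynomial.aeval T P v = 0)
    (hQ : Polynomial.aeval T Q v = 0) : v = 0 := by
  obtain ⟨a, b, hab⟩ := h
  have h1 := congrArg (fun R => Polynomial.aeval T R v) hab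
  simpa [hP, hQ] using h1.symm

lemma exists_eq_smul_of_mem_span {ι : Type*} [Finite ι] {T : Module.End K V} {μ : ι → K}
    (hμ : Function.Injective μ) {v : ι → V} (hv : LinearIndependent K v)
    (hT : ∀ i, T (v i) = μ i • v i) {f : V} (hf : f ∈ Submodule.span K (Set.range v)) {i : ι}
    (hfi : T f = μ i • f) : ∃ c : K, f = c • v i := by
  have := Fintype.ofFinite ι
  obtain ⟨c, rfl⟩ := (Submodule.mem_span_range_iff_exists_fun K).1 hf
  have h0 : ∑ j, (c j * (μ j - μ i)) • v j = 0 := by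
    simp only [mul_sub, sub_smul, Finset.sum_sub_distrib, mul_smul]
    simp only [← hT, ← map_smul, ← map_sum, hfi, Finset.smul_sum, smul_comm (μ i), sub_self]
  refine ⟨c i, Finset.sum_eq_single i (fun j _ hj => ?_) (by simp)⟩
  obtain h | h := mul_eq_zero.1 (Fintype.linearIndependent_iff.1 hv _ h0 j)
  · rw [h, zero_smul]
  · exact absurd (hμ (sub_eq_zero.1 h)) hj

end PolynomialsInAnEndomorphism

section Eigenvectors

open Classical in
/-- The diagrams strictly dominating `E`. -/
def strictAbove (E : YoungDiagram) : Finset YoungDiagram := (above E).erase E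

lemma mem_strictAbove {E F : YoungDiagram} : F ∈ strictAbove E ↔ StrictDom F E := by
  simp only [strictAbove, Finset.mem_erase, mem_above, StrictDom]
  tauto

lemma above_subset_above {E F : YoungDiagram} (hc : F.card = E.card) (hd : Dominates F E) :
    above F ⊆ above E := by
  intro G hG
  rw [mem_above] at hG ⊢
  exact ⟨hG.1.trans hc, hG.2.trans hd⟩

lemma above_subset_strictAbove {E F : YoungDiagram} (h : StrictDom F E) :
    above F ⊆ strictAbove E := by
  intro G hG
  rw [mem_above] at hG
  exact mem_strictAbove.2 (StrictDom.of_dominates hG.1 hG.2 h)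

variable {K : Type*} [Field K]

/-- The monic polynomial whose roots are the eigenvalues of the diagrams in `s`. -/
def eigPoly (q t : K) (s : Finset YoungDiagram) : K[X] := ∏ F ∈ s, (.X - .C (eig q t F))

lemma eigPoly_above (q t : K) (E : YoungDiagram) :
    eigPoly q t (above E) = (.X - .C (eig q t E)) * eigPoly q t (strictAbove E) := by
  classical
  exact (Finset.mul_prod_erase (above E) (fun F => Polynomial.X - Polynomial.C (eig q t F))
    (mem_above.2 ⟨rfl, Dominates.refl E⟩)).symm

lemma aeval_eigPoly_apply_eq_zero_of_subset {q t : K} {s s' : Finset YoungDiagram} (h : s ⊆ s')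
    {T : Module.End K (Sym K)} {f : Sym K} (hf : Polynomial.aeval T (eigPoly q t s) f = 0) :
    Polynomial.aeval T (eigPoly q t s') f = 0 := by
  classical
  rw [eigPoly, ← Finset.prod_sdiff h]
  exact aeval_mul_apply_eq_zero T _ hf

variable [CharZero K]

lemma aeval_eigPoly_schur (q t : K) (E : YoungDiagram) :
    Polynomial.aeval (macOpConj q t) (eigPoly q t (above E)) (schur E) = 0 := by
  induction E using dominance_induction with
  | _ E ih =>
  rw [eigPoly_above, mul_comm, map_mul, Module.End.mul_apply, aeval_X_sub_C_apply]
  suffices schurStrict K E ≤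
      LinearMap.ker (Polynomial.aeval (macOpConj q t) (eigPoly q t (strictAbove E))) from
    this (macOpConj_schur_sub_mem q t E)
  refine Submodule.span_le.2 ?_
  rintro _ ⟨F, hF, rfl⟩
  exact aeval_eigPoly_apply_eq_zero_of_subset (above_subset_strictAbove hF) (ih F hF)

lemma aeval_eigPoly_eq_zero (q t : K) {E : YoungDiagram} {f : Sym K}
    (hf : f ∈ schurAbove (K := K) E) :
    Polynomial.aeval (macOpConj q t) (eigPoly q t (above E)) f = 0 := by
  suffices schurAbove E ≤
      LinearMap.ker (Polynomial.aeval (macOpConj q t) (eigPoly q t (above E))) from this hf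
  refine Submodule.span_le.2 ?_
  rintro _ ⟨F, ⟨hc, hd⟩, rfl⟩
  exact aeval_eigPoly_apply_eq_zero_of_subset (above_subset_above hc hd) (aeval_eigPoly_schur q t F)

lemma schurAbove_le_comap_macOpConj (q t : K) (E : YoungDiagram) :
    schurAbove E ≤ (schurAbove (K := K) E).comap (macOpConj q t) := by
  refine Submodule.span_le.2 ?_
  rintro _ ⟨F, ⟨hc, hd⟩, rfl⟩
  refine schurAbove_mono hc hd ?_
  rw [← sub_add_cancel (macOpConj q t (schur F)) (eig q t F • schur F)]
  exact Submodule.add_mem _ (schurStrict_le_schurAbove F (macOpConj_schur_sub_mem q t F))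
    (Submodule.smul_mem _ _ (schur_mem_schurAbove F))

/-- An eigenvector of `macOpConj q t` with eigenvalue `eig q t E`, obtained from `s_E` by killing
the eigenvalues of all the diagrams strictly above `E`. -/
def conjEigenvec (q t : K) (E : YoungDiagram) : Sym K :=
  Polynomial.aeval (macOpConj q t) (eigPoly q t (strictAbove E)) (schur E)

/-- The corresponding eigenvector of `macOp q t`; when it is nonzero, this is the modified Macdonald
function of `E` up to normalization. -/
def eigenvec (q t : K) (E : YoungDiagram) : Sym K := plethInv q (conjEigenvec q t E)

lemma conjEigenvec_mem (q t : K) (E : YoungDiagram) : conjEigenvec q t E ∈ schurAbove (K := K) E :=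
  aeval_apply_mem (schurAbove_le_comap_macOpConj q t E) _ (schur_mem_schurAbove E)

lemma plethOneSub_eigenvec_mem {q : K} (hq : ∀ k : ℕ+, 1 - q ^ (k : ℕ) ≠ 0) (t : K)
    (E : YoungDiagram) : plethOneSub q (eigenvec q t E) ∈ schurAbove (K := K) E := by
  rw [eigenvec, plethOneSub_plethInv hq]
  exact conjEigenvec_mem q t E

lemma eigenvec_mem_homog (q t : K) (E : YoungDiagram) : eigenvec q t E ∈ homog K E.card :=
  scale_mem_homog _ (schurAbove_le_homog E (conjEigenvec_mem q t E))

lemma macOpConj_conjEigenvec (q t : K) (E : YoungDiagram) :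
    macOpConj q t (conjEigenvec q t E) = eig q t E • conjEigenvec q t E := by
  have h := aeval_eigPoly_schur q t E
  rwa [eigPoly_above, map_mul, Module.End.mul_apply, aeval_X_sub_C_apply, sub_eq_zero] at h

lemma macOp_eigenvec {q : K} (hq : ∀ k : ℕ+, 1 - q ^ (k : ℕ) ≠ 0) (t : K) (E : YoungDiagram) :
    macOp q t (eigenvec q t E) = eig q t E • eigenvec q t E := by
  refine (Function.LeftInverse.injective (plethInv_plethOneSub hq)) ?_
  rw [plethOneSub_macOp, map_smul, eigenvec, plethOneSub_plethInv hq, macOpConj_conjEigenvec]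

lemma aeval_macOp_eigPoly_eq_zero {q : K} (hq : ∀ k : ℕ+, 1 - q ^ (k : ℕ) ≠ 0) (t : K)
    {E : YoungDiagram} {f : Sym K} (hf : plethOneSub q f ∈ schurAbove (K := K) E) :
    Polynomial.aeval (macOp q t) (eigPoly q t (above E)) f = 0 := by
  refine (Function.LeftInverse.injective (plethInv_plethOneSub hq)) ?_
  rw [map_zero, ← aeval_eigPoly_eq_zero q t hf]
  exact map_aeval_apply (φ := (plethOneSub q).toLinearMap) (plethOneSub_macOp q t) _ f

end Eigenvectors

/-! ### Conjugate diagrams -/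

section Transpose

open YoungDiagram (mem_transpose mem_iff_lt_rowLen mem_iff_lt_colLen)

@[to_additive]
lemma prod_cells_transpose {M : Type*} [CommMonoid M] (D : YoungDiagram) (f : ℕ × ℕ → M) :
    ∏ s ∈ D.transpose.cells, f s = ∏ s ∈ D.cells, f s.swap :=
  Finset.prod_nbij' Prod.swap Prod.swap (fun _ hs => mem_transpose.1 hs)
    (fun _ hs => mem_transpose.2 (by simpa using hs)) (by simp) (by simp) (by simp)

lemma phi_transpose {K : Type*} [Field K] (q t : K) (D : YoungDiagram) :
    phi q t D.transpose = phi t q D := by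
  simp [phi, sum_cells_transpose, mul_comm]

lemma eig_transpose {K : Type*} [Field K] (q t : K) (D : YoungDiagram) :
    eig q t D.transpose = eig t q D := by
  rw [eig, eig, phi_transpose]; ring

lemma card_transpose (D : YoungDiagram) : D.transpose.card = D.card := by
  rw [YoungDiagram.card, YoungDiagram.card, Finset.card_eq_sum_ones, Finset.card_eq_sum_ones,
    sum_cells_transpose]

lemma card_filter_fst_lt (D : YoungDiagram) (r : ℕ) :
    (D.cells.filter fun s => s.1 < r).card = ∑ i ∈ range r, D.rowLen i := by
  rw [Finset.card_eq_sum_card_fiberwise (f := Prod.fst) (t := range r) fun s hs => by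
    simpa using (Finset.mem_filter.1 hs).2]
  refine Finset.sum_congr rfl fun i hi => ?_
  rw [YoungDiagram.rowLen_eq_card, YoungDiagram.row, Finset.filter_filter]
  refine congrArg Finset.card (Finset.filter_congr fun s _ => ?_)
  have := Finset.mem_range.1 hi
  omega

lemma card_filter_snd_lt (D : YoungDiagram) (k : ℕ) :
    (D.cells.filter fun s => s.2 < k).card = ∑ j ∈ range k, D.transpose.rowLen j := by
  rw [← card_filter_fst_lt, Finset.card_filter, Finset.card_filter, sum_cells_transpose]
  rfl

lemma sum_rowLen_transpose_add_le (D : YoungDiagram) (k r : ℕ) :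
    ∑ j ∈ range k, D.transpose.rowLen j + ∑ i ∈ range r, D.rowLen i ≤ D.card + r * k := by
  rw [← card_filter_snd_lt, ← card_filter_fst_lt, ← Finset.card_union_add_card_inter]
  refine add_le_add (Finset.card_le_card ?_)
    ((Finset.card_le_card (t := range r ×ˢ range k) ?_).trans (by simp))
  · exact Finset.union_subset (Finset.filter_subset _ _) (Finset.filter_subset _ _)
  · intro s
    simp only [Finset.mem_inter, Finset.mem_filter, Finset.mem_product, Finset.mem_range]
    tauto

lemma sum_rowLen_transpose_add_eq (D : YoungDiagram) (k : ℕ) :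
    ∑ j ∈ range k, D.transpose.rowLen j + ∑ i ∈ range (D.colLen k), D.rowLen i =
      D.card + D.colLen k * k := by
  have hunion : (D.cells.filter fun s => s.2 < k) ∪ (D.cells.filter fun s => s.1 < D.colLen k) =
      D.cells := by
    rw [← Finset.filter_or, Finset.filter_eq_self]
    rintro ⟨i, j⟩ h
    exact (lt_or_ge j k).imp_right fun hj => mem_iff_lt_colLen.1 (D.up_left_mem le_rfl hj h)
  have hinter : (D.cells.filter fun s => s.2 < k) ∩ (D.cells.filter fun s => s.1 < D.colLen k) =
      range (D.colLen k) ×ˢ range k := by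
    ext ⟨i, j⟩
    simp only [Finset.mem_inter, Finset.mem_filter, Finset.mem_product, Finset.mem_range]
    exact ⟨fun h => ⟨h.2.2, h.1.2⟩, fun ⟨hi, hj⟩ =>
      have hmem := D.up_left_mem le_rfl hj.le (mem_iff_lt_colLen.2 hi)
      ⟨⟨hmem, hj⟩, hmem, hi⟩⟩
  rw [← card_filter_snd_lt, ← card_filter_fst_lt, ← Finset.card_union_add_card_inter, hunion,
    hinter]
  simp

lemma Dominates.transpose {F E : YoungDiagram} (hc : F.card = E.card) (h : Dominates F E) :
    Dominates E.transpose F.transpose := by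
  intro k
  have hF := sum_rowLen_transpose_add_le F k (E.colLen k)
  have hE := sum_rowLen_transpose_add_eq E k
  have := h (E.colLen k)
  omega

end Transpose

/-! ### Existence and uniqueness of the modified Macdonald functions -/

section Macdonald

variable {K : Type*} [Field K] [CharZero K]

/-- Genericity of the parameters `q`, `t` in degree `n`: neither is a root of unity, the Macdonald
operator has distinct eigenvalues in degree `n`, and its eigenvectors do not degenerate. -/
structure Generic (q t : K) (n : ℕ) : Prop where
  left_ne : ∀ k : ℕ+, 1 - q ^ (k : ℕ) ≠ 0
  right_ne : ∀ k : ℕ+, 1 - t ^ (k : ℕ) ≠ 0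
  eig_inj : ∀ D E : YoungDiagram, D.card = n → E.card = n → eig q t D = eig q t E → D = E
  evOne_eigenvec_ne : ∀ E : YoungDiagram, E.card = n → evOne K (eigenvec q t E) ≠ 0
  eigenvec_swap_ne : ∀ E : YoungDiagram, E.card = n → eigenvec t q E ≠ 0

namespace Generic

variable {q t : K} {n : ℕ} (h : Generic q t n)

include h

lemma eq_smul_eigenvec (lam : n.Partition) {f : Sym K} (hf : f ∈ homog K n)
    (he : macOp q t f = eig q t (diagram lam) • f) :
    ∃ c : K, f = c • eigenvec q t (diagram lam) := by
  have hinj : Function.Injective fun mu : n.Partition => eig q t (diagram mu) := fun a b hab =>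
    diagram_injective n (h.eig_inj _ _ (card_diagram a) (card_diagram b) hab)
  have heig (mu : n.Partition) := macOp_eigenvec h.left_ne t (diagram mu)
  have hli : LinearIndependent K fun mu : n.Partition => eigenvec q t (diagram mu) :=
    Module.End.eigenvectors_linearIndependent' (macOp q t) _ hinj _ fun mu =>
      ⟨Module.End.mem_eigenspace_iff.2 (heig mu), fun h0 =>
        h.evOne_eigenvec_ne _ (card_diagram mu) (by rw [h0, map_zero])⟩
  have hhom (mu : n.Partition) : eigenvec q t (diagram mu) ∈ homog K n := by
    simpa only [card_diagram] using eigenvec_mem_homog q t (diagram mu)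
  exact exists_eq_smul_of_mem_span hinj hli heig (homog_le_span_of_linearIndependent hli hhom hf) he

omit [CharZero K] in
lemma isCoprime_eigPoly {E : YoungDiagram} (hE : E.card = n) :
    IsCoprime (eigPoly q t (strictAbove E)) (eigPoly t q (strictAbove E.transpose)) := by
  refine IsCoprime.prod_left fun F hF => IsCoprime.prod_right fun G hG => ?_
  rw [mem_strictAbove] at hF hG
  refine Polynomial.isCoprime_X_sub_C_of_isUnit_sub (IsUnit.mk0 _ (sub_ne_zero.2 fun he => ?_))
  rw [← eig_transpose q t G] at he
  have hFG : F = G.transpose := h.eig_inj F G.transpose (hF.1.trans hE)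
    (by rw [card_transpose, hG.1, card_transpose, hE]) he
  have hd := hF.2.1.transpose hF.1
  rw [hFG, YoungDiagram.transpose_transpose] at hd
  exact hG.2.2 (hG.2.1.antisymm hd)

lemma macOp_eq_of_isMacdonald {E : YoungDiagram} (hE : E.card = n) {f : Sym K}
    (hf : IsMacdonald q t E f) : macOp q t f = eig q t E • f := by
  have hleft := aeval_macOp_eigPoly_eq_zero h.left_ne t hf.1
  have hright := aeval_macOp_eigPoly_eq_zero h.right_ne q hf.2.1
  rw [eigPoly_above, mul_comm, map_mul, Module.End.mul_apply, aeval_X_sub_C_apply] at hleft hright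
  rw [macOp_comm t q, eig_transpose] at hright
  exact sub_eq_zero.1
    (eq_zero_of_isCoprime_of_aeval_apply_eq_zero (h.isCoprime_eigPoly hE) hleft hright)

lemma plethOneSub_right_eigenvec_mem (lam : n.Partition) :
    plethOneSub t (eigenvec q t (diagram lam)) ∈ schurAbove (K := K) (diagram lam).transpose := by
  set E := diagram lam
  have hcard : E.transpose.card = n := (card_transpose E).trans (card_diagram lam)
  have he : macOp q t (eigenvec t q E.transpose) = eig q t E • eigenvec t q E.transpose := by
    rw [macOp_comm, macOp_eigenvec h.right_ne, eig_transpose]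
  obtain ⟨c, hc⟩ := h.eq_smul_eigenvec lam (hcard ▸ eigenvec_mem_homog t q E.transpose) he
  have hc0 : c ≠ 0 := by
    rintro rfl
    exact h.eigenvec_swap_ne E.transpose hcard (by rw [hc, zero_smul])
  rw [← inv_smul_smul₀ hc0 (eigenvec q t E), ← hc, map_smul]
  exact Submodule.smul_mem _ _ (plethOneSub_eigenvec_mem h.right_ne q E.transpose)

lemma existsUnique_isMacdonald (lam : n.Partition) :
    ∃! H : Sym K, IsMacdonald q t (diagram lam) H := by
  set E := diagram lam
  have hcard : E.card = n := card_diagram lam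
  set v := eigenvec q t E
  refine ⟨(evOne K v)⁻¹ • v, ⟨?_, ?_, ?_⟩, fun f hf => ?_⟩
  · rw [map_smul]
    exact Submodule.smul_mem _ _ (plethOneSub_eigenvec_mem h.left_ne t E)
  · rw [map_smul]
    exact Submodule.smul_mem _ _ (h.plethOneSub_right_eigenvec_mem lam)
  · rw [hall_complete (Submodule.smul_mem _ _ (eigenvec_mem_homog q t E)), map_smul, smul_eq_mul,
      inv_mul_cancel₀ (h.evOne_eigenvec_ne E hcard)]
  · have hfh := mem_homog_of_plethOneSub_mem_schurAbove h.left_ne hf.1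
    obtain ⟨c, rfl⟩ := h.eq_smul_eigenvec lam (hcard ▸ hfh) (h.macOp_eq_of_isMacdonald hcard hf)
    have hone := hf.2.2
    rw [hall_complete hfh, map_smul, smul_eq_mul] at hone
    rw [← eq_inv_of_mul_eq_one_left hone]

lemma isMacdonald_macdonald (lam : n.Partition) :
    IsMacdonald q t (diagram lam) (macdonald q t (diagram lam)) := by
  have hex := h.existsUnique_isMacdonald lam
  rw [macdonald, dif_pos hex]
  exact hex.choose_spec.1

lemma macdonald_mem_homog (lam : n.Partition) : macdonald q t (diagram lam) ∈ homog K n := by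
  simpa only [card_diagram] using
    mem_homog_of_plethOneSub_mem_schurAbove h.left_ne (h.isMacdonald_macdonald lam).1

lemma evOne_macdonald (lam : n.Partition) : evOne K (macdonald q t (diagram lam)) = 1 := by
  have hone := (h.isMacdonald_macdonald lam).2.2
  rwa [card_diagram, hall_complete (h.macdonald_mem_homog lam)] at hone

lemma pairAlmostRow_macdonald (lam : n.Partition) :
    pairAlmostRow K (macdonald q t (diagram lam)) = phi q t (diagram lam) := by
  have he := congrArg (evOne K)
    (h.macOp_eq_of_isMacdonald (card_diagram lam) (h.isMacdonald_macdonald lam))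
  rw [evOne_macOp, map_smul, h.evOne_macdonald, smul_eq_mul, mul_one, eig] at he
  have hq : 1 - q ≠ 0 := by simpa using h.left_ne 1
  have ht : 1 - t ≠ 0 := by simpa using h.right_ne 1
  exact mul_left_cancel₀ (mul_ne_zero hq ht) (by linear_combination -he)

end Generic

end Macdonald

/-! ### Specialization of coefficients -/

section Specialization

section Pairs

variable {A B : Type*} [CommRing A] [CommRing B] {T : Subring (A × B)} {a a' : A} {b b' : B}

lemma mk_mul_mem (h : (a, b) ∈ T) (h' : (a', b') ∈ T) : (a * a', b * b') ∈ T := T.mul_mem h h'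

lemma mk_add_mem (h : (a, b) ∈ T) (h' : (a', b') ∈ T) : (a + a', b + b') ∈ T := T.add_mem h h'

lemma mk_sub_mem (h : (a, b) ∈ T) (h' : (a', b') ∈ T) : (a - a', b - b') ∈ T := T.sub_mem h h'

lemma mk_neg_mem (h : (a, b) ∈ T) : (-a, -b) ∈ T := T.neg_mem h

lemma mk_pow_mem (h : (a, b) ∈ T) (n : ℕ) : (a ^ n, b ^ n) ∈ T := T.pow_mem h n

lemma mk_sum_mem {ι : Type*} {s : Finset ι} {f : ι → A} {g : ι → B}
    (h : ∀ i ∈ s, (f i, g i) ∈ T) :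
    (∑ i ∈ s, f i, ∑ i ∈ s, g i) ∈ T :=
  prod_mk_sum s f g ▸ T.sum_mem h

lemma mk_prod_mem {ι : Type*} {s : Finset ι} {f : ι → A} {g : ι → B}
    (h : ∀ i ∈ s, (f i, g i) ∈ T) :
    (∏ i ∈ s, f i, ∏ i ∈ s, g i) ∈ T :=
  prod_mk_prod s f g ▸ T.prod_mem h

/-- A specialization of a ring `A` to a ring `B` is encoded by a subring `T` of `A × B`, the pairs
of an element and its value; this is its extension to polynomials. -/
def polyLift (T : Subring (A × B)) : Subring (A[X] × B[X]) :=
  ((Polynomial.mapRingHom ((RingHom.fst A B).comp T.subtype)).prod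
    (Polynomial.mapRingHom ((RingHom.snd A B).comp T.subtype))).range

lemma C_mem_polyLift (h : (a, b) ∈ T) : (.C a, .C b) ∈ polyLift T := ⟨.C ⟨(a, b), h⟩, by simp⟩

lemma X_mem_polyLift : (.X, .X) ∈ polyLift T := ⟨.X, by simp⟩

lemma contract_mem {α : A⟦X⟧} {β : B⟦X⟧}
    (hαβ : ∀ n, (PowerSeries.coeff n α, PowerSeries.coeff n β) ∈ T)
    {f : A[X]} {g : B[X]} (hf : (f, g) ∈ polyLift T) : (contract α f, contract β g) ∈ T := by
  obtain ⟨F, hF⟩ := hf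
  obtain ⟨rfl, rfl⟩ := Prod.ext_iff.1 hF
  clear hF
  induction F using Polynomial.induction_on' with
  | add F G hF hG => simpa using mk_add_mem hF hG
  | monomial n x =>
    simpa [← Polynomial.C_mul_X_pow_eq_monomial, contract_C_mul_X_pow] using
      mk_mul_mem x.2 (hαβ n)

end Pairs

variable {K L : Type*} [Field K] [Field L]

/-- The extension of a specialization of coefficients to symmetric functions. -/
def symLift (S : Subring (K × L)) : Subring (Sym K × Sym L) :=
  ((MvPolynomial.map ((RingHom.fst K L).comp S.subtype)).prod
    (MvPolynomial.map ((RingHom.snd K L).comp S.subtype))).range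

variable {S : Subring (K × L)}

lemma C_mem_symLift {a : K} {b : L} (h : (a, b) ∈ S) :
    ((MvPolynomial.C a : Sym K), (MvPolynomial.C b : Sym L)) ∈ symLift S :=
  ⟨.C ⟨(a, b), h⟩, by simp⟩

lemma X_mem_symLift (k : ℕ+) :
    ((MvPolynomial.X k : Sym K), (MvPolynomial.X k : Sym L)) ∈ symLift S :=
  ⟨.X k, by simp⟩

lemma smul_mem_symLift {a : K} {b : L} (h : (a, b) ∈ S) {f : Sym K} {g : Sym L}
    (hf : (f, g) ∈ symLift S) : (a • f, b • g) ∈ symLift S := by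
  rw [← MvPolynomial.C_mul', ← MvPolynomial.C_mul']
  exact mk_mul_mem (C_mem_symLift h) hf

lemma algHom_mem_of_mem_symLift {A B : Type*} [CommRing A] [CommRing B] [Algebra K A] [Algebra L B]
    {T : Subring (A × B)} (φ : Sym K →ₐ[K] A) (ψ : Sym L →ₐ[L] B)
    (hC : ∀ a b, (a, b) ∈ S → (algebraMap K A a, algebraMap L B b) ∈ T)
    (hX : ∀ k, (φ (.X k), ψ (.X k)) ∈ T)
    {f : Sym K} {g : Sym L} (hf : (f, g) ∈ symLift S) : (φ f, ψ g) ∈ T := by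
  obtain ⟨F, hF⟩ := hf
  obtain ⟨rfl, rfl⟩ := Prod.ext_iff.1 hF
  clear hF
  induction F using MvPolynomial.induction_on with
  | C a => simpa [MvPolynomial.algHom_C] using hC a.1.1 a.1.2 a.2
  | add F G hF hG => simpa using mk_add_mem hF hG
  | mul_X F k hF => simpa using mk_mul_mem hF (hX k)

lemma evOne_mem {f : Sym K} {g : Sym L} (hf : (f, g) ∈ symLift S) : (evOne K f, evOne L g) ∈ S := by
  refine algHom_mem_of_mem_symLift _ _ (fun a b hab => hab) (fun k => ?_) hf
  simp only [evOne, MvPolynomial.aeval_X]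
  exact S.one_mem

lemma scale_mem_symLift {c : ℕ+ → K} {d : ℕ+ → L} (h : ∀ k, (c k, d k) ∈ S) {f : Sym K} {g : Sym L}
    (hf : (f, g) ∈ symLift S) : (scale c f, scale d g) ∈ symLift S := by
  refine algHom_mem_of_mem_symLift _ _ (fun a b hab => C_mem_symLift hab) (fun k => ?_) hf
  simpa [scale] using mk_mul_mem (C_mem_symLift (h k)) (X_mem_symLift k)

lemma translate_mem_polyLift {c : ℕ+ → K} {d : ℕ+ → L} (h : ∀ k, (c k, d k) ∈ S) {f : Sym K}
    {g : Sym L} (hf : (f, g) ∈ symLift S) :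
    (translate c f, translate d g) ∈ polyLift (symLift S) := by
  refine algHom_mem_of_mem_symLift _ _ (fun a b hab => C_mem_polyLift (C_mem_symLift hab))
    (fun k => ?_) hf
  rw [translate_X, translate_X]
  exact mk_add_mem (C_mem_polyLift (X_mem_symLift k))
    (mk_mul_mem (C_mem_polyLift (C_mem_symLift (h k))) (mk_pow_mem X_mem_polyLift k))

lemma phi_mem {q t : K} {q' t' : L} (hq : (q, q') ∈ S) (ht : (t, t') ∈ S) (D : YoungDiagram) :
    (phi q t D, phi q' t' D) ∈ S :=
  mk_sum_mem fun _ _ => mk_mul_mem (mk_pow_mem hq _) (mk_pow_mem ht _)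

lemma eig_mem {q t : K} {q' t' : L} (hq : (q, q') ∈ S) (ht : (t, t') ∈ S) (D : YoungDiagram) :
    (eig q t D, eig q' t' D) ∈ S :=
  mk_sub_mem S.one_mem
    (mk_mul_mem (mk_mul_mem (mk_sub_mem S.one_mem hq) (mk_sub_mem S.one_mem ht)) (phi_mem hq ht D))

variable (hS : ∀ n : ℕ, 0 < n → ((n : K)⁻¹, (n : L)⁻¹) ∈ S)

include hS

lemma complete_mem_symLift (n : ℕ) : (complete (K := K) n, complete (K := L) n) ∈ symLift S := by
  refine mk_sum_mem fun rho _ => 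
    ⟨MvPolynomial.monomial (partExponents rho) ⟨_, hS _ (zee_pos (partExponents rho))⟩, ?_⟩
  simp [partExponents]

lemma completeInt_mem_symLift (m : ℤ) :
    (completeInt (K := K) m, completeInt (K := L) m) ∈ symLift S := by
  obtain ⟨n, rfl⟩ | hm := (em (0 ≤ m)).imp_left Int.eq_ofNat_of_zero_le
  · simpa only [completeInt_natCast] using complete_mem_symLift hS n
  · rw [completeInt_of_neg (not_le.1 hm), completeInt_of_neg (not_le.1 hm)]
    exact (symLift S).zero_mem

lemma schur_mem_symLift (D : YoungDiagram) :
    (schur (K := K) D, schur (K := L) D) ∈ symLift S := by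
  simp only [schur_eq_det_jtMatrix, Matrix.det_apply']
  exact mk_sum_mem fun σ _ =>
    mk_mul_mem (intCast_mem _ _) (mk_prod_mem fun i _ => completeInt_mem_symLift hS _)

lemma coeff_eSeries_mem_symLift (n : ℕ) :
    (PowerSeries.coeff n (eSeries K), PowerSeries.coeff n (eSeries L)) ∈ symLift S := by
  induction n using Nat.strong_induction_on with
  | _ n ih =>
    rw [eSeries, eSeries, PowerSeries.coeff_invOfUnit, PowerSeries.coeff_invOfUnit]
    split_ifs
    · simp only [inv_one, Units.val_one]
      exact (symLift S).one_mem
    · simp only [inv_one, Units.val_one, neg_one_mul]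
      refine mk_neg_mem (mk_sum_mem fun x _ => ?_)
      split_ifs with hx
      · refine mk_mul_mem ?_ (ih x.2 hx)
        simpa only [hSeries, PowerSeries.coeff_mk] using complete_mem_symLift hS x.1
      · exact (symLift S).zero_mem

variable {q t : K} {q' t' : L} (hq : (q, q') ∈ S) (ht : (t, t') ∈ S)

include hq ht

lemma macOpConj_mem_symLift {f : Sym K} {g : Sym L} (hf : (f, g) ∈ symLift S) :
    (macOpConj q t f, macOpConj q' t' g) ∈ symLift S :=
  contract_mem (fun n => scale_mem_symLift (fun k => mk_sub_mem S.one_mem (mk_pow_mem hq k))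
      (coeff_eSeries_mem_symLift hS n))
    (translate_mem_polyLift (fun k => mk_sub_mem S.one_mem (mk_pow_mem ht k)) hf)

lemma conjEigenvec_mem_symLift (E : YoungDiagram) :
    (conjEigenvec q t E, conjEigenvec q' t' E) ∈ symLift S := by
  classical
  rw [conjEigenvec, conjEigenvec]
  generalize strictAbove E = s
  induction s using Finset.induction_on with
  | empty => simpa [eigPoly] using schur_mem_symLift hS E
  | insert F s hF ih =>
    simp only [eigPoly, Finset.prod_insert hF, map_mul, Module.End.mul_apply, aeval_X_sub_C_apply]
    exact mk_sub_mem (macOpConj_mem_symLift hS hq ht ih) (smul_mem_symLift (eig_mem hq ht F) ih)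

lemma evOne_eigenvec_mem (hinv : ∀ k : ℕ+, ((1 - q ^ (k : ℕ))⁻¹, (1 - q' ^ (k : ℕ))⁻¹) ∈ S)
    (E : YoungDiagram) : (evOne K (eigenvec q t E), evOne L (eigenvec q' t' E)) ∈ S :=
  evOne_mem (scale_mem_symLift hinv (conjEigenvec_mem_symLift hS hq ht E))

end Specialization

/-! ### The specialization `t = q⁻¹` -/

section Inverse

/-- The beta number `λ_i + N - 1 - i` of a diagram with at most `N` rows. -/
def betaNumber (D : YoungDiagram) (N : ℕ) (i : Fin N) : ℕ := D.rowLen i + i.rev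

lemma betaNumber_strictAnti (D : YoungDiagram) (N : ℕ) : StrictAnti (betaNumber D N) :=
  fun _ _ hij => add_lt_add_of_le_of_lt (D.rowLen_anti _ _ hij.le) (Fin.rev_lt_rev.2 hij)

variable {L : Type*} [Field L] {q : L}

lemma permScalar_inv (hq : q ≠ 0) {N : ℕ} (l : Fin N → ℤ) (σ : Equiv.Perm (Fin N)) :
    permScalar q q⁻¹ l σ = q⁻¹ ^ N + (1 - q⁻¹) * ∑ i, q ^ l i := by
  have hterm (i : Fin N) : q⁻¹ ^ (σ i : ℕ) * q ^ (l i + (σ i : ℕ)) = q ^ l i := by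
    rw [zpow_add₀ hq, zpow_natCast, mul_left_comm, ← mul_pow, inv_mul_cancel₀ hq, one_pow, mul_one]
  simp only [permScalar, hterm]

lemma macOpConj_schur_inv [CharZero L] (hq : q ≠ 0) (E : YoungDiagram) :
    macOpConj q q⁻¹ (schur E) = eig q q⁻¹ E • schur E := by
  rw [schur_eq_det_jtMatrix, macOpConj_det_jtMatrix_eq_sum, det_jtMatrix_eq_sum, Finset.smul_sum,
    ← permScalar_one]
  simp only [permScalar_inv hq]

lemma conjEigenvec_inv [CharZero L] (hq : q ≠ 0) (E : YoungDiagram) :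
    conjEigenvec q q⁻¹ E = (∏ F ∈ strictAbove E, (eig q q⁻¹ E - eig q q⁻¹ F)) • schur E := by
  rw [conjEigenvec, Module.End.aeval_apply_of_mem_apply_eq_smul (macOpConj_schur_inv hq E)]
  simp [eigPoly, Polynomial.eval_prod]

lemma eig_inv_mul_pow (hq : q ≠ 0) {N : ℕ} {D : YoungDiagram} (hN : D.rowLen N = 0) :
    eig q q⁻¹ D * q ^ N = 1 + (q - 1) * ∑ i, q ^ betaNumber D N i := by
  have hterm (i : Fin N) : (1 - q⁻¹) * (q⁻¹ ^ (i : ℕ) * q ^ D.rowLen i) * q ^ N =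
      (q - 1) * q ^ betaNumber D N i := by
    have hN : q ^ N = q ^ (i : ℕ) * q ^ (i.rev : ℕ) * q := by
      rw [← pow_add, ← pow_succ]
      congr 1
      rw [Fin.val_rev]
      omega
    rw [hN, betaNumber, pow_add, inv_pow]
    field_simp
  rw [eig_eq q q⁻¹ hN, ← Fin.sum_univ_eq_sum_range fun i => q⁻¹ ^ i * q ^ D.rowLen i, add_mul,
    ← mul_pow, inv_mul_cancel₀ hq, one_pow, Finset.mul_sum, Finset.sum_mul, Finset.mul_sum]
  simp only [hterm]

lemma range_eq_of_sum_pow_eq {ι : Type*} [Fintype ι] {A : Type*} [CommRing A] [Algebra ℚ A] {x : A}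
    (hx : Transcendental ℚ x) {f g : ι → ℕ} (h : ∑ i, x ^ f i = ∑ i, x ^ g i) :
    Set.range f = Set.range g := by
  have hpoly : (∑ i, .X ^ f i : ℚ[X]) = ∑ i, .X ^ g i :=
    transcendental_iff_injective.1 hx (by simpa using h)
  have hmem (f : ι → ℕ) (k : ℕ) : (∑ i, .X ^ f i : ℚ[X]).coeff k ≠ 0 ↔ k ∈ Set.range f := by
    rw [Polynomial.finsetSum_coeff, Ne,
      Finset.sum_eq_zero_iff_of_nonneg fun i _ => by rw [Polynomial.coeff_X_pow]; positivity]
    simp [Polynomial.coeff_X_pow, eq_comm]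
  ext k
  rw [← hmem, ← hmem, hpoly]

lemma one_sub_pow_ne_zero_of_transcendental [Algebra ℚ L] (hq : Transcendental ℚ q) (k : ℕ+) :
    1 - q ^ (k : ℕ) ≠ 0 := fun h =>
  hq.pow k.pos (sub_eq_zero.1 h ▸ isAlgebraic_one)

lemma eq_of_eig_inv_eq [Algebra ℚ L] (hq : Transcendental ℚ q) {D E : YoungDiagram}
    (hcard : D.card = E.card) (h : eig q q⁻¹ D = eig q q⁻¹ E) : D = E := by
  have hq0 : q ≠ 0 := fun h0 => hq (h0 ▸ isAlgebraic_zero)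
  have hq1 : q - 1 ≠ 0 := fun h1 => hq (sub_eq_zero.1 h1 ▸ isAlgebraic_one)
  have hsum : ∑ i, q ^ betaNumber D D.card i = ∑ i, q ^ betaNumber E D.card i := by
    have hD := eig_inv_mul_pow hq0 (rowLen_eq_zero (D := D) le_rfl)
    have hE := eig_inv_mul_pow hq0 (rowLen_eq_zero (D := E) hcard.ge)
    exact mul_left_cancel₀ hq1 (add_left_cancel (hD.symm.trans (h ▸ hE)))
  have hbeta : betaNumber D D.card = betaNumber E D.card :=
    (StrictAnti.range_inj (betaNumber_strictAnti _ _) (betaNumber_strictAnti _ _)).1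
      (range_eq_of_sum_pow_eq hq hsum)
  refine diagram_ext fun i => ?_
  obtain hi | hi := lt_or_ge i D.card
  · exact add_right_cancel (congrFun hbeta ⟨i, hi⟩)
  · rw [rowLen_eq_zero hi, rowLen_eq_zero (hcard ▸ hi)]

lemma det_of_prod_sub {R : Type*} [CommRing R] [IsDomain R] {N : ℕ} (y : Fin N → R) (a : ℕ → R) :
    (Matrix.of fun i j : Fin N => ∏ r ∈ range j, (y i - a r)).det = (Matrix.vandermonde y).det := by
  set p : Fin N → R[X] := fun j => ∏ r ∈ range j, (.X - .C (a r)) with hp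
  rw [Matrix.det_eval_matrixOfPolynomials_eq_det_vandermonde y p]
  · simp [hp, Polynomial.eval_prod]
  · simp [hp]
  · exact fun j => Polynomial.monic_prod_X_sub_C _ _

lemma pow_injective_of_one_sub_pow_ne_zero (hq : ∀ k : ℕ+, 1 - q ^ (k : ℕ) ≠ 0) (hq0 : q ≠ 0) :
    Function.Injective fun n : ℕ => q ^ n := by
  refine .of_lt_imp_ne fun m n hmn h => ?_
  obtain ⟨d, rfl⟩ := Nat.exists_eq_add_of_lt hmn
  refine hq d.succPNat (sub_eq_zero.2 (mul_left_cancel₀ (pow_ne_zero m hq0) ?_))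
  simpa [← pow_add, add_assoc] using h

/-- The principal specialization `f ↦ f[1/(1-q)]`. -/
def principalEval (q : L) : Sym L →ₐ[L] L := (evOne L).comp (plethInv q)

section

variable [CharZero L] (hq : ∀ k : ℕ+, 1 - q ^ (k : ℕ) ≠ 0)

include hq

lemma principalEval_complete_succ (n : ℕ) :
    principalEval q (complete n) = (1 - q ^ (n + 1)) * principalEval q (complete (n + 1)) := by
  have hseries : (qSeries q).map (principalEval q : Sym L →+* L) = 1 - PowerSeries.X := by
    rw [← map_evOne_eSeries]
    ext n
    simp [qSeries, principalEval, plethInv_plethOneSub hq]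
  have h := congrArg (PowerSeries.map (principalEval q : Sym L →+* L)) (qSeries_mul_hSeries q)
  rw [map_mul, hseries] at h
  have hcoeff := congrArg (PowerSeries.coeff (n + 1)) h
  simp only [sub_mul, one_mul, map_sub, PowerSeries.coeff_map, PowerSeries.coeff_succ_X_mul,
    PowerSeries.coeff_mk, hSeries, map_mul, RingHom.coe_coe, MvPolynomial.algHom_C] at hcoeff
  simp only [Algebra.algebraMap_self, RingHom.id_apply] at hcoeff
  linear_combination -hcoeff

lemma principalEval_complete_ne_zero (n : ℕ) : principalEval q (complete n) ≠ 0 := by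
  induction n with
  | zero => simp [complete_zero]
  | succ n ih => exact right_ne_zero_of_mul (principalEval_complete_succ hq n ▸ ih)

lemma principalEval_completeInt_sub_one (m : ℤ) :
    principalEval q (completeInt (m - 1)) = (1 - q ^ m) * principalEval q (completeInt m) := by
  obtain h | rfl | h := lt_trichotomy m 0
  · simp [completeInt_of_neg h, completeInt_of_neg (show m - 1 < 0 by omega)]
  · simp [completeInt_of_neg]
  · obtain ⟨n, hn⟩ := Int.eq_ofNat_of_zero_le (show 0 ≤ m - 1 by omega)
    obtain rfl : m = (n + 1 : ℕ) := by omega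
    rw [hn, completeInt_natCast, completeInt_natCast, zpow_natCast,
      principalEval_complete_succ hq]

variable (hq0 : q ≠ 0)

include hq0

lemma principalEval_completeInt_sub (m : ℤ) (k : ℕ) :
    principalEval q (completeInt (m - k)) =
      (∏ r ∈ range k, -(q ^ r)⁻¹) * (principalEval q (completeInt m) *
        ∏ r ∈ range k, (q ^ m - q ^ r)) := by
  induction k with
  | zero => simp
  | succ k ih =>
    rw [Nat.cast_succ, ← sub_sub, principalEval_completeInt_sub_one hq, ih, zpow_sub₀ hq0,
      Finset.prod_range_succ, Finset.prod_range_succ, zpow_natCast]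
    have hk : q ^ k ≠ 0 := pow_ne_zero k hq0
    field_simp
    ring

lemma principalEval_schur_ne_zero (E : YoungDiagram) : principalEval q (schur E) ≠ 0 := by
  set y : Fin E.card → L := fun i => q ^ betaNumber E E.card i
  have hJT : (principalEval q : Sym L →+* L).mapMatrix (jtMatrix L (shiftedRowLen E)) =
      (Matrix.of fun i j : Fin E.card => (∏ r ∈ range j, -(q ^ r)⁻¹) * Matrix.of (fun i j =>
        principalEval q (complete (betaNumber E E.card i)) * Matrix.of (fun i j : Fin E.card =>
          ∏ r ∈ range j, (y i - q ^ r)) i j) i j).submatrix id Fin.revPerm := by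
    ext i j
    have hij : shiftedRowLen E i + (j : ℤ) = (betaNumber E E.card i : ℤ) - (j.rev : ℕ) := by
      simp only [shiftedRowLen, betaNumber, Fin.val_rev]
      omega
    simpa [jtMatrix, hij, completeInt_natCast] using
      principalEval_completeInt_sub hq hq0 (betaNumber E E.card i) j.rev
  have hdet : principalEval q (schur E) = ((principalEval q : Sym L →+* L).mapMatrix
      (jtMatrix L (shiftedRowLen E))).det := (RingHom.map_det _ _)
  rw [hdet, hJT, Matrix.det_permute', Matrix.det_mul_row, Matrix.det_mul_column, det_of_prod_sub]
  refine mul_ne_zero (Int.cast_ne_zero.2 (Units.ne_zero _)) (mul_ne_zero ?_ (mul_ne_zero ?_ ?_))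
  · exact Finset.prod_ne_zero_iff.2 fun i _ => Finset.prod_ne_zero_iff.2 fun r _ =>
      neg_ne_zero.2 (inv_ne_zero (pow_ne_zero r hq0))
  · exact Finset.prod_ne_zero_iff.2 fun i _ => principalEval_complete_ne_zero hq _
  · exact Matrix.det_vandermonde_ne_zero_iff.2 <|
      (pow_injective_of_one_sub_pow_ne_zero hq hq0).comp (betaNumber_strictAnti E _).injective

end

lemma evOne_eigenvec_inv_ne_zero [CharZero L] [Algebra ℚ L] (hq : Transcendental ℚ q)
    (E : YoungDiagram) : evOne L (eigenvec q q⁻¹ E) ≠ 0 := by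
  have hq0 : q ≠ 0 := fun h0 => hq (h0 ▸ isAlgebraic_zero)
  rw [eigenvec, conjEigenvec_inv hq0, map_smul, map_smul, smul_eq_mul]
  refine mul_ne_zero (Finset.prod_ne_zero_iff.2 fun F hF => sub_ne_zero.2 fun h => ?_)
    (principalEval_schur_ne_zero (one_sub_pow_ne_zero_of_transcendental hq) hq0 E)
  obtain ⟨hcard, -, hne⟩ := mem_strictAbove.1 hF
  exact hne (eq_of_eig_inv_eq hq hcard h.symm)

end Inverse

/-! ### Values of rational functions -/

section Values

variable {L : Type*} [Field L] [Algebra ℚ L] {a b : L}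

lemma algebraMap_ne_zero_of_aeval {Q : MvPolynomial (Fin 2) ℚ}
    (hQ : MvPolynomial.aeval ![a, b] Q ≠ 0) : algebraMap _ Qzw Q ≠ 0 := by
  rw [Ne, IsFractionRing.to_map_eq_zero_iff]
  rintro rfl
  exact hQ (map_zero _)

/-- The subring of the pairs `(f, f(a, b))`, where `f` is defined at `(a, b)`. -/
def specAt (a b : L) : Subring (Qzw × L) where
  carrier := {x | HasValueAt x.1 a b x.2}
  one_mem' := ⟨1, 1, by simp⟩
  zero_mem' := ⟨0, 1, by simp⟩
  mul_mem' := by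
    rintro ⟨_, _⟩ ⟨_, _⟩ ⟨P, Q, hQ, rfl, rfl⟩ ⟨P', Q', hQ', rfl, rfl⟩
    exact ⟨P * P', Q * Q', by simp [hQ, hQ'], by simp [div_mul_div_comm],
      by simp [div_mul_div_comm]⟩
  add_mem' := by
    rintro ⟨_, _⟩ ⟨_, _⟩ ⟨P, Q, hQ, rfl, rfl⟩ ⟨P', Q', hQ', rfl, rfl⟩
    refine ⟨P * Q' + Q * P', Q * Q', by simp [hQ, hQ'], ?_, ?_⟩
    · simp [div_add_div _ _ (algebraMap_ne_zero_of_aeval hQ) (algebraMap_ne_zero_of_aeval hQ')]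
    · simp [div_add_div _ _ hQ hQ']
  neg_mem' := by
    rintro ⟨_, _⟩ ⟨P, Q, hQ, rfl, rfl⟩
    exact ⟨-P, Q, hQ, by simp [neg_div], by simp [neg_div]⟩

lemma zVar_mem_specAt : (zVar, a) ∈ specAt a b := ⟨.X 0, 1, by simp [zVar]⟩

lemma wVar_mem_specAt : (wVar, b) ∈ specAt a b := ⟨.X 1, 1, by simp [wVar]⟩

lemma eq_zero_of_mem_specAt {v : L} (h : ((0 : Qzw), v) ∈ specAt a b) : v = 0 := by
  obtain ⟨P, Q, hQ, hf, hv⟩ := h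
  have hP := (div_eq_zero_iff.1 hf.symm).resolve_right (algebraMap_ne_zero_of_aeval hQ)
  rw [IsFractionRing.to_map_eq_zero_iff] at hP
  exact hv.trans (by rw [hP, map_zero, zero_div])

lemma ne_zero_of_mem_specAt {f : Qzw} {v : L} (h : (f, v) ∈ specAt a b) (hv : v ≠ 0) : f ≠ 0 := by
  rintro rfl
  exact hv (eq_zero_of_mem_specAt h)

lemma inv_mem_specAt {f : Qzw} {v : L} (h : (f, v) ∈ specAt a b) (hv : v ≠ 0) :
    (f⁻¹, v⁻¹) ∈ specAt a b := by
  obtain ⟨P, Q, -, rfl, rfl⟩ := h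
  exact ⟨Q, P, (div_ne_zero_iff.1 hv).1, by simp, by simp⟩

lemma natCast_inv_mem_specAt (n : ℕ) (hn : 0 < n) : ((n : Qzw)⁻¹, (n : L)⁻¹) ∈ specAt a b := by
  have : CharZero L := algebraRat.charZero L
  exact inv_mem_specAt (natCast_mem (specAt a b) n) (Nat.cast_ne_zero.2 hn.ne')

section Generic

variable {q t : Qzw} {x : L} (hx : Transcendental ℚ x)

include hx

lemma one_sub_pow_ne_zero_of_mem_specAt (hq : (q, x) ∈ specAt a b) (k : ℕ+) :
    1 - q ^ (k : ℕ) ≠ 0 :=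
  ne_zero_of_mem_specAt (mk_sub_mem (specAt a b).one_mem (mk_pow_mem hq k))
    (one_sub_pow_ne_zero_of_transcendental hx k)

lemma evOne_eigenvec_ne_zero_of_mem_specAt (hq : (q, x) ∈ specAt a b)
    (ht : (t, x⁻¹) ∈ specAt a b) (E : YoungDiagram) : evOne Qzw (eigenvec q t E) ≠ 0 := by
  have : CharZero L := algebraRat.charZero L
  refine ne_zero_of_mem_specAt (evOne_eigenvec_mem natCast_inv_mem_specAt hq ht (fun k => ?_) E)
    (evOne_eigenvec_inv_ne_zero hx E)
  exact inv_mem_specAt (mk_sub_mem (specAt a b).one_mem (mk_pow_mem hq k))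
    (one_sub_pow_ne_zero_of_transcendental hx k)

lemma generic_of_mem_specAt (hq : (q, x) ∈ specAt a b) (ht : (t, x⁻¹) ∈ specAt a b) (n : ℕ) :
    Generic q t n where
  left_ne := one_sub_pow_ne_zero_of_mem_specAt hx hq
  right_ne := one_sub_pow_ne_zero_of_mem_specAt (mt IsAlgebraic.inv_iff.1 hx) ht
  eig_inj D E hD hE h := by
    have hDE := mk_sub_mem (eig_mem hq ht D) (eig_mem hq ht E)
    rw [h, sub_self] at hDE
    exact eq_of_eig_inv_eq hx (hD.trans hE.symm) (sub_eq_zero.1 (eq_zero_of_mem_specAt hDE))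
  evOne_eigenvec_ne E _ := evOne_eigenvec_ne_zero_of_mem_specAt hx hq ht E
  eigenvec_swap_ne E _ h := evOne_eigenvec_ne_zero_of_mem_specAt (mt IsAlgebraic.inv_iff.1 hx) ht
    (by rwa [inv_inv]) E (by rw [h, map_zero])

end Generic

lemma transcendental_ratFunc_X : Transcendental ℚ (RatFunc.X : RatFunc ℚ) := by
  convert RatFunc.transcendental_X (K := ℚ) using 1
  exact Subsingleton.elim _ _

lemma generic_zVar_wVar (n : ℕ) : Generic (zVar ^ 2) (wVar ^ 2) n := by
  refine generic_of_mem_specAt (a := RatFunc.X) (b := RatFunc.X⁻¹)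
    (transcendental_ratFunc_X.pow two_pos) (mk_pow_mem zVar_mem_specAt 2) ?_ n
  rw [← inv_pow]
  exact mk_pow_mem wVar_mem_specAt 2

end Values

/-! ### The plethystic logarithm of `Ω` -/

section Logarithm

variable {A : Type*} [CommRing A] [Algebra ℚ A] {F : A⟦X⟧}

lemma mul_derivative_logOf (hF : PowerSeries.constantCoeff F = 1) :
    F * PowerSeries.derivative A (PowerSeries.logOf F) = PowerSeries.derivative A F := by
  have hlog : (1 + PowerSeries.X) * PowerSeries.derivative A (PowerSeries.log A) = 1 := by
    ext n
    rw [PowerSeries.deriv_log, add_mul, one_mul, map_add]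
    rcases n with _ | n
    · simp
    · simp [PowerSeries.coeff_succ_X_mul, PowerSeries.coeff_one, pow_succ]
  have hs : PowerSeries.HasSubst (F - 1) := .of_constantCoeff_zero' (by simp [hF])
  have hsubst := congrArg (PowerSeries.substAlgHom (R := A) hs) hlog
  simp only [map_mul, map_add, map_one, PowerSeries.coe_substAlgHom, PowerSeries.subst_X hs,
    add_sub_cancel] at hsubst
  rw [PowerSeries.logOf_eq, PowerSeries.derivative_subst hs, ← mul_assoc, hsubst]
  simp

variable [IsDomain A] {R : Type*} [CommSemiring R] [Algebra R A]

lemma mul_mk_derivation_logOf (δ : Derivation R A A) (hF : PowerSeries.constantCoeff F = 1) :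
    F * PowerSeries.mk (fun n => δ (PowerSeries.coeff n (PowerSeries.logOf F))) =
      PowerSeries.mk fun n => δ (PowerSeries.coeff n F) := by
  have : IsAddTorsionFree A := IsAddTorsionFree.of_module_rat A
  set Δ : A⟦X⟧ → A⟦X⟧ := fun G => PowerSeries.mk fun n => δ (PowerSeries.coeff n G) with hΔ
  have hΔ_mul (G H : A⟦X⟧) : Δ (G * H) = G * Δ H + H * Δ G := by
    ext n
    rw [mul_comm H]
    simp only [hΔ, map_add, PowerSeries.coeff_mk, PowerSeries.coeff_mul, map_sum,
      Derivation.leibniz, smul_eq_mul, Finset.sum_add_distrib, mul_comm (PowerSeries.coeff _ H)]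
  have hΔ_derivative (G : A⟦X⟧) :
      PowerSeries.derivative A (Δ G) = Δ (PowerSeries.derivative A G) := by
    ext n
    simp only [hΔ, PowerSeries.coeff_derivative, PowerSeries.coeff_mk]
    rw [mul_comm (PowerSeries.coeff _ G), ← Nat.cast_succ, ← nsmul_eq_mul, map_nsmul,
      nsmul_eq_mul, mul_comm]
  have hL := mul_derivative_logOf hF
  set L := PowerSeries.logOf F
  have hF0 : F ≠ 0 := fun h => by simp [h] at hF
  refine sub_eq_zero.1 (eq_of_derivative_eq_mul (P := PowerSeries.derivative A L)
    (mul_left_cancel₀ hF0 ?_) (by simp) ?_)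
  · have hd := congrArg Δ hL
    rw [hΔ_mul] at hd
    change F * PowerSeries.derivative A (F * Δ L - Δ F) = _
    rw [map_sub, Derivation.leibniz, hΔ_derivative, hΔ_derivative, ← hd, ← hL, smul_eq_mul,
      smul_eq_mul]
    ring
  · have hL0 : PowerSeries.constantCoeff L = 0 := PowerSeries.constantCoeff_logOf hF
    have hΔ_constantCoeff (G : A⟦X⟧) :
        PowerSeries.constantCoeff (Δ G) = δ (PowerSeries.constantCoeff G) := by
      rw [← PowerSeries.coeff_zero_eq_constantCoeff_apply, PowerSeries.coeff_mk,
        PowerSeries.coeff_zero_eq_constantCoeff_apply]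
    change PowerSeries.constantCoeff (F * Δ L - Δ F) = _
    rw [map_sub, map_mul, hΔ_constantCoeff, hΔ_constantCoeff, hF, hL0, map_zero, mul_zero,
      δ.map_one_eq_zero, sub_zero, map_zero]

end Logarithm

section Euler

variable {K : Type*} [Field K]

variable (K) in
/-- The Euler derivation `∑ k p_k ∂/∂p_k`, which multiplies a symmetric function by its degree. -/
def euler : Derivation K (Sym K) (Sym K) :=
  MvPolynomial.mkDerivation K fun k : ℕ+ => (k : Sym K) * MvPolynomial.X k

lemma euler_X (k : ℕ+) : euler K (.X k) = (k : Sym K) * MvPolynomial.X k :=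
  MvPolynomial.mkDerivation_X _ _ _

lemma euler_monomial (m : ℕ+ →₀ ℕ) (c : K) :
    euler K (.monomial m c) = .monomial m (weight m * c) := by
  rw [euler, MvPolynomial.mkDerivation_monomial, Finsupp.weight_apply, Finsupp.sum, Finsupp.sum,
    Nat.cast_sum, Finset.sum_mul, map_sum, Finset.smul_sum]
  refine Finset.sum_congr rfl fun k hk => ?_
  have hle : Finsupp.single k 1 ≤ m := by
    simpa [Nat.one_le_iff_ne_zero] using Finsupp.mem_support_iff.1 hk
  rw [← map_natCast MvPolynomial.C, MvPolynomial.X, MvPolynomial.C_mul_monomial, smul_eq_mul,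
    MvPolynomial.monomial_mul, tsub_add_cancel_of_le hle, MvPolynomial.smul_monomial, smul_eq_mul,
    smul_eq_mul, Nat.cast_mul, mul_one, mul_comm c]

lemma coeff_euler (m : ℕ+ →₀ ℕ) (f : Sym K) : (euler K f).coeff m = weight m * f.coeff m := by
  induction f using MvPolynomial.induction_on' with
  | monomial u a =>
    rw [euler_monomial, MvPolynomial.coeff_monomial, MvPolynomial.coeff_monomial]
    split_ifs with h <;> simp [h]
  | add f g hf hg => rw [map_add, MvPolynomial.coeff_add, MvPolynomial.coeff_add, hf, hg, mul_add]

lemma mem_homog_iff_euler [CharZero K] {n : ℕ} {f : Sym K} :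
    f ∈ homog K n ↔ euler K f = (n : Sym K) * f := by
  rw [MvPolynomial.ext_iff]
  refine forall_congr' fun m => ?_
  rw [coeff_euler, ← map_natCast MvPolynomial.C, MvPolynomial.coeff_C_mul, mul_eq_mul_right_iff,
    Nat.cast_inj, or_iff_not_imp_right]

variable [Algebra ℚ K] {F : (Sym K)⟦X⟧}

lemma coeff_logOf_mem_homog (hF0 : PowerSeries.constantCoeff F = 1)
    (hF : ∀ n, PowerSeries.coeff n F ∈ homog K n) (n : ℕ) :
    PowerSeries.coeff n (PowerSeries.logOf F) ∈ homog K n := by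
  have : CharZero K := algebraRat.charZero K
  have hF_ne : F ≠ 0 := fun h => by simp [h] at hF0
  have hmk {G : (Sym K)⟦X⟧} :
      (PowerSeries.mk fun n => (n : Sym K) * PowerSeries.coeff n G) =
        PowerSeries.X * PowerSeries.derivative _ G := by
    ext1 n
    rcases n with _ | n
    · simp
    · rw [PowerSeries.coeff_succ_X_mul, PowerSeries.coeff_derivative, PowerSeries.coeff_mk,
        Nat.cast_succ, mul_comm]
  have hlog := mul_mk_derivation_logOf (euler K) hF0
  simp only [fun n => mem_homog_iff_euler.1 (hF n)] at hlog
  rw [hmk, ← mul_derivative_logOf hF0, mul_left_comm, ← hmk] at hlog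
  have hn := congrArg (PowerSeries.coeff n) (mul_left_cancel₀ hF_ne hlog)
  rw [PowerSeries.coeff_mk, PowerSeries.coeff_mk] at hn
  exact mem_homog_iff_euler.2 hn

lemma mul_mk_pairAlmostRow_logOf (hF0 : PowerSeries.constantCoeff F = 1) :
    F.map (evOne K : Sym K →+* K) *
        PowerSeries.mk (fun n => pairAlmostRow K (PowerSeries.coeff n (PowerSeries.logOf F))) =
      PowerSeries.mk fun n => pairAlmostRow K (PowerSeries.coeff n F) := by
  have h := congrArg (PowerSeries.map (evOne K : Sym K →+* K))
    (mul_mk_derivation_logOf (MvPolynomial.pderiv (R := K) 1) hF0)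
  rw [map_mul] at h
  exact h

end Euler

section Adams

lemma adams_C (d : ℕ+) (a : Qzw) : adams d (.C a) = .C (adamsQ d a) := by simp [adams]

lemma adams_X (d k : ℕ+) : adams d (.X k) = .X (d * k) := by simp [adams]

lemma adams_one : adams 1 = RingHom.id (Sym Qzw) := by
  have hQ : adamsQ 1 = RingHom.id Qzw := by
    refine IsFractionRing.ringHom_ext (A := MvPolynomial (Fin 2) ℚ) fun x => ?_
    rw [adamsQ, IsFractionRing.map, IsLocalization.map_eq]
    simp
  refine MvPolynomial.ringHom_ext (fun r => ?_) fun k => ?_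
  · rw [adams_C, hQ, RingHom.id_apply, RingHom.id_apply]
  · rw [adams_X, one_mul, RingHom.id_apply]

lemma euler_adams (d : ℕ+) (f : Sym Qzw) :
    euler Qzw (adams d f) = (d : Sym Qzw) * adams d (euler Qzw f) := by
  induction f using MvPolynomial.induction_on with
  | C a => simp [adams_C, euler]
  | add f g hf hg => rw [map_add, map_add, map_add, map_add, hf, hg, mul_add]
  | mul_X f k hf =>
    simp only [map_mul, map_add, Derivation.leibniz, hf, adams_X, euler_X, smul_eq_mul,
      map_natCast, PNat.mul_coe, Nat.cast_mul]
    ring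

lemma adams_mem_homog (d : ℕ+) {n : ℕ} {f : Sym Qzw} (hf : f ∈ homog Qzw n) :
    adams d f ∈ homog Qzw (d * n) := by
  rw [mem_homog_iff_euler] at hf ⊢
  rw [euler_adams, hf, map_mul, map_natCast, Nat.cast_mul, mul_assoc]

lemma pairAlmostRow_adams {d : ℕ+} (hd : d ≠ 1) (f : Sym Qzw) :
    pairAlmostRow Qzw (adams d f) = 0 := by
  suffices h : MvPolynomial.pderiv 1 (adams d f) = 0 by rw [pairAlmostRow_apply, h, map_zero]
  induction f using MvPolynomial.induction_on with
  | C a => rw [adams_C, MvPolynomial.pderiv_C]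
  | add f g hf hg => rw [map_add, map_add, hf, hg, add_zero]
  | mul_X f k hf =>
    have hk : d * k ≠ 1 := fun h =>
      hd (PNat.eq (Nat.eq_one_of_mul_eq_one_right (congrArg PNat.val h)))
    rw [map_mul, adams_X, Derivation.leibniz, hf, MvPolynomial.pderiv_X_of_ne hk, smul_zero,
      smul_zero, add_zero]

end Adams

section Omega

lemma cells_diagram_zero (lam : (0 : ℕ).Partition) : (diagram lam).cells = ∅ :=
  Finset.card_eq_zero.1 (card_diagram lam)

lemma constantCoeff_seriesA0 {K : Type*} [Field K] (z w : K) :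
    PowerSeries.constantCoeff (seriesA0 z w) = 1 := by
  rw [← PowerSeries.coeff_zero_eq_constantCoeff_apply, seriesA0, PowerSeries.coeff_mk]
  simp [hook, cells_diagram_zero]

lemma map_evOne_Omega : (Omega 1).map (evOne Qzw : Sym Qzw →+* Qzw) = seriesA0 zVar wVar := by
  ext n
  rw [PowerSeries.coeff_map, Omega, seriesA0, PowerSeries.coeff_mk, PowerSeries.coeff_mk,
    AlgHom.coe_toRingHom, map_sum]
  refine Finset.sum_congr rfl fun lam _ => ?_
  rw [map_smul, (generic_zVar_wVar n).evOne_macdonald lam, smul_eq_mul, mul_one]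

lemma mk_pairAlmostRow_Omega :
    (PowerSeries.mk fun n => pairAlmostRow Qzw (PowerSeries.coeff n (Omega 1))) =
      seriesA1 zVar wVar := by
  ext n
  rw [Omega, seriesA1, PowerSeries.coeff_mk, PowerSeries.coeff_mk, PowerSeries.coeff_mk, map_sum]
  refine Finset.sum_congr rfl fun lam _ => ?_
  rw [map_smul, (generic_zVar_wVar n).pairAlmostRow_macdonald lam, smul_eq_mul]

lemma coeff_Omega_mem_homog (g n : ℕ) : PowerSeries.coeff n (Omega g) ∈ homog Qzw n := by
  rw [Omega, PowerSeries.coeff_mk]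
  exact Submodule.sum_mem _ fun lam _ =>
    Submodule.smul_mem _ _ ((generic_zVar_wVar n).macdonald_mem_homog lam)

lemma constantCoeff_Omega : PowerSeries.constantCoeff (Omega 1) = 1 := by
  rw [← PowerSeries.coeff_zero_eq_constantCoeff_apply]
  have hC : PowerSeries.coeff 0 (Omega 1) = .C ((PowerSeries.coeff 0 (Omega 1)).coeff 0) := by
    ext m
    rw [MvPolynomial.coeff_C]
    split_ifs with hm
    · rw [hm]
    · by_contra hc
      exact hm (weight_eq_zero_iff.1 (coeff_Omega_mem_homog 1 0 hc)).symm
  have h1 := congrArg (PowerSeries.coeff 0) map_evOne_Omega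
  rw [PowerSeries.coeff_map, PowerSeries.coeff_zero_eq_constantCoeff_apply (seriesA0 _ _),
    constantCoeff_seriesA0, AlgHom.coe_toRingHom, hC, ← MvPolynomial.algebraMap_eq,
    AlgHom.commutes, Algebra.algebraMap_self, RingHom.id_apply] at h1
  rw [hC, h1, map_one]

lemma mk_pairAlmostRow_logOf_Omega :
    (PowerSeries.mk fun n =>
        pairAlmostRow Qzw (PowerSeries.coeff n (PowerSeries.logOf (Omega 1)))) =
      seriesA1 zVar wVar * (seriesA0 zVar wVar)⁻¹ := by
  rw [PowerSeries.eq_mul_inv_iff_mul_eq (by simp [constantCoeff_seriesA0]), mul_comm,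
    ← map_evOne_Omega, mul_mk_pairAlmostRow_logOf constantCoeff_Omega, mk_pairAlmostRow_Omega]

lemma coeff_plethLog (F : (Sym Qzw)⟦X⟧) (n : ℕ) :
    PowerSeries.coeff n (plethLog F) = ∑ d ∈ n.divisors,
      (((ArithmeticFunction.moebius d : ℚ) / d : ℚ) : Qzw) •
        adams d.toPNat' (PowerSeries.coeff (n / d) (PowerSeries.logOf F)) := by
  rw [plethLog, PowerSeries.coeff_mk]
  refine Finset.sum_congr rfl fun d _ => MvPolynomial.ext _ _ fun m => ?_
  rw [MvPolynomial.coeff_smul, MvPolynomial.coeff_smul, Algebra.smul_def, eq_ratCast, smul_eq_mul]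

lemma coeff_plethLog_mem_homog {F : (Sym Qzw)⟦X⟧} (hF0 : PowerSeries.constantCoeff F = 1)
    (hF : ∀ n, PowerSeries.coeff n F ∈ homog Qzw n) (n : ℕ) :
    PowerSeries.coeff n (plethLog F) ∈ homog Qzw n := by
  rw [coeff_plethLog]
  refine Submodule.sum_mem _ fun d hd => Submodule.smul_mem _ _ ?_
  have h := adams_mem_homog d.toPNat' (coeff_logOf_mem_homog hF0 hF (n / d))
  rwa [Nat.toPNat'_coe, if_pos (Nat.pos_of_mem_divisors hd),
    Nat.mul_div_cancel' (Nat.dvd_of_mem_divisors hd)] at h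

lemma pairAlmostRow_coeff_plethLog (F : (Sym Qzw)⟦X⟧) {n : ℕ} (hn : n ≠ 0) :
    pairAlmostRow Qzw (PowerSeries.coeff n (plethLog F)) =
      pairAlmostRow Qzw (PowerSeries.coeff n (PowerSeries.logOf F)) := by
  rw [coeff_plethLog, map_sum, Finset.sum_eq_single_of_mem 1 (Nat.one_mem_divisors.2 hn)]
  · have : (1 : ℕ).toPNat' = 1 := rfl
    simp [this, adams_one]
  · intro d hd hd1
    rw [map_smul, pairAlmostRow_adams, smul_zero]
    rw [Ne, ← PNat.coe_eq_one_iff, Nat.toPNat'_coe, if_pos (Nat.pos_of_mem_divisors hd)]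
    exact hd1

lemma charH_almostRow (n : ℕ) (hn : 1 ≤ n) :
    charH 1 (almostRow n hn) = (zVar ^ 2 - 1) * (1 - wVar ^ 2) *
      PowerSeries.coeff n (seriesA1 zVar wVar * (seriesA0 zVar wVar)⁻¹) := by
  have hmem := coeff_plethLog_mem_homog constantCoeff_Omega (coeff_Omega_mem_homog 1) n
  obtain ⟨m, rfl⟩ := Nat.exists_eq_add_of_le' hn
  rw [charH, completeProd_almostRow, Nat.add_sub_cancel, hall_complete_mul_X hmem,
    pairAlmostRow_coeff_plethLog _ m.succ_ne_zero, ← mk_pairAlmostRow_logOf_Omega,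
    PowerSeries.coeff_mk]

end Omega

section Specialization

lemma coeff_inv_mem {K L : Type*} [Field K] [Field L] {S : Subring (K × L)} {F : K⟦X⟧} {G : L⟦X⟧}
    (hF : PowerSeries.constantCoeff F = 1) (hG : PowerSeries.constantCoeff G = 1)
    (h : ∀ n, (PowerSeries.coeff n F, PowerSeries.coeff n G) ∈ S) (n : ℕ) :
    (PowerSeries.coeff n F⁻¹, PowerSeries.coeff n G⁻¹) ∈ S := by
  induction n using Nat.strong_induction_on with
  | _ n ih =>
    rw [PowerSeries.coeff_inv, PowerSeries.coeff_inv, hF, hG, inv_one, inv_one]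
    split_ifs with hn
    · exact S.one_mem
    · rw [neg_one_mul, neg_one_mul]
      refine mk_neg_mem (mk_sum_mem fun x _ => ?_)
      split_ifs with hx
      · exact mk_mul_mem (h _) (ih _ hx)
      · exact S.zero_mem

variable {L : Type*} [Field L] [Algebra ℚ L] {a b : L}
  (h1 : ∀ k l : ℕ, a ^ (2 * k + 2) - b ^ (2 * l) ≠ 0)
  (h2 : ∀ k l : ℕ, a ^ (2 * k) - b ^ (2 * l + 2) ≠ 0)

include h1 h2

lemma hook_mem_specAt (g : ℕ) (D : YoungDiagram) :
    (hook g zVar wVar D, hook g a b D) ∈ specAt a b := by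
  have hsub (k l : ℕ) : (zVar ^ k - wVar ^ l, a ^ k - b ^ l) ∈ specAt a b :=
    mk_sub_mem (mk_pow_mem zVar_mem_specAt k) (mk_pow_mem wVar_mem_specAt l)
  refine mk_prod_mem fun s _ => ?_
  rw [div_eq_mul_inv, div_eq_mul_inv]
  exact mk_mul_mem (mk_pow_mem (hsub _ _) _) (inv_mem_specAt
    (mk_mul_mem (hsub _ _) (hsub _ _)) (mul_ne_zero (h1 _ _) (h2 _ _)))

lemma hasValueAt_charH_almostRow (n : ℕ) (hn : 1 ≤ n) :
    HasValueAt (charH 1 (almostRow n hn)) a b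
      ((a ^ 2 - 1) * (1 - b ^ 2) * PowerSeries.coeff n (seriesA1 a b * (seriesA0 a b)⁻¹)) := by
  have hz : (zVar ^ 2, a ^ 2) ∈ specAt a b := mk_pow_mem zVar_mem_specAt 2
  have hw : (wVar ^ 2, b ^ 2) ∈ specAt a b := mk_pow_mem wVar_mem_specAt 2
  have hhook := hook_mem_specAt h1 h2 1
  have hA0 (m : ℕ) : (PowerSeries.coeff m (seriesA0 zVar wVar),
      PowerSeries.coeff m (seriesA0 a b)) ∈ specAt a b := by
    rw [seriesA0, seriesA0, PowerSeries.coeff_mk, PowerSeries.coeff_mk]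
    exact mk_sum_mem fun lam _ => hhook _
  have hA1 (m : ℕ) : (PowerSeries.coeff m (seriesA1 zVar wVar),
      PowerSeries.coeff m (seriesA1 a b)) ∈ specAt a b := by
    rw [seriesA1, seriesA1, PowerSeries.coeff_mk, PowerSeries.coeff_mk]
    exact mk_sum_mem fun lam _ => mk_mul_mem (hhook _) (phi_mem hz hw _)
  rw [charH_almostRow, PowerSeries.coeff_mul, PowerSeries.coeff_mul]
  exact mk_mul_mem
    (mk_mul_mem (mk_sub_mem hz (specAt a b).one_mem) (mk_sub_mem (specAt a b).one_mem hw))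
    (mk_sum_mem fun x _ => mk_mul_mem (hA1 _) (coeff_inv_mem (constantCoeff_seriesA0 _ _)
      (constantCoeff_seriesA0 _ _) hA0 _))

end Specialization

/-! ### Generating functions of partitions -/

section GenFun

variable {R : Type*} [CommRing R]

/-- Reduction of power series modulo `T ^ (N + 1)`. It is used to compare power series with partial
products of infinite products. -/
abbrev modX (R : Type*) [CommRing R] (N : ℕ) :
    R⟦X⟧ →+* R⟦X⟧ ⧸ Ideal.span {(PowerSeries.X : R⟦X⟧) ^ (N + 1)} :=
  Ideal.Quotient.mk _

lemma modX_eq_iff {N : ℕ} {f g : R⟦X⟧} :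
    modX R N f = modX R N g ↔ ∀ m ≤ N, PowerSeries.coeff m f = PowerSeries.coeff m g := by
  rw [Ideal.Quotient.eq, Ideal.mem_span_singleton, PowerSeries.X_pow_dvd_iff]
  simp only [map_sub, sub_eq_zero, Nat.lt_succ_iff]

lemma modX_X_pow_mul {N m : ℕ} (h : N < m) (f : R⟦X⟧) :
    modX R N (PowerSeries.X ^ m * f) = 0 := by
  rw [Ideal.Quotient.eq_zero_iff_mem, Ideal.mem_span_singleton]
  exact Dvd.dvd.mul_right (pow_dvd_pow _ h) f

lemma modX_expand_eq_one {N k : ℕ} (hk : k ≠ 0) (hN : N < k) {φ : R⟦X⟧}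
    (hφ : PowerSeries.constantCoeff φ = 1) : modX R N (PowerSeries.expand k hk φ) = 1 := by
  rw [← map_one (modX R N), modX_eq_iff]
  intro m hm
  rcases m.eq_zero_or_pos with rfl | hpos
  · simp [hφ]
  · rw [PowerSeries.coeff_expand_of_not_dvd _ _ _ (Nat.not_dvd_of_pos_of_lt hpos (by omega)),
      PowerSeries.coeff_one, if_neg hpos.ne']

open scoped PowerSeries.WithPiTopology in
lemma one_add_tsum_smul_X_pow [TopologicalSpace R] [IsTopologicalRing R] [T2Space R] {k : ℕ}
    (hk : k ≠ 0) {e : ℕ → R} (he : e 0 = 1) :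
    1 + ∑' j, e (j + 1) • (PowerSeries.X : R⟦X⟧) ^ (k * (j + 1)) =
      PowerSeries.expand k hk (.mk e) := by
  have h : HasSum (fun j => e j • (PowerSeries.X : R⟦X⟧) ^ (k * j))
      (PowerSeries.expand k hk (.mk e)) := by
    refine (PowerSeries.WithPiTopology.hasSum_iff_hasSum_coeff R).2 fun n => ?_
    simp only [PowerSeries.coeff_smul, PowerSeries.coeff_X_pow]
    by_cases hn : k ∣ n
    · obtain ⟨m, rfl⟩ := hn
      rw [PowerSeries.coeff_expand_mul, PowerSeries.coeff_mk]
      simpa using hasSum_single (f := fun j => e j * if k * m = k * j then 1 else 0) m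
        fun j hj => by simp [hk, hj.symm]
    · rw [PowerSeries.coeff_expand_of_not_dvd _ _ _ hn]
      convert! hasSum_zero with j
      rw [if_neg (by rintro rfl; exact hn (dvd_mul_right k j)), smul_zero]
  rw [← h.tsum_eq, h.summable.tsum_eq_zero_add, he, mul_zero, pow_zero, one_smul]

open scoped PowerSeries.WithPiTopology in
lemma modX_genFun (N : ℕ) {f : ℕ → ℕ → R} (hf : ∀ k, f k 0 = 1) :
    modX R N (Nat.Partition.genFun f) =
      modX R N (∏ i ∈ range N, PowerSeries.expand (i + 1) i.succ_ne_zero (.mk (f (i + 1)))) := by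
  let : TopologicalSpace R := ⊥
  have : DiscreteTopology R := ⟨rfl⟩
  have hprod := Nat.Partition.hasProd_genFun f
  simp only [one_add_tsum_smul_X_pow (Nat.succ_ne_zero _) (hf _)] at hprod
  rw [HasProd, PowerSeries.WithPiTopology.tendsto_iff_coeff_tendsto] at hprod
  refine modX_eq_iff.2 fun m hm => tendsto_nhds_unique (hprod m)
    (tendsto_atTop_of_eventually_const (i₀ := range N) fun s hs => modX_eq_iff.1 ?_ m hm)
  rw [← Finset.prod_sdiff (show range N ⊆ s from hs), map_mul, map_prod, Finset.prod_eq_one,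
    one_mul]
  intro i hi
  exact modX_expand_eq_one _ (by simpa [Nat.lt_succ_iff] using (Finset.mem_sdiff.1 hi).2)
    (by simp [hf])

lemma expand_one_sub_C_mul_X (a : R) {k : ℕ} (hk : k ≠ 0) :
    PowerSeries.expand k hk (1 - PowerSeries.C a * PowerSeries.X) =
      1 - PowerSeries.C a * PowerSeries.X ^ k := by
  rw [map_sub, map_mul, map_one, PowerSeries.expand_C, PowerSeries.expand_X]

lemma modX_genFun_pow_mul (N : ℕ) (g : ℕ → R) :
    modX R N (Nat.Partition.genFun (fun k c => g k ^ c) *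
      ∏ i ∈ range N, (1 - PowerSeries.C (g (i + 1)) * PowerSeries.X ^ (i + 1))) = 1 := by
  rw [map_mul, modX_genFun N fun k => pow_zero _, ← map_mul, ← Finset.prod_mul_distrib,
    Finset.prod_eq_one, map_one]
  intro i _
  rw [← expand_one_sub_C_mul_X _ i.succ_ne_zero, ← map_mul, mul_comm, one_sub_C_mul_X_mul_mk_pow,
    map_one]

/-- The product `(1 - a T) (1 - a T²) ⋯ (1 - a T^N)`. -/
def qPoch (a : R) (N : ℕ) : R⟦X⟧ :=
  ∏ i ∈ range N, (1 - PowerSeries.C a * PowerSeries.X ^ (i + 1))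

lemma qPoch_succ (a : R) (N : ℕ) :
    qPoch a (N + 1) = qPoch a N * (1 - PowerSeries.C a * PowerSeries.X ^ (N + 1)) :=
  Finset.prod_range_succ _ _

@[simp]
lemma qPoch_zero_right (a : R) : qPoch a 0 = 1 := Finset.prod_range_zero _

@[simp]
lemma qPoch_zero_left (N : ℕ) : qPoch (0 : R) N = 1 := by simp [qPoch]

@[simp]
lemma constantCoeff_qPoch (a : R) (N : ℕ) : PowerSeries.constantCoeff (qPoch a N) = 1 := by
  rw [qPoch, map_prod]
  exact Finset.prod_eq_one fun i _ => by simp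

end GenFun

section Diagrams

open YoungDiagram (rowLen_transpose mem_iff_lt_rowLen mem_iff_lt_colLen)

lemma colLen_eq_zero {D : YoungDiagram} {j : ℕ} (hj : D.card ≤ j) : D.colLen j = 0 := by
  rw [← rowLen_transpose]
  exact rowLen_eq_zero ((card_transpose D).trans_le hj)

lemma lt_colLen_iff {D : YoungDiagram} {i j : ℕ} : i < D.colLen j ↔ j < D.rowLen i := by
  rw [← mem_iff_lt_colLen, mem_iff_lt_rowLen]

lemma prod_cells_eq_prod_col {M : Type*} [CommMonoid M] {D : YoungDiagram} {N : ℕ}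
    (hN : D.colLen N = 0) (f : ℕ × ℕ → M) :
    ∏ s ∈ D.cells, f s = ∏ j ∈ range N, ∏ i ∈ range (D.colLen j), f (i, j) := by
  have h := prod_cells_eq ((rowLen_transpose D N).trans hN) fun s => f s.swap
  simpa only [prod_cells_transpose, rowLen_transpose, Prod.swap_swap, Prod.swap_prod_mk] using h

lemma eig_eq_colLen {K : Type*} [Field K] (q t : K) {D : YoungDiagram} {N : ℕ}
    (hN : D.colLen N = 0) :
    eig q t D = q ^ N + (1 - q) * ∑ j ∈ range N, q ^ j * t ^ D.colLen j := by
  rw [← eig_transpose, eig_eq t q ((rowLen_transpose D N).trans hN)]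
  simp only [rowLen_transpose]

lemma parts_eq_map_rowLen {n : ℕ} (lam : n.Partition) :
    lam.parts = (Multiset.range ((diagram lam).colLen 0)).map (diagram lam).rowLen := by
  have hrow : (diagram lam).rowLens = lam.parts.sort (· ≥ ·) :=
    YoungDiagram.rowLens_ofRowLens_eq_self fun _ hx => lam.parts_pos ((Multiset.mem_sort _).1 hx)
  rw [← Multiset.sort_eq lam.parts (· ≥ ·), ← hrow]
  rfl

lemma filter_lt_rowLen (D : YoungDiagram) (j : ℕ) :
    (range (D.colLen 0)).filter (j < D.rowLen ·) = range (D.colLen j) := by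
  ext i
  rw [Finset.mem_filter, Finset.mem_range, Finset.mem_range, ← lt_colLen_iff]
  exact and_iff_right_of_imp fun h => h.trans_le (D.colLen_anti 0 j j.zero_le)

lemma card_filter_lt_parts {n : ℕ} (lam : n.Partition) (j : ℕ) :
    (lam.parts.filter (j < ·)).card = (diagram lam).colLen j := by
  rw [parts_eq_map_rowLen, Multiset.filter_map, Multiset.card_map,
    ← Finset.card_range ((diagram lam).colLen j), ← filter_lt_rowLen]
  rfl

lemma colLen_diagram_eq_add_count {n : ℕ} (lam : n.Partition) (j : ℕ) :
    (diagram lam).colLen j = (diagram lam).colLen (j + 1) + lam.parts.count (j + 1) := by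
  have hand : lam.parts.filter (fun k => j + 1 < k ∧ j + 1 = k) = 0 :=
    Multiset.filter_eq_nil.2 fun k _ => by omega
  rw [← card_filter_lt_parts, ← card_filter_lt_parts, Multiset.count_eq_card_filter_eq,
    ← Multiset.card_add, Multiset.filter_add_filter, hand, add_zero]
  exact congrArg Multiset.card (Multiset.filter_congr fun k _ => by omega)

lemma toFinsupp_prod_pow {M : Type*} [CommMonoid M] (m : Multiset ℕ) (g : ℕ → M) :
    (Multiset.toFinsupp m).prod (fun k c => g k ^ c) = (m.map g).prod := by
  rw [Finset.prod_multiset_map_count, Finsupp.prod, Multiset.toFinsupp_support]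
  rfl

lemma toFinsupp_prod_ite_pow {n : ℕ} (lam : n.Partition) {M : Type*} [CommMonoid M] (x : M)
    (j : ℕ) : (Multiset.toFinsupp lam.parts).prod (fun k c => (if j < k then x else 1) ^ c) =
      x ^ (diagram lam).colLen j := by
  rw [toFinsupp_prod_pow, parts_eq_map_rowLen, Multiset.map_map]
  change ∏ i ∈ range _, (if j < (diagram lam).rowLen i then x else 1) = _
  rw [Finset.prod_ite, filter_lt_rowLen, Finset.prod_const, Finset.prod_const_one, mul_one,
    Finset.card_range]

end Diagrams

section EigenvalueSeries

variable {K : Type*} [Field K]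

lemma qPoch_mul_inv (a : K) (N : ℕ) : qPoch a N * (qPoch a N)⁻¹ = 1 :=
  PowerSeries.mul_inv_cancel _ (by simp)

lemma inv_qPoch_eq (a : K) (N : ℕ) :
    (qPoch a N)⁻¹ = (1 - PowerSeries.C a * PowerSeries.X ^ (N + 1)) * (qPoch a (N + 1))⁻¹ := by
  rw [PowerSeries.eq_mul_inv_iff_mul_eq (by simp), qPoch_succ, ← mul_assoc,
    PowerSeries.inv_mul_cancel _ (by simp), one_mul]

lemma hilbH_eq (n : ℕ) (z w : K) : hilbH n z w = PowerSeries.coeff n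
    (qPoch (z * w) n ^ 2 * (qPoch (z ^ 2) n * qPoch (w ^ 2) n)⁻¹) := by
  have hshift (f : ℕ → K⟦X⟧) : ∏ m ∈ Finset.Icc 1 n, f m = ∏ i ∈ range n, f (i + 1) := by
    rw [Finset.range_eq_Ico, Finset.prod_Ico_add' f 0 n 1]
    rfl
  rw [hilbH, hshift, Finset.prod_mul_distrib, Finset.prod_pow]
  congr 2
  rw [PowerSeries.eq_inv_iff_mul_eq_one (by simp), qPoch, qPoch, ← Finset.prod_mul_distrib,
    ← Finset.prod_mul_distrib]
  exact Finset.prod_eq_one fun i _ => PowerSeries.inv_mul_cancel _ (by simp)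

/-- The series `∑_λ 𝓗_λ(z, w) (1 - (1 - z²)(1 - w²) φ_λ(z², w²)) T ^ |λ|`. Its quotient by
`A_0(z, w; T)` is the generating function `1 + (z² - 1)(1 - w²) A_1 / A_0`. -/
def hookEigSeries (z w : K) : K⟦X⟧ :=
  .mk fun n => ∑ lam : n.Partition, hook 1 z w (diagram lam) * eig (z ^ 2) (w ^ 2) (diagram lam)

lemma seriesA0_add_C_mul_seriesA1 (z w : K) :
    seriesA0 z w + PowerSeries.C ((z ^ 2 - 1) * (1 - w ^ 2)) * seriesA1 z w =
      hookEigSeries z w := by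
  ext n
  rw [map_add, PowerSeries.coeff_C_mul, seriesA0, seriesA1, hookEigSeries, PowerSeries.coeff_mk,
    PowerSeries.coeff_mk, PowerSeries.coeff_mk, Finset.mul_sum, ← Finset.sum_add_distrib]
  refine Finset.sum_congr rfl fun lam _ => ?_
  rw [eig]
  ring

lemma one_add_C_mul_seriesA1_mul_inv_eq {z w : K}
    (h : ∀ N, modX K N (hookEigSeries z w * (qPoch (z ^ 2) N * qPoch (w ^ 2) N)) =
      modX K N (seriesA0 z w * qPoch (z * w) N ^ 2)) :
    1 + PowerSeries.C ((z ^ 2 - 1) * (1 - w ^ 2)) * (seriesA1 z w * (seriesA0 z w)⁻¹) =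
      .mk fun n => hilbH n z w := by
  have hA : seriesA0 z w * (seriesA0 z w)⁻¹ = 1 :=
    PowerSeries.mul_inv_cancel _ (by simp [constantCoeff_seriesA0])
  ext n
  set u := qPoch (z ^ 2) n * qPoch (w ^ 2) n
  have hu : u * u⁻¹ = 1 := PowerSeries.mul_inv_cancel _ (by simp [u])
  rw [PowerSeries.coeff_mk, hilbH_eq, ← mul_assoc, ← hA, ← add_mul, seriesA0_add_C_mul_seriesA1]
  refine modX_eq_iff.1 ?_ n le_rfl
  calc modX K n (hookEigSeries z w * (seriesA0 z w)⁻¹)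
      = modX K n (hookEigSeries z w * u) * modX K n ((seriesA0 z w)⁻¹ * u⁻¹) := by
        rw [← map_mul]
        congr 1
        linear_combination -(hookEigSeries z w * (seriesA0 z w)⁻¹) * hu
    _ = modX K n (qPoch (z * w) n ^ 2 * u⁻¹) := by
        rw [h, ← map_mul]
        congr 1
        linear_combination (qPoch (z * w) n ^ 2 * u⁻¹) * hA

end EigenvalueSeries

/-! ### The curve `w = 1 / z` -/

section Curve

variable {K : Type*} [Field K]

/-- The series `∑_λ x ^ (λ'_{j+1}) T ^ |λ|`, which counts partitions by the length of a column. -/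
def colSeries (x : K) (j : ℕ) : K⟦X⟧ :=
  .mk fun n => ∑ lam : n.Partition, x ^ (diagram lam).colLen j

lemma colSeries_eq_genFun (x : K) (j : ℕ) :
    colSeries x j = Nat.Partition.genFun fun k c => (if j < k then x else 1) ^ c := by
  ext n
  rw [colSeries, PowerSeries.coeff_mk, Nat.Partition.coeff_genFun]
  exact Finset.sum_congr rfl fun lam _ => (toFinsupp_prod_ite_pow lam x j).symm

lemma modX_colSeries (x : K) {j N : ℕ} (hj : j ≤ N) :
    modX K N (colSeries x j * qPoch x N) = modX K N (qPoch x j * (qPoch 1 j)⁻¹) := by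
  set P : K⟦X⟧ := ∏ i ∈ Finset.Ico j N, (1 - PowerSeries.C x * PowerSeries.X ^ (i + 1))
  have hsplit : ∏ i ∈ range N,
      (1 - PowerSeries.C (if j < i + 1 then x else (1 : K)) * PowerSeries.X ^ (i + 1)) =
      qPoch 1 j * P := by
    rw [← Finset.prod_range_mul_prod_Ico _ hj, qPoch]
    refine congrArg₂ (· * ·) (Finset.prod_congr rfl fun i hi => ?_)
      (Finset.prod_congr rfl fun i hi => ?_)
    · rw [if_neg (by have := Finset.mem_range.1 hi; omega)]
    · rw [if_pos (by have := Finset.mem_Ico.1 hi; omega)]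
  have hgen : modX K N (colSeries x j * (qPoch 1 j * P)) = 1 := by
    rw [← hsplit, colSeries_eq_genFun]
    exact modX_genFun_pow_mul N fun k => if j < k then x else (1 : K)
  rw [← one_mul (modX K N (qPoch x j * _)), ← hgen, ← map_mul, qPoch,
    ← Finset.prod_range_mul_prod_Ico _ hj, ← qPoch]
  congr 1
  linear_combination -(colSeries x j * qPoch x j * P) * qPoch_mul_inv (1 : K) j

/-- The generating function of the eigenvalues `1 - (1 - q)(1 - t) φ_λ(q, t)`. -/
def eigSeries (q t : K) : K⟦X⟧ := .mk fun n => ∑ lam : n.Partition, eig q t (diagram lam)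

lemma modX_eigSeries (q t : K) (N : ℕ) :
    modX K N (eigSeries q t) = modX K N (PowerSeries.C (q ^ N) * colSeries t N +
      PowerSeries.C (1 - q) * ∑ j ∈ range N, PowerSeries.C (q ^ j) * colSeries t j) := by
  refine modX_eq_iff.2 fun n hn => ?_
  have hcol (lam : n.Partition) : (diagram lam).colLen N = 0 :=
    colLen_eq_zero ((card_diagram lam).trans_le hn)
  simp only [eigSeries, colSeries, PowerSeries.coeff_mk, map_add, map_sum, PowerSeries.coeff_C_mul,
    eig_eq_colLen q t (hcol _), Finset.sum_add_distrib, ← Finset.mul_sum, hcol, pow_zero,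
    Finset.sum_const, nsmul_one]
  rw [Finset.sum_comm]
  simp only [← Finset.mul_sum, nsmul_eq_mul, mul_comm (q ^ N)]

/-- The coefficient `((1 - x)(1 - x T) ⋯ (1 - x T^(k-1))) / ((1 - T) ⋯ (1 - T^k))` of the
`T`-binomial series. -/
def binomCoeff (x : K) (k : ℕ) : K⟦X⟧ :=
  (∏ i ∈ range k, (1 - PowerSeries.C x * PowerSeries.X ^ i)) * (qPoch 1 k)⁻¹

lemma binomCoeff_zero (x : K) : binomCoeff x 0 = 1 := by simp [binomCoeff]

lemma binomCoeff_succ_mul (x : K) (k : ℕ) :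
    binomCoeff x (k + 1) * (1 - PowerSeries.X ^ (k + 1)) =
      binomCoeff x k * (1 - PowerSeries.C x * PowerSeries.X ^ k) := by
  have h := inv_qPoch_eq (1 : K) k
  rw [map_one, one_mul] at h
  rw [binomCoeff, binomCoeff, h, Finset.prod_range_succ]
  ring

lemma binomCoeff_succ (x : K) (k : ℕ) :
    binomCoeff x (k + 1) = PowerSeries.C (1 - x) * qPoch x k * (qPoch 1 (k + 1))⁻¹ := by
  rw [binomCoeff, Finset.prod_range_succ', pow_zero, mul_one, map_sub, map_one, ← qPoch,
    mul_comm (qPoch x k)]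

lemma abel_sum_qPoch (q x : K) (N : ℕ) :
    PowerSeries.C (q ^ N) * (qPoch x N * (qPoch 1 N)⁻¹) + PowerSeries.C (1 - q) *
      ∑ j ∈ range N, PowerSeries.C (q ^ j) * (qPoch x j * (qPoch 1 j)⁻¹) =
    ∑ k ∈ range (N + 1), PowerSeries.C (q ^ k) * PowerSeries.X ^ k * binomCoeff x k := by
  induction N with
  | zero => simp [binomCoeff_zero]
  | succ N ih =>
    rw [Finset.sum_range_succ _ (N + 1), ← ih, Finset.sum_range_succ, binomCoeff_succ,
      qPoch_succ x, inv_qPoch_eq 1 N]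
    simp only [map_one, map_sub, map_pow]
    ring

/-- The partial sum `∑_{n ≤ N} (q T^k)^n binomCoeff x n` of the `T`-binomial series at `q T^k`. -/
def binomSum (q x : K) (N k : ℕ) : K⟦X⟧ :=
  ∑ n ∈ range (N + 1), PowerSeries.C (q ^ n) * PowerSeries.X ^ (k * n) * binomCoeff x n

lemma binomSum_succ (q x : K) (N k : ℕ) : binomSum q x (N + 1) k = binomSum q x N k +
    PowerSeries.C (q ^ (N + 1)) * PowerSeries.X ^ (k * (N + 1)) * binomCoeff x (N + 1) :=
  Finset.sum_range_succ _ _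

-- The functional equation `(1 - u) f(u) = (1 - x u) f(T u)` of the binomial series at `u = q T^k`,
-- where `x u = T^k`, with the error term of the truncation.
lemma one_sub_mul_binomSum {q x : K} (hx : q * x = 1) (N k : ℕ) :
    (1 - PowerSeries.C q * PowerSeries.X ^ k) * binomSum q x N k +
      PowerSeries.X ^ (k * (N + 1)) * (PowerSeries.C (q ^ (N + 1)) * binomCoeff x N *
        (1 - PowerSeries.C x * PowerSeries.X ^ N)) =
      (1 - PowerSeries.X ^ k) * binomSum q x N (k + 1) := by
  have hC : PowerSeries.C q * PowerSeries.C x = 1 := by rw [← map_mul, hx, map_one]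
  induction N with
  | zero =>
    simp only [binomSum, zero_add, Finset.sum_range_one, binomCoeff_zero, pow_zero, map_one,
      mul_zero, mul_one, pow_one]
    linear_combination (-PowerSeries.X ^ k) * hC
  | succ N ih =>
    rw [binomSum_succ, binomSum_succ]
    simp only [map_pow] at ih ⊢
    rw [show (k + 1) * (N + 1) = k * (N + 1) + (N + 1) by ring,
      show k * (N + 1 + 1) = k * (N + 1) + k by ring]
    simp only [pow_add _ (k * (N + 1))]
    linear_combination ih +
      (PowerSeries.X ^ (k * (N + 1)) * PowerSeries.C q ^ (N + 1)) * binomCoeff_succ_mul x N -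
      (PowerSeries.X ^ (k * (N + 1)) * PowerSeries.C q ^ (N + 1) * binomCoeff x (N + 1) *
        PowerSeries.X ^ k * PowerSeries.X ^ (N + 1)) * hC

lemma modX_binomSum_mul_qPoch {q x : K} (hx : q * x = 1) (N k : ℕ) :
    modX K N (binomSum q x N 1 * qPoch q k) = modX K N (qPoch 1 k * binomSum q x N (k + 1)) := by
  induction k with
  | zero => simp
  | succ k ih =>
    rw [qPoch_succ, ← mul_assoc, map_mul, ih, ← map_mul, qPoch_succ, mul_assoc, mul_assoc,
      map_mul, map_mul _ (qPoch 1 k), map_one, one_mul, ← one_sub_mul_binomSum hx, map_add,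
      modX_X_pow_mul (by nlinarith), add_zero, mul_comm (binomSum _ _ _ _)]

lemma modX_binomSum_self (q x : K) (N : ℕ) : modX K N (binomSum q x N (N + 1)) = 1 := by
  rw [binomSum, Finset.sum_range_succ', map_add, map_sum, Finset.sum_eq_zero, zero_add]
  · simp [binomCoeff_zero]
  · intro i _
    rw [mul_assoc, mul_left_comm, modX_X_pow_mul (by nlinarith)]

lemma modX_eigSeries_mul_qPoch (q x : K) (N : ℕ) :
    modX K N (eigSeries q x * qPoch x N) = modX K N (binomSum q x N 1) := by
  have hbinom : binomSum q x N 1 = ∑ k ∈ range (N + 1),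
      PowerSeries.C (q ^ k) * PowerSeries.X ^ k * binomCoeff x k := by simp only [binomSum, one_mul]
  rw [hbinom, ← abel_sum_qPoch, map_mul, modX_eigSeries, ← map_mul, add_mul, mul_assoc, mul_assoc,
    Finset.sum_mul]
  simp only [mul_assoc]
  rw [map_add, map_add, map_mul, modX_colSeries x le_rfl, map_mul _ (PowerSeries.C (1 - q)),
    map_mul _ (PowerSeries.C (1 - q)), map_sum, map_sum, map_mul]
  refine congrArg₂ (· + ·) rfl (congrArg _ (Finset.sum_congr rfl fun j hj => ?_))
  rw [map_mul, modX_colSeries x (Finset.mem_range.1 hj).le, ← map_mul]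

lemma modX_eigSeries_mul {q x : K} (hx : q * x = 1) (N : ℕ) :
    modX K N (eigSeries q x * (qPoch q N * qPoch x N)) = modX K N (qPoch 1 N) := by
  rw [mul_comm (qPoch q N), ← mul_assoc, map_mul, modX_eigSeries_mul_qPoch, ← map_mul,
    modX_binomSum_mul_qPoch hx, map_mul, modX_binomSum_self, mul_one]

variable {x : K} (hx0 : x ≠ 0) (hx : ∀ m : ℕ, m ≠ 0 → x ^ m ≠ 1)

include hx0 hx

lemma pow_sub_inv_pow_ne_zero {m n : ℕ} (hmn : m + n ≠ 0) : x ^ m - x⁻¹ ^ n ≠ 0 := by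
  rw [inv_pow, sub_ne_zero, Ne, ← mul_eq_one_iff_eq_inv₀ (pow_ne_zero n hx0), ← pow_add]
  exact hx _ hmn

lemma hook_inv_eq_one (D : YoungDiagram) : hook 1 x x⁻¹ D = 1 := by
  refine Finset.prod_eq_one fun s _ => ?_
  rw [div_eq_one_iff_eq (mul_ne_zero (pow_sub_inv_pow_ne_zero hx0 hx (by omega))
    (pow_sub_inv_pow_ne_zero hx0 hx (by omega)))]
  generalize arm D s = a
  generalize leg D s = l
  have hsub (m n : ℕ) : x ^ m - x⁻¹ ^ n = (x ^ (m + n) - 1) * x⁻¹ ^ n := by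
    rw [sub_mul, one_mul, pow_add, mul_assoc, ← mul_pow, mul_inv_cancel₀ hx0, one_pow, mul_one]
  rw [hsub, hsub, hsub, show 2 * a + 1 + (2 * l + 1) = 2 * a + 2 * l + 2 by ring,
    show 2 * a + 2 + 2 * l = 2 * a + 2 * l + 2 by ring,
    show 2 * a + (2 * l + 2) = 2 * a + 2 * l + 2 by ring]
  ring

lemma modX_hookEigSeries_inv (N : ℕ) :
    modX K N (hookEigSeries x x⁻¹ * (qPoch (x ^ 2) N * qPoch (x⁻¹ ^ 2) N)) =
      modX K N (seriesA0 x x⁻¹ * qPoch (x * x⁻¹) N ^ 2) := by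
  have hE : hookEigSeries x x⁻¹ = eigSeries (x ^ 2) (x⁻¹ ^ 2) := by
    simp only [hookEigSeries, eigSeries, hook_inv_eq_one hx0 hx, one_mul]
  have hA : seriesA0 x x⁻¹ = colSeries 1 0 := by
    simp only [seriesA0, colSeries, hook_inv_eq_one hx0 hx, one_pow]
  have hinv : x ^ 2 * x⁻¹ ^ 2 = 1 := by rw [← mul_pow, mul_inv_cancel₀ hx0, one_pow]
  rw [hE, modX_eigSeries_mul hinv, hA, mul_inv_cancel₀ hx0, pow_two, ← mul_assoc, map_mul,
    modX_colSeries 1 N.zero_le]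
  simp

end Curve

/-! ### The line `z = 0` -/

section Line

variable {K : Type*} [Field K]

/-- The reciprocal `1 / ((1 - u) ⋯ (1 - u^m))` of the unnormalized `u`-factorial. -/
def invFactorial (u : K) (m : ℕ) : K := ∏ l ∈ range m, (1 - u ^ (l + 1))⁻¹

@[simp]
lemma invFactorial_zero (u : K) : invFactorial u 0 = 1 := Finset.prod_range_zero _

lemma eig_zero (t : K) (D : YoungDiagram) : eig 0 t D = t ^ D.colLen 0 := by
  rw [eig_eq_colLen 0 t (colLen_eq_zero D.card.le_succ), Finset.sum_range_succ',
    Finset.sum_eq_zero fun i _ => by simp]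
  simp

lemma prod_col_ite_arm_eq_zero {n : ℕ} (lam : n.Partition) (u : K) (j : ℕ) :
    ∏ i ∈ range ((diagram lam).colLen j), (if arm (diagram lam) (i, j) = 0
      then (1 - u ^ (leg (diagram lam) (i, j) + 1))⁻¹ else 1) =
      invFactorial u (lam.parts.count (j + 1)) := by
  have hcount := colLen_diagram_eq_add_count lam j
  have harm (i : ℕ) : arm (diagram lam) (i, j) = 0 ↔ (diagram lam).colLen (j + 1) ≤ i := by
    rw [arm, Nat.sub_eq_zero_iff_le, ← not_lt, ← not_lt, lt_colLen_iff]
  rw [← Finset.prod_range_mul_prod_Ico _ (hcount.symm ▸ Nat.le_add_right _ _),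
    Finset.prod_eq_one fun i hi => if_neg fun h =>
      (Finset.mem_range.1 hi).not_ge ((harm i).1 h), one_mul,
    Finset.prod_Ico_eq_prod_range, invFactorial, ← Finset.prod_range_reflect, hcount,
    Nat.add_sub_cancel_left]
  refine Finset.prod_congr rfl fun i hi => ?_
  have hi' := Finset.mem_range.1 hi
  rw [if_pos ((harm _).2 (Nat.le_add_right _ _)), leg]
  congr 3
  dsimp only
  omega

lemma one_sub_C_mul_X_mul_mk_invFactorial {t : K} (ht : ∀ m : ℕ, m ≠ 0 → t ^ m ≠ 1)
    (ht0 : t ≠ 0) :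
    (1 - PowerSeries.C t * PowerSeries.X) * .mk (fun m => invFactorial t⁻¹ m * t ^ m) =
      .mk (invFactorial t⁻¹) := by
  ext m
  rw [sub_mul, one_mul, mul_assoc, map_sub, PowerSeries.coeff_C_mul, PowerSeries.coeff_mk,
    PowerSeries.coeff_mk]
  rcases m with - | m
  · simp
  · have h : t ^ (m + 1) - 1 ≠ 0 := sub_ne_zero.2 (ht _ m.succ_ne_zero)
    have hinv : (1 - t⁻¹ ^ (m + 1))⁻¹ = t ^ (m + 1) / (t ^ (m + 1) - 1) := by
      rw [inv_pow]
      field_simp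
    rw [PowerSeries.coeff_succ_X_mul, PowerSeries.coeff_mk, invFactorial, Finset.prod_range_succ,
      ← invFactorial, hinv]
    linear_combination invFactorial t⁻¹ m * div_mul_cancel₀ (t ^ (m + 1)) h

variable {x : K} (hx0 : x ≠ 0) (hx : ∀ m : ℕ, m ≠ 0 → x ^ m ≠ 1)

include hx0 hx

lemma zero_pow_sub_pow_ne_zero {m n : ℕ} (hmn : m + n ≠ 0) : (0 : K) ^ m - x ^ n ≠ 0 := by
  rcases m with - | m
  · rw [pow_zero, sub_ne_zero]
    exact (hx n (by omega)).symm
  · simp [hx0]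

lemma hook_factor_zero (a l : ℕ) :
    ((0 : K) ^ (2 * a + 1) - x ^ (2 * l + 1)) ^ (2 * 1) /
      ((0 ^ (2 * a + 2) - x ^ (2 * l)) * (0 ^ (2 * a) - x ^ (2 * l + 2))) =
      if a = 0 then (1 - (x ^ 2)⁻¹ ^ (l + 1))⁻¹ else 1 := by
  have hsub : x ^ (2 * l + 2) - 1 ≠ 0 := sub_ne_zero.2 (hx _ (by omega))
  have hsub' : 1 - x ^ (2 * l + 2) ≠ 0 := sub_ne_zero.2 (hx _ (by omega)).symm
  rw [zero_pow (by omega), zero_pow (by omega)]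
  split_ifs with ha
  · rw [ha, mul_zero, pow_zero, inv_pow, ← pow_mul, show 2 * (l + 1) = 2 * l + 2 by ring]
    field_simp
    ring
  · rw [zero_pow (by omega), div_eq_one_iff_eq (by simp [hx0])]
    ring

lemma hook_zero {n : ℕ} (lam : n.Partition) : hook 1 0 x (diagram lam) =
    (Multiset.toFinsupp lam.parts).prod fun _ c => invFactorial (x ^ 2)⁻¹ c := by
  rw [hook, Finset.prod_congr rfl fun s _ => hook_factor_zero hx0 hx _ _,
    prod_cells_eq_prod_col (colLen_eq_zero (card_diagram lam).le),
    Finset.prod_congr rfl fun j _ => prod_col_ite_arm_eq_zero lam _ j,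
    Finsupp.prod_of_support_subset _ (s := (range n).image (· + 1)) _ _ fun _ _ => by simp,
    Finset.prod_image (add_left_injective 1).injOn]
  · rfl
  · intro k hk
    rw [Multiset.toFinsupp_support, Multiset.mem_toFinset] at hk
    have hpos := lam.parts_pos hk
    have hle := lam.le_of_mem_parts hk
    exact Finset.mem_image.2 ⟨k - 1, Finset.mem_range.2 (by omega), by omega⟩

lemma seriesA0_zero_eq_genFun :
    seriesA0 0 x = Nat.Partition.genFun fun _ c => invFactorial (x ^ 2)⁻¹ c := by
  ext n
  rw [seriesA0, PowerSeries.coeff_mk, Nat.Partition.coeff_genFun]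
  exact Finset.sum_congr rfl fun lam _ => hook_zero hx0 hx lam

lemma hookEigSeries_zero_eq_genFun : hookEigSeries 0 x =
    Nat.Partition.genFun fun k c =>
      invFactorial (x ^ 2)⁻¹ c * (if 0 < k then x ^ 2 else 1) ^ c := by
  ext n
  rw [hookEigSeries, PowerSeries.coeff_mk, Nat.Partition.coeff_genFun]
  refine Finset.sum_congr rfl fun lam _ => ?_
  rw [Finsupp.prod_mul, toFinsupp_prod_ite_pow, ← hook_zero hx0 hx, zero_pow two_ne_zero, eig_zero]

lemma modX_hookEigSeries_zero (N : ℕ) :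
    modX K N (hookEigSeries 0 x * (qPoch (0 ^ 2) N * qPoch (x ^ 2) N)) =
      modX K N (seriesA0 0 x * qPoch (0 * x) N ^ 2) := by
  have hpow (m : ℕ) (hm : m ≠ 0) : (x ^ 2) ^ m ≠ 1 := by
    rw [← pow_mul]
    exact hx _ (by omega)
  rw [zero_pow two_ne_zero, zero_mul, qPoch_zero_left, one_mul, one_pow, mul_one,
    hookEigSeries_zero_eq_genFun hx0 hx, seriesA0_zero_eq_genFun hx0 hx, map_mul,
    modX_genFun N fun _ => by simp, modX_genFun N fun _ => by simp, ← map_mul, qPoch,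
    ← Finset.prod_mul_distrib]
  refine congrArg _ (Finset.prod_congr rfl fun i _ => ?_)
  simp only [Nat.succ_pos, if_true]
  rw [← expand_one_sub_C_mul_X _ i.succ_ne_zero, mul_comm, ← map_mul,
    one_sub_C_mul_X_mul_mk_invFactorial hpow (pow_ne_zero 2 hx0)]

end Line

section HilbertValue

variable {L : Type*} [Field L] [Algebra ℚ L]

lemma hasValueAt_charH_almostRow_hilbH {a b : L}
    (h1 : ∀ k l : ℕ, a ^ (2 * k + 2) - b ^ (2 * l) ≠ 0)
    (h2 : ∀ k l : ℕ, a ^ (2 * k) - b ^ (2 * l + 2) ≠ 0)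
    (h : 1 + PowerSeries.C ((a ^ 2 - 1) * (1 - b ^ 2)) * (seriesA1 a b * (seriesA0 a b)⁻¹) =
      .mk fun n => hilbH n a b) (n : ℕ) (hn : 1 ≤ n) :
    HasValueAt (charH 1 (almostRow n hn)) a b (hilbH n a b) := by
  have hcoeff := congrArg (PowerSeries.coeff n) h
  rw [map_add, PowerSeries.coeff_one, if_neg (by omega), zero_add, PowerSeries.coeff_C_mul,
    PowerSeries.coeff_mk] at hcoeff
  exact hcoeff ▸ hasValueAt_charH_almostRow h1 h2 n hn

end HilbertValue

end HilbChar

end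

open HilbChar in
theorem theorem4p9_general {L : Type*} [Field L] [Algebra ℚ L] {x : L} (hx0 : x ≠ 0)
    (hx : ∀ m : ℕ, m ≠ 0 → x ^ m ≠ 1) :
    (∀ (n : ℕ) (hn : 1 ≤ n),
      HasValueAt (charH 1 (almostRow n hn)) x x⁻¹ (hilbH n x x⁻¹)) ∧
    (1 + PowerSeries.C ((x ^ 2 - 1) * (1 - x⁻¹ ^ 2)) * (seriesA1 x x⁻¹ * (seriesA0 x x⁻¹)⁻¹) =
      .mk fun n => hilbH n x x⁻¹) ∧
    (∀ (n : ℕ) (hn : 1 ≤ n), HasValueAt (charH 1 (almostRow n hn)) 0 x (hilbH n 0 x)) := by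
  have hcurve := one_add_C_mul_seriesA1_mul_inv_eq (modX_hookEigSeries_inv hx0 hx)
  have hline := one_add_C_mul_seriesA1_mul_inv_eq (modX_hookEigSeries_zero hx0 hx)
  exact ⟨hasValueAt_charH_almostRow_hilbH (fun k l => pow_sub_inv_pow_ne_zero hx0 hx (by omega))
      (fun k l => pow_sub_inv_pow_ne_zero hx0 hx (by omega)) hcurve, hcurve,
    hasValueAt_charH_almostRow_hilbH (fun k l => zero_pow_sub_pow_ne_zero hx0 hx (by omega))
      (fun k l => zero_pow_sub_pow_ne_zero hx0 hx (by omega)) hline⟩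

open HilbChar in
theorem theorem4p9 :
    (∀ (n : ℕ) (hn : 1 ≤ n),
      HasValueAt (charH 1 (almostRow n hn)) (RatFunc.X : RatFunc ℚ) (RatFunc.X)⁻¹
        (hilbH n (RatFunc.X : RatFunc ℚ) (RatFunc.X)⁻¹)) ∧
    (1 + PowerSeries.C (((RatFunc.X : RatFunc ℚ) ^ 2 - 1) * (1 - ((RatFunc.X)⁻¹) ^ 2)) *
        (seriesA1 (RatFunc.X : RatFunc ℚ) (RatFunc.X)⁻¹ *
          (seriesA0 (RatFunc.X : RatFunc ℚ) (RatFunc.X)⁻¹)⁻¹) =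
      PowerSeries.mk fun n => hilbH n (RatFunc.X : RatFunc ℚ) (RatFunc.X)⁻¹) ∧
    (∀ (n : ℕ) (hn : 1 ≤ n),
      HasValueAt (charH 1 (almostRow n hn)) (0 : RatFunc ℚ) RatFunc.X
        (hilbH n (0 : RatFunc ℚ) RatFunc.X)) := by
  exact theorem4p9_general RatFunc.X_ne_zero fun _ hm h =>
    transcendental_ratFunc_X.pow (Nat.pos_of_ne_zero hm) (h ▸ isAlgebraic_one)
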